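/- Knots are regarded as knot diagrams on the $2$-sphere up to Reidemeister moves. A *triple-crossing diagram* of a knot $K$ is a diagram of $K$ on the sphere all of whose multiple points are triple points at which three strands (top, middle, bottom) cross pairwise transversally; it represents the knot obtained by perturbing each triple point into three double crossings with the corresponding over/under information. The *triple-crossing number* $c_3(K)$ is the least number of triple crossings of a triple-crossing diagram of $K$, and a triple-crossing diagram of $K$ is *minimal* if it has exactly $c_3(K)$ triple crossings. A *delta-crossing* is a tangle of three arcs with three double crossings, in which each pair of arcs crosses once, the crossings are the corners of a triangle, and each arc passes over one of the other two arcs and under the other one. A *delta-crossing diagram* is a double-crossing diagram that decomposes into delta-crossings joined by simple arcs, and the *delta-crossing number* $c_\Delta(K)$ is the least number of delta-crossings of a delta-crossing diagram of $K$. The *projection* of a triple-crossing diagram is the underlying $6$-valent graph on the sphere. It contains a tangle $T_3$ if it has three distinct triple points that are the vertices of a triangular face one of whose sides is also a side of a bigon face. It contains a tangle $T_4$ if it has four distinct triple points $v_1,v_2,v_3,v_4$ such that, for $i=1,2,3$, the points $v_i$ and $v_{i+1}$ are the vertices of a bigon face having a side $b_i$ from $v_i$ to $v_{i+1}$, and $b_1,b_2,b_3$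 are consecutive edges on the boundary of one face (on the side of the $b_i$ opposite to the bigons). **Corollary.** Let $K$ be a non-trivial knot. If the projection of some minimal triple-crossing diagram of $K$ contains neither a tangle $T_3$ nor a tangle $T_4$, then $2c_3(K)-1\ge c_\Delta(K)$. -/

import Mathlib

/-!
Knot diagrams on the 2-sphere, given by planar diagram codes, and knots as classes of such
diagrams under the Reidemeister moves.  Diagrams may have double crossings and triple crossings.

The edges of a diagram are named by natural numbers.  Each node lists the edges at that point
in counterclockwise order.
-/

namespace KnotTheory

/-- A node of a diagram, with its edges in counterclockwise order.
* `arc a b` is a marker point on a strand, which joins the edges `a` and `b`.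
* `double a b c d` is a double crossing; the strand `a`-`c` passes under the strand `b`-`d`.
* `triple h a b c d e f` is a triple crossing of the strands number `0`, `1`, `2`, which are
  `a`-`d`, `b`-`e` and `c`-`f`; strand `k` lies at height `h k`, so that the strands at the
  heights `2`, `1`, `0` are the top, the middle and the bottom one. -/
inductive Node where
  | arc (a b : ℕ)
  | double (a b c d : ℕ)
  | triple (h : Equiv.Perm (Fin 3)) (a b c d e f : ℕ)

namespace Node

/-- The edges at a node in counterclockwise order. -/
def legs : Node → List ℕ
  | arc a b => [a, b]
  | double a b c d => [a, b, c, d]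
  | triple _ a b c d e f => [a, b, c, d, e, f]

/-- Rename the edges at a node. -/
def relabel (g : ℕ → ℕ) : Node → Node
  | arc a b => arc (g a) (g b)
  | double a b c d => double (g a) (g b) (g c) (g d)
  | triple h a b c d e f => triple h (g a) (g b) (g c) (g d) (g e) (g f)

/-- The node is a triple crossing. -/
def IsTriple : Node → Prop
  | triple .. => True
  | _ => False

/-- The double crossing with the edges `w, x, y, z` in counterclockwise order, at which the
strand `w`-`y` is over the strand `x`-`z` if `s` is true, and under it otherwise. -/
def crossing (s : Bool) (w x y z : ℕ) : Node :=
  if s then double x y z w else double w x y z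

/-- Three strands `a`-`d`, `b`-`e`, `c`-`f` that pairwise cross once in double crossings, around
a triangle with the sides `p` (on `b`-`e`), `q` (on `c`-`f`) and `r` (on `a`-`d`).  The outer ends
are `a, b, c, d, e, f` in counterclockwise order, and the triangle lies at the same side of
`a`-`d` as the ends `e` and `f`.  The flag `s₀₁` says that `a`-`d` is over `b`-`e`, the flag
`s₀₂` that `a`-`d` is over `c`-`f`, and the flag `s₁₂` that `b`-`e` is over `c`-`f`. -/
def triangle (s₀₁ s₀₂ s₁₂ : Bool) (a b c d e f p q r : ℕ) : List Node :=
  [crossing s₀₁ a b r p, crossing s₀₂ r c d q, crossing s₁₂ p q e f]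

/-- The triangle in which three strands at the heights `h 0`, `h 1`, `h 2` cross. -/
def layeredTriangle (h : Equiv.Perm (Fin 3)) (a b c d e f p q r : ℕ) : List Node :=
  triangle (decide (h 1 < h 0)) (decide (h 2 < h 0)) (decide (h 2 < h 1)) a b c d e f p q r

end Node

open Node

/-- A planar diagram code: the list of the nodes of a diagram. -/
abbrev Diagram : Type := List Node

namespace Diagram

/-- All edge labels of a diagram; each edge is listed once for each of its ends. -/
def labels (D : Diagram) : List ℕ := D.flatMap legs

/-- A half-edge: a node together with the position of one of its legs. -/
abbrev HalfEdge (D : Diagram) : Type :=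
  (i : Fin D.length) × Fin (D.get i).legs.length

namespace HalfEdge

variable {D : Diagram}

/-- The edge to which a half-edge belongs. -/
def label (x : HalfEdge D) : ℕ := (D.get x.1).legs.get x.2

/-- The next half-edge counterclockwise at the same node. -/
def next (x : HalfEdge D) : HalfEdge D := ⟨x.1, finRotate _ x.2⟩

/-- The half-edge at the same node that continues the same strand. -/
def opposite (x : HalfEdge D) : HalfEdge D :=
  next^[(D.get x.1).legs.length / 2] x

/-- Two half-edges are consecutive on a strand: they belong to the same edge, or they are
opposite to each other at a node. -/
def StrandRel (x y : HalfEdge D) : Prop := x.label = y.label ∨ y = x.opposite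

/-- A half-edge `x` also stands for the corner between `x` and `x.next`.  The corners at `x`
and at `y` are consecutive on the boundary of a face if `x.next` and `y` are the two ends of the
same edge. -/
def FaceRel (x y : HalfEdge D) : Prop := x.next ≠ y ∧ x.next.label = y.label

end HalfEdge

/-- The number of closed strands of a diagram. -/
noncomputable def componentCount (D : Diagram) : ℕ :=
  Nat.card (Quot (HalfEdge.StrandRel (D := D)))

/-- The number of faces of a diagram. -/
noncomputable def faceCount (D : Diagram) : ℕ :=
  Nat.card (Quot (HalfEdge.FaceRel (D := D)))

/-- The number of edges of a diagram. -/
def edgeCount (D : Diagram) : ℕ := D.labels.toFinset.card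

/-- A knot diagram on the sphere: every edge has two ends, there is exactly one closed strand
(so that the diagram is connected), and the surface is a sphere, which is expressed by Euler's
formula. -/
structure IsKnotDiagram (D : Diagram) : Prop where
  two_ends : ∀ l ∈ D.labels, D.labels.count l = 2
  one_component : D.componentCount = 1
  euler : D.length + D.faceCount = D.edgeCount + 2

/-- The elementary changes of a diagram that do not change the knot.  The first group only
changes the description of the diagram, the second group are the Reidemeister moves, and the last
one deconstructs a triple crossing into three double crossings. -/
inductive Move : Diagram → Diagram → Prop
  /-- list the nodes in another order -/
  | perm {D D' : Diagram} : D.Perm D' → Move D D'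
  /-- rename the edges -/
  | relabel (g : ℕ → ℕ) (hg : Function.Injective g) (D : Diagram) :
      Move D (D.map (Node.relabel g))
  /-- read the edges at a node from another starting edge -/
  | turn_arc (a b : ℕ) (R : Diagram) : Move (arc a b :: R) (arc b a :: R)
  | turn_double (a b c d : ℕ) (R : Diagram) :
      Move (double a b c d :: R) (double c d a b :: R)
  | turn_triple (h : Equiv.Perm (Fin 3)) (a b c d e f : ℕ) (R : Diagram) :
      Move (triple h a b c d e f :: R) (triple ((finRotate 3).trans h) b c d e f a :: R)
  /-- remove a marker point from a strand -/
  | merge (a b : ℕ) (hab : a ≠ b) (R : Diagram) :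
      Move (arc a b :: R) (R.map (Node.relabel (Function.update id b a)))
  /-- first Reidemeister move -/
  | reidemeister₁ (s : Bool) (a b c : ℕ) (R : Diagram) :
      Move (crossing s a a b c :: R) (arc b c :: R)
  /-- second Reidemeister move; the strands are `w`-`p`-`x` and `u`-`q`-`y` -/
  | reidemeister₂ (s : Bool) (p q u w x y : ℕ) (R : Diagram) :
      Move (crossing s p u w q :: crossing s p q x y :: R) (arc w x :: arc u y :: R)
  /-- third Reidemeister move -/
  | reidemeister₃ (h : Equiv.Perm (Fin 3)) (a b c d e f p q r p' q' r' : ℕ) (R : Diagram) :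
      Move (layeredTriangle h a b c d e f p q r ++ R)
        (layeredTriangle h d e f a b c p' q' r' ++ R)
  /-- deconstruction of a triple crossing -/
  | deconstruct (h : Equiv.Perm (Fin 3)) (a b c d e f p q r : ℕ) (R : Diagram) :
      Move (triple h a b c d e f :: R) (layeredTriangle h a b c d e f p q r ++ R)

end Diagram

/-- Knot diagrams on the sphere. -/
def KnotDiagram : Type := {D : Diagram // D.IsKnotDiagram}

/-- Knots: classes of knot diagrams under the equivalence relation that the moves between
knot diagrams generate. -/
def Knot : Type := Quot fun D D' : KnotDiagram => Diagram.Move D.1 D'.1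

namespace KnotDiagram

/-- The knot that a diagram represents. -/
def knot (D : KnotDiagram) : Knot := Quot.mk _ D

/-- A triple-crossing diagram: all nodes are triple crossings, or the diagram is a circle without
crossings (with one marker point). -/
def IsTripleCrossing (D : KnotDiagram) : Prop :=
  (∀ v ∈ D.1, v.IsTriple) ∨ ∃ a, D.1 = [arc a a]

open Classical in
/-- The number of triple crossings of a diagram. -/
noncomputable def tripleCount (D : KnotDiagram) : ℕ := D.1.countP fun v => decide v.IsTriple

end KnotDiagram

/-- A delta-crossing: the triangle in which each of the three strands `a`-`d`, `b`-`e`, `c`-`f`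
is over one of the other two and under the other one.  If `s` is true, then `a`-`d` is over
`b`-`e`, which is over `c`-`f`, which is over `a`-`d`; otherwise all three are reversed. -/
structure DeltaCrossing where
  s : Bool
  (a b c d e f p q r : ℕ)

/-- The three double crossings of a delta-crossing. -/
def DeltaCrossing.nodes (T : DeltaCrossing) : List Node :=
  triangle T.s (!T.s) T.s T.a T.b T.c T.d T.e T.f T.p T.q T.r

/-- `D` is a delta-crossing diagram with `m` delta-crossings: it decomposes into `m`
delta-crossings that are joined by simple arcs (which may carry marker points). -/
def KnotDiagram.IsDeltaCrossing (D : KnotDiagram) (m : ℕ) : Prop :=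
  ∃ (T : List DeltaCrossing) (A : List (ℕ × ℕ)), T.length = m ∧
    D.1.Perm (T.flatMap DeltaCrossing.nodes ++ A.map fun x => arc x.1 x.2)

/-- The triple-crossing number of a knot (`⊤` if there were no triple-crossing diagram). -/
noncomputable def c₃ (K : Knot) : ℕ∞ :=
  sInf {n | ∃ D : KnotDiagram, D.knot = K ∧ D.IsTripleCrossing ∧ n = D.tripleCount}

/-- The delta-crossing number of a knot (`⊤` if there were no delta-crossing diagram). -/
noncomputable def cDelta (K : Knot) : ℕ∞ :=
  sInf {n | ∃ (D : KnotDiagram) (m : ℕ), D.knot = K ∧ D.IsDeltaCrossing m ∧ n = m}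

namespace KnotDiagram

/-- A minimal triple-crossing diagram of the knot `K`. -/
def IsMinimalTripleCrossing (D : KnotDiagram) (K : Knot) : Prop :=
  D.knot = K ∧ D.IsTripleCrossing ∧ (D.tripleCount : ℕ∞) = c₃ K

/-- The projection of a diagram: the over/under information is forgotten, only the cyclic order
of the edges at each node is kept. -/
def projection (D : KnotDiagram) : Multiset (Cycle ℕ) :=
  (D.1.map fun v => (v.legs : Cycle ℕ) : List (Cycle ℕ))

/-- The projection contains a tangle `T₃`: three distinct triple points, the first two of which
are the vertices of a bigon face with the sides `p`, `q`, and all three of which are the vertices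
of a triangular face with the sides `q`, `s`, `t`. -/
def HasT₃ (D : KnotDiagram) : Prop :=
  ∃ (p q s t x₁ x₂ x₃ y₁ y₂ y₃ z₁ z₂ z₃ z₄ : ℕ) (R : Multiset (Cycle ℕ)),
    D.projection =
      {([t, q, p, x₁, x₂, x₃] : Cycle ℕ),
        ([p, q, s, y₁, y₂, y₃] : Cycle ℕ),
        ([s, t, z₁, z₂, z₃, z₄] : Cycle ℕ)} + R

/-- The projection contains a tangle `T₄`: a chain of four distinct triple points, consecutive ones
of which are the vertices of a bigon face with the sides `uᵢ`, `bᵢ`, where the edges `b₁`, `b₂`,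
`b₃` are consecutive on the boundary of one face. -/
def HasT₄ (D : KnotDiagram) : Prop :=
  ∃ (u₁ u₂ u₃ b₁ b₂ b₃ w₁ w₂ w₃ w₄ x₁ x₂ y₁ y₂ z₁ z₂ z₃ z₄ : ℕ) (R : Multiset (Cycle ℕ)),
    D.projection =
      {([b₁, u₁, w₁, w₂, w₃, w₄] : Cycle ℕ),
        ([u₁, b₁, b₂, u₂, x₁, x₂] : Cycle ℕ),
        ([u₂, b₂, b₃, u₃, y₁, y₂] : Cycle ℕ),
        ([u₃, b₃, z₁, z₂, z₃, z₄] : Cycle ℕ)} + R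

end KnotDiagram

/-- The circle without crossings, with one marker point. -/
theorem isKnotDiagram_circle : Diagram.IsKnotDiagram [arc 0 0] := by
  have key : ∀ x : Diagram.HalfEdge [arc 0 0],
      x = ⟨0, (0 : Fin 2)⟩ ∨ x = ⟨0, (1 : Fin 2)⟩ := by
    rintro ⟨i, j⟩
    obtain rfl : i = 0 := Subsingleton.elim (α := Fin 1) _ _
    have h : ∀ j : Fin 2, j = 0 ∨ j = 1 := by decide
    rcases h j with h | h
    · left; rw [← h]
    · right; rw [← h]
  refine ⟨by decide, ?_, ?_⟩
  · rw [Diagram.componentCount, Nat.card_eq_one_iff_unique]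
    refine ⟨⟨fun x y => ?_⟩, ⟨Quot.mk _ ⟨0, (0 : Fin 2)⟩⟩⟩
    induction x using Quot.ind with | _ x
    induction y using Quot.ind with | _ y
    refine Quot.sound (Or.inl ?_)
    rcases key x with rfl | rfl <;> rcases key y with rfl | rfl <;> rfl
  · have hF : Diagram.faceCount [arc 0 0] = 2 := by
      rw [Diagram.faceCount]
      have e : Function.Bijective
          (Quot.mk (Diagram.HalfEdge.FaceRel (D := [arc 0 0]))) := by
        have aux : ∀ x y : Diagram.HalfEdge [arc 0 0], Diagram.HalfEdge.FaceRel x y → x = y := by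
          intro x y h
          rcases key x with rfl | rfl <;> rcases key y with rfl | rfl
          · rfl
          · exact absurd rfl h.1
          · exact absurd rfl h.1
          · rfl
        refine ⟨fun x y h => ?_, Quot.mk_surjective⟩
        have h' := congrArg (Quot.lift id aux) h
        exact h'
      rw [← Nat.card_eq_of_bijective _ e, Nat.card_eq_fintype_card]
      rfl
    rw [hF]
    rfl

/-- The trivial knot. -/
def unknot : Knot := KnotDiagram.knot ⟨[arc 0 0], isKnotDiagram_circle⟩

end KnotTheory

/-! ### Half-edges of a planar diagram code. -/

namespace KnotTheory

open Node

/-! Let the minimal diagram have `n` triple crossings. Every triple crossing can be replaced by two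
delta-crossings (`exists_blocks_of_triple`), so `2 * n` delta-crossings always suffice, and it is
enough to save a single one somewhere. Two configurations save one. A triple crossing with a monogon
needs at most one delta-crossing (`exists_blocks_of_monogon`). Two triple crossings that share two
bigons, neighbours at a node, need at most three together (`exists_blocks_of_bigons`).

One of the two configurations must occur, by discharging (`exists_monogon_or_bigons`). A 6-valent
diagram on the sphere has `6 * n` corners and `2 * n + 2` faces. Let each corner of a face of size
`k` carry `60 / min k 6`, so that a face carries at least `60` and the total is at least `120 * n +
120`. Without monogons, only corners of bigons carry more than `20`, namely `30`. Each bigon corner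
passes its excess `10` across a side of the bigon. If no two bigons are neighbours at a node, no
bigon receives anything; without `T₃`, no triangle does. Without `T₄`, a quadrilateral receives at
most twice and a pentagon at most four times; larger faces have room for one transfer per corner. So
no face ends with an average above `20`, and the total is at most `120 * n`, a contradiction.

Since knots are classes of codes that really are knot diagrams, each code on the way must be shown
to be planar. Euler's inequality `length_add_faceCount_le`, proved with coboundaries modulo 2, holds
for every code with two-ended edges and one closed strand. Hence only lower bounds for the number of
faces are needed, and these come from surjections. `IsKnotDiagram.replace` thereby reduces the
replacement of a tangle to a finite check on the tangle alone, and the explicit chains of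
Reidemeister moves (`triplePlan_works` and its companions) are verified by evaluation. The same
homological argument, with equality on the sphere, yields `mate_ne_rot_two`, which excludes
degenerate positions of the nodes of `T₃` and `T₄`. -/

theorem val_finRotate (n : ℕ) (i : Fin n) : (finRotate n i).val = (i.val + 1) % n := by
  cases n with
  | zero => exact i.elim0
  | succ n =>
    rw [coe_finRotate]
    split_ifs with h
    · simp [h]
    · rw [Nat.mod_eq_of_lt]
      have := i.2
      have : i.val ≠ n := fun h' => h (Fin.ext h')
      omega

namespace Diagram

namespace HalfEdge

variable {D : Diagram}

theorem ext' {x y : HalfEdge D} (h₁ : x.1.val = y.1.val) (h₂ : x.2.val = y.2.val) : x = y := by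
  obtain ⟨i, j⟩ := x
  obtain ⟨i', j'⟩ := y
  obtain rfl : i = i' := Fin.ext h₁
  obtain rfl : j = j' := Fin.ext h₂
  rfl

instance : DecidableEq (HalfEdge D) := fun x y =>
  decidable_of_iff (x.1.val = y.1.val ∧ x.2.val = y.2.val)
    ⟨fun h => ext' h.1 h.2, fun h => by rw [h]; exact ⟨rfl, rfl⟩⟩

/-- The number of legs at the node of a half-edge. -/
def valence (x : HalfEdge D) : ℕ := (D.get x.1).legs.length

theorem next_fst (x : HalfEdge D) : x.next.1 = x.1 := rfl

theorem next_snd_val (x : HalfEdge D) : x.next.2.val = (x.2.val + 1) % x.valence :=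
  val_finRotate _ _

theorem snd_lt (x : HalfEdge D) : x.2.val < x.valence := x.2.2

theorem iterate_next_fst (x : HalfEdge D) (k : ℕ) : (next^[k] x).1 = x.1 := by
  induction k with
  | zero => rfl
  | succ k ih => rw [Function.iterate_succ_apply', next_fst, ih]

theorem iterate_next_valence (x : HalfEdge D) (k : ℕ) : (next^[k] x).valence = x.valence := by
  unfold valence
  rw [iterate_next_fst]

theorem iterate_next_snd_val (x : HalfEdge D) (k : ℕ) :
    (next^[k] x).2.val = (x.2.val + k) % x.valence := by
  induction k with
  | zero => exact (Nat.mod_eq_of_lt x.snd_lt).symm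
  | succ k ih =>
    rw [Function.iterate_succ_apply', next_snd_val, iterate_next_valence, ih, Nat.mod_add_mod,
      add_assoc]

theorem opposite_fst (x : HalfEdge D) : x.opposite.1 = x.1 := iterate_next_fst _ _

theorem opposite_snd_val (x : HalfEdge D) :
    x.opposite.2.val = (x.2.val + x.valence / 2) % x.valence := iterate_next_snd_val _ _

/-- The permutation of the half-edges that sends each one to the next one at its node. -/
def nextEquiv (D : Diagram) : Equiv.Perm (HalfEdge D) :=
  Equiv.sigmaCongrRight fun i => finRotate (D.get i).legs.length

theorem nextEquiv_apply (x : HalfEdge D) : nextEquiv D x = x.next := rfl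

theorem next_injective : Function.Injective (next (D := D)) := (nextEquiv D).injective

/-- The previous half-edge at the same node. -/
def prev (x : HalfEdge D) : HalfEdge D := (nextEquiv D).symm x

@[simp] theorem next_prev (x : HalfEdge D) : x.prev.next = x := (nextEquiv D).apply_symm_apply x

@[simp] theorem prev_next (x : HalfEdge D) : x.next.prev = x := (nextEquiv D).symm_apply_apply x

theorem label_eq (x : HalfEdge D) : x.label = (D[x.1.val].legs)[x.2.val]'x.2.2 := rfl

theorem label_mem (x : HalfEdge D) : x.label ∈ D.labels :=
  List.mem_flatMap.2 ⟨D.get x.1, List.get_mem _ _, List.get_mem _ _⟩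

theorem sum_ite_label (D : Diagram) (l : ℕ) :
    (∑ x : HalfEdge D, if x.label = l then 1 else 0) = D.labels.count l := by
  have key : ∀ L : List ℕ, (∑ j : Fin L.length, if L.get j = l then 1 else 0) = L.count l := by
    intro L
    induction L with
    | nil => rfl
    | cons a L ih =>
      rw [List.count_cons, ← ih]
      refine (Fin.sum_univ_succ (n := L.length) _).trans ?_
      rw [add_comm]
      congr 1
      by_cases h : a = l <;> simp [h]
  rw [Diagram.labels, List.count_flatMap, Fintype.sum_sigma]
  rw [← Fin.sum_univ_getElem]
  refine Fintype.sum_equiv (finCongr (by simp)) _ _ fun i => ?_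
  have := key (D.get i).legs
  rw [List.getElem_map]
  exact this

theorem exists_label {l : ℕ} (h : l ∈ D.labels) : ∃ x : HalfEdge D, x.label = l := by
  obtain ⟨v, hv, hl⟩ := List.mem_flatMap.1 h
  obtain ⟨i, rfl⟩ := List.get_of_mem hv
  obtain ⟨j, rfl⟩ := List.get_of_mem hl
  exact ⟨⟨i, j⟩, rfl⟩

theorem card_label (D : Diagram) (l : ℕ) :
    (Finset.univ.filter fun x : HalfEdge D => x.label = l).card = D.labels.count l := by
  rw [← sum_ite_label, Finset.card_filter]

theorem exists_mate (h : ∀ l ∈ D.labels, D.labels.count l = 2) (x : HalfEdge D) :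
    ∃ y : HalfEdge D, y ≠ x ∧ y.label = x.label ∧
      ∀ z : HalfEdge D, z.label = x.label → z = x ∨ z = y := by
  have hc := card_label D x.label
  rw [h _ x.label_mem, Finset.card_eq_two] at hc
  obtain ⟨a, b, hab, he⟩ := hc
  have hm : ∀ z : HalfEdge D, z.label = x.label ↔ z = a ∨ z = b := by
    intro z
    have : z ∈ (Finset.univ.filter fun y : HalfEdge D => y.label = x.label) ↔ z = a ∨ z = b := by
      rw [he]; simp
    simpa using this
  rcases (hm x).1 rfl with rfl | rfl
  · exact ⟨b, hab.symm, (hm b).2 (Or.inr rfl), fun z hz => (hm z).1 hz⟩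
  · exact ⟨a, hab, (hm a).2 (Or.inl rfl), fun z hz => ((hm z).1 hz).symm⟩

section mate

variable (h : ∀ l ∈ D.labels, D.labels.count l = 2)

/-- The other end of the edge of a half-edge. -/
noncomputable def mate (x : HalfEdge D) : HalfEdge D := (exists_mate h x).choose

theorem mate_ne (x : HalfEdge D) : mate h x ≠ x := (exists_mate h x).choose_spec.1

theorem label_mate (x : HalfEdge D) : (mate h x).label = x.label :=
  (exists_mate h x).choose_spec.2.1

theorem eq_or_eq_mate {x z : HalfEdge D} (hz : z.label = x.label) : z = x ∨ z = mate h x :=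
  (exists_mate h x).choose_spec.2.2 z hz

theorem eq_mate {x z : HalfEdge D} (hz : z.label = x.label) (hn : z ≠ x) : z = mate h x :=
  (eq_or_eq_mate h hz).resolve_left hn

theorem mate_mate (x : HalfEdge D) : mate h (mate h x) = x :=
  (eq_mate h (label_mate h x).symm (mate_ne h x).symm).symm

theorem filter_label (x : HalfEdge D) :
    (Finset.univ.filter fun y : HalfEdge D => y.label = x.label) = {x, mate h x} := by
  ext y
  simp only [Finset.mem_filter, Finset.mem_univ, true_and, Finset.mem_insert,
    Finset.mem_singleton]
  exact ⟨eq_or_eq_mate h, by rintro (rfl | rfl); exacts [rfl, label_mate h _]⟩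

theorem sum_label {M : Type*} [AddCommMonoid M] (φ : HalfEdge D → M) (x : HalfEdge D) :
    (∑ y, if y.label = x.label then φ y else 0) = φ x + φ (mate h x) := by
  rw [← Finset.sum_filter, filter_label h, Finset.sum_pair (mate_ne h x).symm]

/-- Faces are thus the orbits of a permutation of the corners, and each corner has exactly one
successor on its face. -/
theorem faceRel_iff {x y : HalfEdge D} : FaceRel x y ↔ y = mate h x.next := by
  constructor
  · rintro ⟨hne, hl⟩
    exact eq_mate h hl.symm hne.symm
  · rintro rfl
    exact ⟨(mate_ne h _).symm, (label_mate h _).symm⟩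

end mate

end HalfEdge

open HalfEdge

/-- Numbers of faces are bounded from below by giving a surjective invariant of faces, without
knowing the faces themselves. -/
theorem card_le_faceCount {D : Diagram} {α : Type*} (f : HalfEdge D → α)
    (hf : ∀ x y, FaceRel x y → f x = f y) (hs : Function.Surjective f) :
    Nat.card α ≤ D.faceCount := by
  refine Nat.card_le_card_of_surjective (Quot.lift f hf) fun a => ?_
  obtain ⟨x, rfl⟩ := hs a
  exact ⟨Quot.mk _ x, rfl⟩

/-- The form in which the single closed strand is used. It also supplies connectedness, since the
strand runs through every half-edge. -/
theorem eq_of_componentCount {D : Diagram} (h : D.componentCount = 1) {α : Type*}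
    (f : HalfEdge D → α) (h₁ : ∀ x y, x.label = y.label → f x = f y)
    (h₂ : ∀ x, f x = f x.opposite) (x y : HalfEdge D) : f x = f y := by
  rw [Diagram.componentCount, Nat.card_eq_one_iff_unique] at h
  have := h.1
  have hq : ∀ x y, StrandRel x y → f x = f y := by
    rintro x y (h | rfl)
    exacts [h₁ x y h, h₂ x]
  exact congrArg (Quot.lift f hq) (Subsingleton.elim (Quot.mk _ x) (Quot.mk _ y))

theorem nonempty_of_componentCount {D : Diagram} (h : D.componentCount = 1) :
    Nonempty (HalfEdge D) := by
  rw [Diagram.componentCount, Nat.card_eq_one_iff_unique] at h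
  obtain ⟨q⟩ := h.2
  exact ⟨q.exists_rep.choose⟩

/-- The converse of `eq_of_componentCount`. Propositions suffice as test functions, because lying on
the strand of a given half-edge is one of them. -/
theorem componentCount_eq_one {D : Diagram} [hn : Nonempty (HalfEdge D)]
    (h : ∀ f : HalfEdge D → Prop, (∀ x y, x.label = y.label → f x = f y) →
      (∀ x, f x = f x.opposite) → ∀ x y, f x = f y) : D.componentCount = 1 := by
  rw [Diagram.componentCount, Nat.card_eq_one_iff_unique]
  refine ⟨⟨fun a b => ?_⟩, ⟨Quot.mk _ hn.some⟩⟩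
  induction a using Quot.ind with | _ x
  induction b using Quot.ind with | _ y
  have := h (fun z => Quot.mk StrandRel x = Quot.mk StrandRel z)
    (fun a b hab => congrArg (Quot.mk StrandRel x = ·) (Quot.sound (Or.inl hab)))
    (fun a => congrArg (Quot.mk StrandRel x = ·) (Quot.sound (Or.inr rfl))) x y
  exact this ▸ rfl

end Diagram
end KnotTheory
-- Homology modulo 2 and Euler's inequality.
namespace KnotTheory

open Node

namespace Diagram

open HalfEdge Module

section Homology

variable {D : Diagram} (h : ∀ l ∈ D.labels, D.labels.count l = 2)

/-- The edges of a diagram. -/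
abbrev Edge (D : Diagram) : Type := {l // l ∈ D.labels.toFinset}

/-- The edge of a half-edge. -/
def HalfEdge.edge (x : HalfEdge D) : Edge D := ⟨x.label, List.mem_toFinset.2 x.label_mem⟩

theorem HalfEdge.edge_eq_iff (x : HalfEdge D) (e : Edge D) : x.edge = e ↔ x.label = e.1 :=
  Subtype.ext_iff

/-- The face of a corner. -/
def HalfEdge.face (x : HalfEdge D) : Quot (FaceRel (D := D)) := Quot.mk _ x

/-- The sum of a function on the half-edges over the two ends of an edge, modulo 2. -/
def edgeSum (D : Diagram) : (HalfEdge D → ZMod 2) →ₗ[ZMod 2] (Edge D → ZMod 2) where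
  toFun φ e := ∑ x, if x.label = e.1 then φ x else 0
  map_add' φ ψ := by
    ext e
    rw [Pi.add_apply, ← Finset.sum_add_distrib]
    exact Finset.sum_congr rfl fun x _ => by split_ifs <;> simp
  map_smul' c φ := by
    ext e
    rw [Pi.smul_apply, RingHom.id_apply, Finset.smul_sum]
    exact Finset.sum_congr rfl fun x _ => by split_ifs <;> simp

include h in
theorem edgeSum_edge (φ : HalfEdge D → ZMod 2) (x : HalfEdge D) :
    edgeSum D φ x.edge = φ x + φ (mate h x) := sum_label h φ x

/-- The coboundary of a function on the nodes. -/
def nodeCoboundary (D : Diagram) : (Fin D.length → ZMod 2) →ₗ[ZMod 2] (Edge D → ZMod 2) :=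
  edgeSum D ∘ₗ LinearMap.funLeft _ _ Sigma.fst

/-- The coboundary of a function on the faces, as a function on the dual edges. -/
def faceCoboundary (D : Diagram) :
    (Quot (FaceRel (D := D)) → ZMod 2) →ₗ[ZMod 2] (Edge D → ZMod 2) :=
  edgeSum D ∘ₗ LinearMap.funLeft _ _ HalfEdge.face

include h in
theorem nodeCoboundary_edge (f : Fin D.length → ZMod 2) (x : HalfEdge D) :
    nodeCoboundary D f x.edge = f x.1 + f (mate h x).1 := edgeSum_edge h _ x

include h in
-- So the two faces along the edge of `x` are those of the corners `x` and `x.prev`.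
theorem face_mate (x : HalfEdge D) : (mate h x).face = x.prev.face := by
  refine (Quot.sound ((faceRel_iff h).2 ?_)).symm
  rw [next_prev]

include h in
theorem faceCoboundary_edge (g : Quot (FaceRel (D := D)) → ZMod 2) (x : HalfEdge D) :
    faceCoboundary D g x.edge = g x.face + g x.prev.face := by
  rw [← face_mate h]
  exact edgeSum_edge h _ x

theorem sum_edgeSum_mul (φ : HalfEdge D → ZMod 2) (z : Edge D → ZMod 2) :
    ∑ e, edgeSum D φ e * z e = ∑ x, φ x * z x.edge := by
  simp only [edgeSum, LinearMap.coe_mk, AddHom.coe_mk, Finset.sum_mul]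
  rw [Finset.sum_comm]
  refine Finset.sum_congr rfl fun x _ => ?_
  rw [Finset.sum_eq_single x.edge]
  · simp [HalfEdge.edge]
  · intro e _ he
    rw [if_neg, zero_mul]
    exact fun h' => he ((edge_eq_iff x e).2 h').symm
  · simp

include h in
-- As a sum over half-edges, the product has the terms `f x.1 * (g x.face + g x.prev.face)`. Turning
-- around the nodes shows that the two parts are equal, so they cancel modulo 2.
theorem dotProduct_coboundary (f : Fin D.length → ZMod 2)
    (g : Quot (FaceRel (D := D)) → ZMod 2) :
    nodeCoboundary D f ⬝ᵥ faceCoboundary D g = 0 := by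
  rw [dotProduct, nodeCoboundary, LinearMap.comp_apply, sum_edgeSum_mul]
  simp only [faceCoboundary_edge h, mul_add, Finset.sum_add_distrib, LinearMap.funLeft_apply]
  have : ∑ x : HalfEdge D, f x.1 * g x.face = ∑ x : HalfEdge D, f x.1 * g x.prev.face := by
    refine Fintype.sum_equiv (nextEquiv D) _ _ fun x => ?_
    rw [nextEquiv_apply, prev_next, next_fst]
  rw [this]
  exact CharTwo.add_self_eq_zero _

theorem eq_of_add_eq_zero {a b : ZMod 2} (h : a + b = 0) : a = b := by
  revert a b; decide

variable (hc : D.componentCount = 1)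

include h hc in
-- A function with zero coboundary is constant along the strand, which visits every node.
theorem finrank_ker_nodeCoboundary : finrank (ZMod 2) (nodeCoboundary D).ker ≤ 1 := by
  obtain ⟨x₀⟩ := nonempty_of_componentCount hc
  have key : ∀ f ∈ (nodeCoboundary D).ker, ∀ x : HalfEdge D, f x.1 = f x₀.1 := by
    intro f hf x
    refine eq_of_componentCount hc (fun x : HalfEdge D => f x.1) (fun x y hxy => ?_)
      (fun x => ?_) x x₀
    · rcases eq_or_eq_mate h hxy with rfl | rfl
      · rfl
      · have := nodeCoboundary_edge h f y
        rw [LinearMap.mem_ker.1 hf] at this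
        exact (eq_of_add_eq_zero this.symm).symm
    · rw [opposite_fst]
  have hlen : ∀ i : Fin D.length, ∃ x : HalfEdge D, x.1 = i := by
    intro i
    have : 0 < (D.get i).legs.length := by
      rcases D.get i with _ | _ | _ <;> simp [legs]
    exact ⟨⟨i, ⟨0, this⟩⟩, rfl⟩
  have hone : (fun _ => 1) ∈ (nodeCoboundary D).ker := by
    rw [LinearMap.mem_ker]
    ext e
    obtain ⟨x, hx⟩ := exists_label (List.mem_toFinset.1 e.2)
    rw [← (edge_eq_iff x e).2 hx, nodeCoboundary_edge h]
    rfl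
  refine finrank_le_one ⟨_, hone⟩ fun w => ⟨w.1 x₀.1, ?_⟩
  ext i
  obtain ⟨x, rfl⟩ := hlen i
  simpa using (key w.1 w.2 x).symm

include h hc in
-- With zero coboundary, `g` does not change across an edge, hence not when turning around a node,
-- hence not along the strand.
theorem finrank_ker_faceCoboundary : finrank (ZMod 2) (faceCoboundary D).ker ≤ 1 := by
  obtain ⟨x₀⟩ := nonempty_of_componentCount hc
  have key : ∀ g ∈ (faceCoboundary D).ker, ∀ x : HalfEdge D, g x.face = g x₀.face := by
    intro g hg x
    have step : ∀ x : HalfEdge D, g x.face = g x.prev.face := by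
      intro x
      have := faceCoboundary_edge h g x
      rw [LinearMap.mem_ker.1 hg] at this
      exact eq_of_add_eq_zero this.symm
    have hnext : ∀ x : HalfEdge D, g x.next.face = g x.face := fun x => by
      rw [step x.next, prev_next]
    refine eq_of_componentCount hc (fun x : HalfEdge D => g x.face) (fun x y hxy => ?_)
      (fun x => ?_) x x₀
    · rcases eq_or_eq_mate h hxy with rfl | rfl
      · rfl
      · rw [face_mate h, step y]
    · have : ∀ k, g (next^[k] x).face = g x.face := by
        intro k
        induction k with
        | zero => rfl
        | succ k ih => rw [Function.iterate_succ_apply', hnext, ih]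
      exact (this _).symm
  have hone : (fun _ => 1) ∈ (faceCoboundary D).ker := by
    rw [LinearMap.mem_ker]
    ext e
    obtain ⟨x, hx⟩ := exists_label (List.mem_toFinset.1 e.2)
    rw [← (edge_eq_iff x e).2 hx, faceCoboundary_edge h]
    rfl
  refine finrank_le_one ⟨_, hone⟩ fun w => ⟨w.1 x₀.face, ?_⟩
  ext q
  induction q using Quot.ind with | _ x
  change w.1 x₀.face * 1 = w.1 x.face
  rw [mul_one, key w.1 w.2 x]

include h in
theorem map_range_faceCoboundary_le :
    (faceCoboundary D).range.map (dotProductEquiv (ZMod 2) (Edge D)).toLinearMap ≤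
      (nodeCoboundary D).range.dualAnnihilator := by
  rintro _ ⟨_, ⟨g, rfl⟩, rfl⟩
  rw [Submodule.mem_dualAnnihilator]
  rintro _ ⟨f, rfl⟩
  change faceCoboundary D g ⬝ᵥ nodeCoboundary D f = 0
  rw [dotProduct_comm]
  exact dotProduct_coboundary h f g

theorem finrank_map_dotProductEquiv (W : Submodule (ZMod 2) (Edge D → ZMod 2)) :
    finrank (ZMod 2) (W.map (dotProductEquiv (ZMod 2) (Edge D)).toLinearMap) =
      finrank (ZMod 2) W :=
  LinearEquiv.finrank_map_eq _ _

theorem finrank_face (D : Diagram) :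
    finrank (ZMod 2) (Quot (FaceRel (D := D)) → ZMod 2) = D.faceCount := by
  have := Fintype.ofFinite (Quot (FaceRel (D := D)))
  rw [finrank_fintype_fun_eq_card, Diagram.faceCount, Nat.card_eq_fintype_card]

theorem finrank_edge (D : Diagram) : finrank (ZMod 2) (Edge D → ZMod 2) = D.edgeCount := by
  rw [finrank_fintype_fun_eq_card, Diagram.edgeCount, Fintype.card_coe]

/-- Euler's inequality for a connected diagram on a closed surface. -/
theorem length_add_faceCount_le (h : ∀ l ∈ D.labels, D.labels.count l = 2)
    (hc : D.componentCount = 1) : D.length + D.faceCount ≤ D.edgeCount + 2 := by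
  -- The two ranges have dimensions at least `length - 1` and `faceCount - 1`, and they are
  -- orthogonal in a space of dimension `edgeCount`.
  have h₁ := (nodeCoboundary D).finrank_range_add_finrank_ker
  have h₂ := (faceCoboundary D).finrank_range_add_finrank_ker
  have h₃ := Submodule.finrank_mono (map_range_faceCoboundary_le h)
  have h₄ := Subspace.finrank_add_finrank_dualAnnihilator_eq (nodeCoboundary D).range
  have h₅ := finrank_ker_nodeCoboundary h hc
  have h₆ := finrank_ker_faceCoboundary h hc
  rw [finrank_map_dotProductEquiv] at h₃
  rw [finrank_fin_fun] at h₁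
  rw [finrank_face] at h₂
  rw [finrank_edge] at h₄
  omega

/-- On the sphere every cycle is the boundary of a set of faces. -/
theorem exists_faceCoboundary_eq (hD : D.IsKnotDiagram) (z : Edge D → ZMod 2)
    (hz : ∀ f, z ⬝ᵥ nodeCoboundary D f = 0) : ∃ g, faceCoboundary D g = z := by
  have h := hD.two_ends
  have hc := hD.one_component
  have h₁ := (nodeCoboundary D).finrank_range_add_finrank_ker
  have h₂ := (faceCoboundary D).finrank_range_add_finrank_ker
  have h₃ := map_range_faceCoboundary_le h
  have h₄ := Subspace.finrank_add_finrank_dualAnnihilator_eq (nodeCoboundary D).range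
  have h₅ := finrank_ker_nodeCoboundary h hc
  have h₆ := finrank_ker_faceCoboundary h hc
  have h₇ := hD.euler
  rw [finrank_fin_fun] at h₁
  rw [finrank_face] at h₂
  rw [finrank_edge] at h₄
  -- Euler's formula leaves no gap in the dimension count, so the inclusion in the annihilator is an
  -- equality.
  have h₈ := Submodule.eq_of_le_of_finrank_le h₃ (by
    rw [finrank_map_dotProductEquiv]
    omega)
  have : dotProductEquiv (ZMod 2) (Edge D) z ∈ (nodeCoboundary D).range.dualAnnihilator := by
    rw [Submodule.mem_dualAnnihilator]
    rintro _ ⟨f, rfl⟩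
    exact hz f
  rw [← h₈] at this
  obtain ⟨_, ⟨g, rfl⟩, hg⟩ := this
  exact ⟨g, (dotProductEquiv (ZMod 2) (Edge D)).injective hg⟩

end Homology

end Diagram
end KnotTheory
-- Changes in the description of a diagram.
namespace KnotTheory

open Node

theorem Node.legs_relabel (g : ℕ → ℕ) (v : Node) : (v.relabel g).legs = v.legs.map g := by
  cases v <;> rfl

theorem Node.relabel_relabel (f g : ℕ → ℕ) (v : Node) :
    (v.relabel g).relabel f = v.relabel (f ∘ g) := by
  cases v <;> rfl

theorem Node.relabel_congr {f g : ℕ → ℕ} {v : Node} (h : ∀ l ∈ v.legs, f l = g l) :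
    v.relabel f = v.relabel g := by
  cases v <;> simp_all [relabel, legs]

theorem Node.relabel_id (v : Node) : v.relabel id = v := by
  cases v <;> rfl

namespace Diagram

open HalfEdge

theorem labels_cons (v : Node) (D : Diagram) : labels (v :: D) = v.legs ++ labels D := rfl

theorem labels_append (L R : Diagram) : labels (L ++ R) = labels L ++ labels R :=
  List.flatMap_append

theorem labels_map_relabel (g : ℕ → ℕ) (D : Diagram) :
    labels (D.map (relabel g)) = (labels D).map g := by
  induction D with
  | nil => rfl
  | cons v D ih => rw [List.map_cons, labels_cons, labels_cons, ih, legs_relabel, List.map_append]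

theorem map_relabel_congr {f g : ℕ → ℕ} {D : Diagram} (h : ∀ l ∈ labels D, f l = g l) :
    D.map (relabel f) = D.map (relabel g) :=
  List.map_congr_left fun _ hv =>
    relabel_congr fun l hl => h l (List.mem_flatMap.2 ⟨_, hv, hl⟩)

theorem map_relabel_eq_self {f : ℕ → ℕ} {D : Diagram} (h : ∀ l ∈ labels D, f l = l) :
    D.map (relabel f) = D := by
  rw [map_relabel_congr (g := id) h]
  exact (List.map_congr_left fun v _ => relabel_id v).trans (List.map_id _)

/-- Euler's inequality gives the other half of the formula, so planarity only needs enough faces. -/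
theorem isKnotDiagram_of_le {D : Diagram} (h₁ : ∀ l ∈ D.labels, D.labels.count l = 2)
    (h₂ : D.componentCount = 1) (h₃ : D.edgeCount + 2 ≤ D.length + D.faceCount) :
    D.IsKnotDiagram :=
  ⟨h₁, h₂, le_antisymm (length_add_faceCount_le h₁ h₂) h₃⟩

/-! ### Isomorphisms of half-edges -/

/-- A bijection between the half-edges of two diagrams that respects the nodes. -/
structure HalfEdgeIso (D D' : Diagram) where
  toEquiv : HalfEdge D ≃ HalfEdge D'
  next' : ∀ x, toEquiv x.next = (toEquiv x).next
  valence' : ∀ x, (toEquiv x).valence = x.valence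

namespace HalfEdgeIso

variable {D D' D'' : Diagram}

theorem next_symm (e : HalfEdgeIso D D') (x : HalfEdge D') :
    e.toEquiv.symm x.next = (e.toEquiv.symm x).next := by
  rw [Equiv.symm_apply_eq, e.next', Equiv.apply_symm_apply]

theorem opposite' (e : HalfEdgeIso D D') (x : HalfEdge D) :
    e.toEquiv x.opposite = (e.toEquiv x).opposite := by
  have : ∀ k, e.toEquiv (next^[k] x) = next^[k] (e.toEquiv x) := by
    intro k
    induction k with
    | zero => rfl
    | succ k ih => rw [Function.iterate_succ_apply', Function.iterate_succ_apply', e.next', ih]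
  have hv := e.valence' x
  unfold valence at hv
  unfold HalfEdge.opposite
  rw [this, hv]

/-- The identity. -/
def refl (D : Diagram) : HalfEdgeIso D D := ⟨Equiv.refl _, fun _ => rfl, fun _ => rfl⟩

/-- The composition of two isomorphisms. -/
def trans (e : HalfEdgeIso D D') (f : HalfEdgeIso D' D'') : HalfEdgeIso D D'' :=
  ⟨e.toEquiv.trans f.toEquiv, fun x => by simp [e.next', f.next'],
    fun x => by simp [e.valence', f.valence']⟩

/-- Labels matter only through the way they pair half-edges. Hence this one statement serves for
permuting nodes, turning a node and renaming edges. -/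
theorem isKnotDiagram (e : HalfEdgeIso D D') (hD : D.IsKnotDiagram)
    (hl : ∀ x y, x.label = y.label ↔ (e.toEquiv x).label = (e.toEquiv y).label)
    (h₁ : ∀ l ∈ D'.labels, D'.labels.count l = 2) (h₂ : D'.length = D.length)
    (h₃ : D'.edgeCount = D.edgeCount) : D'.IsKnotDiagram := by
  have hl' : ∀ x y : HalfEdge D', x.label = y.label →
      (e.toEquiv.symm x).label = (e.toEquiv.symm y).label := by
    intro x y h
    rw [hl, Equiv.apply_symm_apply, Equiv.apply_symm_apply, h]
  refine isKnotDiagram_of_le h₁ ?_ ?_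
  · have := nonempty_of_componentCount hD.one_component
    have : Nonempty (HalfEdge D') := this.map e.toEquiv
    refine componentCount_eq_one fun f hf₁ hf₂ x y => ?_
    have := eq_of_componentCount hD.one_component (fun x => f (e.toEquiv x))
      (fun x y h => hf₁ _ _ ((hl x y).1 h)) (fun x => by rw [hf₂, e.opposite'])
      (e.toEquiv.symm x) (e.toEquiv.symm y)
    simpa using this
  · have : D.faceCount ≤ D'.faceCount :=
      card_le_faceCount (fun x => (e.toEquiv.symm x).face) (fun x y h => by
        refine Quot.sound ⟨?_, ?_⟩
        · rw [← e.next_symm, Ne, Equiv.apply_eq_iff_eq]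
          exact h.1
        · rw [← e.next_symm]
          exact hl' _ _ h.2) (fun q => by
        induction q using Quot.ind with | _ x
        exact ⟨e.toEquiv x, by simp [HalfEdge.face]⟩)
    have := hD.euler
    omega

end HalfEdgeIso

/-- The half-edges of a diagram with one more node. -/
def consEquiv (v : Node) (D : Diagram) : Fin v.legs.length ⊕ HalfEdge D ≃ HalfEdge (v :: D) where
  toFun := Sum.elim (fun j => ⟨(0 : Fin (D.length + 1)), j⟩)
    fun x => ⟨(x.1.succ : Fin (D.length + 1)), x.2⟩
  invFun x := Fin.cases (motive := fun i : Fin (D.length + 1) =>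
      Fin (List.get (v :: D) i).legs.length → Fin v.legs.length ⊕ HalfEdge D)
    (fun j => Sum.inl j) (fun i j => Sum.inr ⟨i, j⟩) x.1 x.2
  left_inv := by rintro (_ | _) <;> rfl
  right_inv := by
    rintro ⟨i, j⟩
    induction i using Fin.cases <;> rfl

section cons

variable (v : Node) (D : Diagram)

theorem consEquiv_inl_next (j : Fin v.legs.length) :
    (consEquiv v D (Sum.inl j)).next = consEquiv v D (Sum.inl (finRotate _ j)) := rfl

theorem consEquiv_inr_next (x : HalfEdge D) :
    (consEquiv v D (Sum.inr x)).next = consEquiv v D (Sum.inr x.next) := rfl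

theorem consEquiv_inl_valence (j : Fin v.legs.length) :
    (consEquiv v D (Sum.inl j)).valence = v.legs.length := rfl

theorem consEquiv_inr_valence (x : HalfEdge D) :
    (consEquiv v D (Sum.inr x)).valence = x.valence := rfl

theorem consEquiv_inl_label (j : Fin v.legs.length) :
    (consEquiv v D (Sum.inl j)).label = v.legs.get j := rfl

theorem consEquiv_inr_label (x : HalfEdge D) :
    (consEquiv v D (Sum.inr x)).label = x.label := rfl

theorem consEquiv_inr_opposite (x : HalfEdge D) :
    (consEquiv v D (Sum.inr x)).opposite = consEquiv v D (Sum.inr x.opposite) := by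
  have : ∀ k, next^[k] (consEquiv v D (Sum.inr x)) = consEquiv v D (Sum.inr (next^[k] x)) := by
    intro k
    induction k with
    | zero => rfl
    | succ k ih => rw [Function.iterate_succ_apply', Function.iterate_succ_apply', ih]; rfl
  exact this _

end cons

/-- Change the first node of a diagram. -/
def HalfEdgeIso.cons {v v' : Node} {D D' : Diagram}
    (f : Fin v.legs.length ≃ Fin v'.legs.length) (hf : ∀ j, f (finRotate _ j) = finRotate _ (f j))
    (e : HalfEdgeIso D D') : HalfEdgeIso (v :: D) (v' :: D') where
  toEquiv := (consEquiv v D).symm.trans ((Equiv.sumCongr f e.toEquiv).trans (consEquiv v' D'))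
  next' x := by
    obtain ⟨x | x, rfl⟩ := (consEquiv v D).surjective x
    · simp [consEquiv_inl_next, hf, -finRotate_apply]
    · simp [consEquiv_inr_next, e.next']
  valence' x := by
    obtain ⟨x | x, rfl⟩ := (consEquiv v D).surjective x
    · simpa [consEquiv_inl_valence] using (Fintype.card_congr f).symm
    · simp [consEquiv_inr_valence, e.valence']

/-- Exchange the first two nodes of a diagram. -/
def HalfEdgeIso.swap (v w : Node) (D : Diagram) : HalfEdgeIso (v :: w :: D) (w :: v :: D) where
  toEquiv := (consEquiv v (w :: D)).symm.trans
    (((Equiv.sumCongr (Equiv.refl _) (consEquiv w D).symm).trans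
      ((Equiv.sumAssoc _ _ _).symm.trans
        ((Equiv.sumCongr (Equiv.sumComm _ _) (Equiv.refl _)).trans
          ((Equiv.sumAssoc _ _ _).trans
            (Equiv.sumCongr (Equiv.refl _) (consEquiv v D)))))).trans (consEquiv w (v :: D)))
  next' x := by
    obtain ⟨x | x, rfl⟩ := (consEquiv v (w :: D)).surjective x
    · simp [consEquiv_inl_next, consEquiv_inr_next]
    · obtain ⟨x | x, rfl⟩ := (consEquiv w D).surjective x <;>
      simp [consEquiv_inl_next, consEquiv_inr_next]
  valence' x := by
    obtain ⟨x | x, rfl⟩ := (consEquiv v (w :: D)).surjective x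
    · simp [consEquiv_inl_valence, consEquiv_inr_valence]
    · obtain ⟨x | x, rfl⟩ := (consEquiv w D).surjective x <;>
      simp [consEquiv_inl_valence, consEquiv_inr_valence]

theorem exists_iso_of_perm {D D' : Diagram} (h : D.Perm D') :
    ∃ e : HalfEdgeIso D D', ∀ x, (e.toEquiv x).label = x.label := by
  induction h with
  | nil => exact ⟨.refl _, fun _ => rfl⟩
  | @cons v D D' _ ih =>
    obtain ⟨e, he⟩ := ih
    refine ⟨.cons (Equiv.refl _) (fun _ => rfl) e, fun x => ?_⟩
    obtain ⟨x | x, rfl⟩ := (consEquiv v D).surjective x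
    · simp [HalfEdgeIso.cons, consEquiv_inl_label]
    · simp [HalfEdgeIso.cons, consEquiv_inr_label, he]
  | swap v w D =>
    refine ⟨.swap w v D, fun x => ?_⟩
    obtain ⟨x | x, rfl⟩ := (consEquiv w (v :: D)).surjective x
    · simp [HalfEdgeIso.swap, consEquiv_inl_label, consEquiv_inr_label]
    · obtain ⟨x | x, rfl⟩ := (consEquiv v D).surjective x <;>
      simp [HalfEdgeIso.swap, consEquiv_inl_label, consEquiv_inr_label]
  | trans _ _ ih₁ ih₂ =>
    obtain ⟨e, he⟩ := ih₁
    obtain ⟨f, hf⟩ := ih₂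
    exact ⟨e.trans f, fun x => by simp [HalfEdgeIso.trans, he, hf]⟩

theorem labels_perm {D D' : Diagram} (h : D.Perm D') : D.labels.Perm D'.labels :=
  h.flatMap_right _

theorem IsKnotDiagram.perm {D D' : Diagram} (hD : D.IsKnotDiagram) (h : D.Perm D') :
    D'.IsKnotDiagram := by
  obtain ⟨e, he⟩ := exists_iso_of_perm h
  have hp := labels_perm h
  refine e.isKnotDiagram hD (fun x y => by rw [he, he]) (fun l hl => ?_) h.length_eq.symm ?_
  · rw [← hp.count_eq]
    exact hD.two_ends l (hp.mem_iff.2 hl)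
  · rw [Diagram.edgeCount, Diagram.edgeCount, List.toFinset_eq_of_perm _ _ hp]

theorem IsKnotDiagram.turn_triple {h : Equiv.Perm (Fin 3)} {a b c d e f : ℕ} {R : Diagram}
    (hD : IsKnotDiagram (triple h a b c d e f :: R)) :
    IsKnotDiagram (triple ((finRotate 3).trans h) b c d e f a :: R) := by
  have hp : (labels (triple h a b c d e f :: R)).Perm
      (labels (triple ((finRotate 3).trans h) b c d e f a :: R)) := by
    rw [labels_cons, labels_cons]
    exact (List.perm_append_singleton a [b, c, d, e, f]).symm.append_right _
  let i : HalfEdgeIso (triple h a b c d e f :: R)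
      (triple ((finRotate 3).trans h) b c d e f a :: R) :=
    .cons (v := triple h a b c d e f) (v' := triple ((finRotate 3).trans h) b c d e f a)
      (finRotate 6).symm (by
        have : ∀ j, (finRotate 6).symm (finRotate 6 j) = finRotate 6 ((finRotate 6).symm j) := by
          decide
        exact this) (.refl R)
  have hi : ∀ x, (i.toEquiv x).label = x.label := by
    intro x
    obtain ⟨x | x, rfl⟩ := (consEquiv (triple h a b c d e f) R).surjective x
    · change Fin 6 at x
      fin_cases x <;> rfl
    · rfl
  refine i.isKnotDiagram hD (fun x y => by rw [hi, hi]) (fun l hl => ?_) rfl ?_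
  · rw [← hp.count_eq]
    exact hD.two_ends l (hp.mem_iff.2 hl)
  · rw [Diagram.edgeCount, Diagram.edgeCount, List.toFinset_eq_of_perm _ _ hp]

/-- The half-edges of a diagram with renamed edges. -/
def relabelEquiv (g : ℕ → ℕ) (D : Diagram) : HalfEdge D ≃ HalfEdge (D.map (relabel g)) where
  toFun x := ⟨⟨x.1, by simp⟩, ⟨x.2, by simp [legs_relabel]⟩⟩
  invFun x := ⟨⟨x.1, by simpa using x.1.2⟩, ⟨x.2, by
    have := x.2.2
    simpa [legs_relabel] using this⟩⟩
  left_inv _ := ext' rfl rfl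
  right_inv _ := ext' rfl rfl

/-- The half-edges of a diagram with renamed edges. -/
def relabelIso (g : ℕ → ℕ) (D : Diagram) : HalfEdgeIso D (D.map (relabel g)) where
  toEquiv := relabelEquiv g D
  valence' x := by
    simp [valence, relabelEquiv, legs_relabel]
  next' x := by
    refine ext' rfl ?_
    rw [next_snd_val]
    change x.next.2.val = _
    rw [next_snd_val]
    simp [valence, relabelEquiv, legs_relabel]

theorem label_relabelEquiv (g : ℕ → ℕ) (D : Diagram) (x : HalfEdge D) :
    (relabelEquiv g D x).label = g x.label := by
  simp [label_eq, relabelEquiv, legs_relabel]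

theorem IsKnotDiagram.relabel {D : Diagram} (hD : D.IsKnotDiagram) (g : ℕ → ℕ)
    (hg : Function.Injective g) : IsKnotDiagram (D.map (relabel g)) := by
  refine (relabelIso g D).isKnotDiagram hD (fun x y => ?_) (fun l hl => ?_) (by simp) ?_
  · simp only [relabelIso, label_relabelEquiv]
    exact hg.eq_iff.symm
  · rw [labels_map_relabel] at hl ⊢
    obtain ⟨m, hm, rfl⟩ := List.mem_map.1 hl
    rw [List.count_map_of_injective _ _ hg]
    exact hD.two_ends m hm
  · rw [Diagram.edgeCount, Diagram.edgeCount, labels_map_relabel,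
      ← Finset.card_image_of_injective D.labels.toFinset hg]
    congr 1
    ext
    simp

end Diagram
end KnotTheory
-- Insertion of marker points; diagrams of the same knot.
namespace KnotTheory

open Node

namespace Diagram

open HalfEdge

/-- The inverse of the removal of a marker point preserves knot diagrams. -/
theorem IsKnotDiagram.split {N : Diagram} {a b : ℕ} (hab : a ≠ b)
    (hD : IsKnotDiagram (N.map (Node.relabel (Function.update id b a))))
    (hb : N.labels.count b = 1) : IsKnotDiagram (arc a b :: N) := by
  set g : ℕ → ℕ := Function.update id b a with hg
  have hgb : g b = a := by simp [hg]
  have hgo : ∀ l, l ≠ b → g l = l := fun l hl => by simp [hg, hl]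
  have hlab := labels_map_relabel g N
  have hcount : ∀ l, (labels (N.map (Node.relabel g))).count l =
      if l = a then N.labels.count a + 1 else if l = b then 0 else N.labels.count l := by
    intro l
    rw [hlab, ← hb]
    generalize N.labels = L
    induction L with
    | nil => simp
    | cons c L ih =>
      rw [List.map_cons, List.count_cons, ih]
      simp only [List.count_cons]
      by_cases hc : c = b
      · subst hc
        rw [hgb]
        by_cases h1 : l = a
        · subst h1; simp [hab.symm]; omega
        · have h2 : a ≠ l := fun h => h1 h.symm
          by_cases h3 : l = c
          · subst h3; simp [h1, h2]
          · have h4 : c ≠ l := fun h => h3 h.symm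
            simp [h1, h2, h3, h4]
      · rw [hgo c hc]
        have hc' : b ≠ c := fun h => hc h.symm
        by_cases h1 : l = a
        · subst h1; simp [hc]; split_ifs <;> omega
        · by_cases h3 : l = b
          · subst h3; simp [h1, hc]
          · simp [h1, h3]
  have hbmem : b ∈ N.labels := List.count_pos_iff.1 (by omega)
  have hamem : a ∈ labels (N.map (Node.relabel g)) := by
    rw [hlab]; exact List.mem_map.2 ⟨b, hbmem, hgb⟩
  -- Renaming `b` gives two occurrences of `a`, and exactly one of them comes from `b`.
  have ha : N.labels.count a = 1 := by
    have := hcount a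
    rw [hD.two_ends a hamem, if_pos rfl] at this
    omega
  have hmem : ∀ l ∈ N.labels, l ≠ a → l ≠ b → N.labels.count l = 2 := by
    intro l hl h1 h2
    have := hcount l
    rw [if_neg h1, if_neg h2] at this
    rw [← this]
    refine hD.two_ends l ?_
    rw [hlab]
    exact List.mem_map.2 ⟨l, hl, hgo l h2⟩
  obtain ⟨α, hα⟩ := exists_label (List.count_pos_iff.1 (by omega : 0 < N.labels.count a))
  obtain ⟨β, hβ⟩ := exists_label hbmem
  have huniq : ∀ l, N.labels.count l = 1 → ∀ x y : HalfEdge N, x.label = l → y.label = l →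
      x = y := by
    intro l hl x y hx hy
    rw [← card_label, Finset.card_eq_one] at hl
    obtain ⟨w, hw⟩ := hl
    have : ∀ z : HalfEdge N, z.label = l → z = w := fun z hz => by
      have : z ∈ (Finset.univ.filter fun y : HalfEdge N => y.label = l) := by simp [hz]
      rw [hw] at this
      simpa using this
    rw [this x hx, this y hy]
  let r := relabelEquiv g N
  let q : HalfEdge N → HalfEdge (N.map (Node.relabel g)) := r
  have hq : ∀ x, (q x).label = g x.label := label_relabelEquiv g N
  have hqn : ∀ x, (q x).next = q x.next := fun x => ((relabelIso g N).next' x).symm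
  have hqo : ∀ x, q x.opposite = (q x).opposite := (relabelIso g N).opposite'
  let A₀ : HalfEdge (arc a b :: N) := consEquiv (arc a b) N (Sum.inl (0 : Fin 2))
  let A₁ : HalfEdge (arc a b :: N) := consEquiv (arc a b) N (Sum.inl (1 : Fin 2))
  have hA₀ : A₀.label = a := rfl
  have hA₁ : A₁.label = b := rfl
  have hcases : ∀ z : HalfEdge (arc a b :: N),
      z = A₀ ∨ z = A₁ ∨ ∃ x, z = consEquiv (arc a b) N (Sum.inr x) := by
    intro z
    obtain ⟨x | x, rfl⟩ := (consEquiv (arc a b) N).surjective z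
    · change Fin 2 at x
      fin_cases x
      · exact Or.inl rfl
      · exact Or.inr (Or.inl rfl)
    · exact Or.inr (Or.inr ⟨x, rfl⟩)
  have hends : ∀ l ∈ labels (arc a b :: N), (labels (arc a b :: N)).count l = 2 := by
    intro l hl
    rw [labels_cons] at hl ⊢
    simp only [legs, List.cons_append, List.nil_append, List.mem_cons, List.count_cons] at hl ⊢
    by_cases h1 : l = a
    · subst h1; simp [ha, hab.symm]
    · by_cases h2 : l = b
      · subst h2; simp [hb, hab]
      · rw [hmem l (by tauto) h1 h2]
        have : a ≠ l := fun h => h1 h.symm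
        have : b ≠ l := fun h => h2 h.symm
        simp [*]
  refine isKnotDiagram_of_le hends ?_ ?_
  · have : Nonempty (HalfEdge (arc a b :: N)) := ⟨A₀⟩
    refine componentCount_eq_one fun f hf₁ hf₂ => ?_
    have hopp : A₀.opposite = A₁ :=
      ext' (by rw [opposite_fst]; rfl) (by rw [opposite_snd_val, show A₀.valence = 2 from rfl]; rfl)
    have h01 : f A₀ = f A₁ := by rw [hf₂ A₀, hopp]
    have hαf : f (consEquiv (arc a b) N (Sum.inr α)) = f A₀ := hf₁ _ _ hα
    have hβf : f (consEquiv (arc a b) N (Sum.inr β)) = f A₀ := (hf₁ _ _ hβ).trans h01.symm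
    have key : ∀ x : HalfEdge N, f (consEquiv (arc a b) N (Sum.inr x)) = f A₀ := by
      intro x
      rw [← hαf]
      have := eq_of_componentCount hD.one_component
        (fun x => f (consEquiv (arc a b) N (Sum.inr (r.symm x)))) (fun x y hxy => ?_)
        (fun x => ?_) (r x) (r α)
      · simpa using this
      · obtain ⟨x, rfl⟩ := r.surjective x
        obtain ⟨y, rfl⟩ := r.surjective y
        simp only [Equiv.symm_apply_apply]
        have hxy' : g x.label = g y.label := by rw [← hq, ← hq]; exact hxy
        have hval : ∀ x : HalfEdge N, g x.label = a →
            f (consEquiv (arc a b) N (Sum.inr x)) = f A₀ := by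
          intro x hx
          by_cases hxb : x.label = b
          · rw [huniq b hb x β hxb hβ, hβf]
          · rw [hgo _ hxb] at hx
            rw [huniq a ha x α hx hα, hαf]
        by_cases h1 : g x.label = a
        · rw [hval x h1, hval y (hxy' ▸ h1)]
        · have hx : x.label ≠ b := fun h => h1 (by rw [h, hgb])
          have hy : y.label ≠ b := fun h => h1 (by rw [hxy', h, hgb])
          rw [hgo _ hx, hgo _ hy] at hxy'
          exact hf₁ _ _ hxy'
      · obtain ⟨x, rfl⟩ := r.surjective x
        have : (r x).opposite = r x.opposite := (hqo x).symm
        rw [this, Equiv.symm_apply_apply, Equiv.symm_apply_apply, hf₂, consEquiv_inr_opposite]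
    have key' : ∀ z, f z = f A₀ := by
      intro z
      rcases hcases z with rfl | rfl | ⟨x, rfl⟩
      exacts [rfl, h01.symm, key x]
    intro x y
    rw [key', key' y]
  -- The corner after `A₀` on its face is `β`, and the one after `A₁` is `α`; this decides the faces
  -- of the two corners at the marker point.
  · let F : Fin 2 ⊕ HalfEdge N → Quot (FaceRel (D := N.map (Node.relabel g))) :=
      Sum.elim (fun j => if j = 0 then (q β).face else (q α).face) (fun x => (q x).face)
    let f : HalfEdge (arc a b :: N) → Quot (FaceRel (D := N.map (Node.relabel g))) :=
      fun z => F ((consEquiv (arc a b) N).symm z)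
    have hf0 : f A₀ = (q β).face := by
      simp only [f, A₀, F, Equiv.symm_apply_apply]
      rfl
    have hf1 : f A₁ = (q α).face := by
      simp only [f, A₁, F, Equiv.symm_apply_apply]
      rfl
    have hfi : ∀ x, f (consEquiv (arc a b) N (Sum.inr x)) = (q x).face := fun x => by
      simp only [f, F, Equiv.symm_apply_apply]
      rfl
    have hn0 : A₀.next = A₁ := rfl
    have hn1 : A₁.next = A₀ := rfl
    have hni : ∀ x, (consEquiv (arc a b) N (Sum.inr x)).next =
      consEquiv (arc a b) N (Sum.inr x.next) := fun _ => rfl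
    have hαβ : α ≠ β := fun h => hab (by rw [← hα, h, hβ])
    have hle : faceCount (N.map (Node.relabel g)) ≤ faceCount (arc a b :: N) := by
      refine card_le_faceCount f (fun x y hxy => ?_) fun Q => ?_
      · obtain ⟨hne, hl⟩ := hxy
        rcases hcases x with rfl | rfl | ⟨x, rfl⟩
        · rw [hn0] at hne hl
          rw [hA₁] at hl
          rcases hcases y with rfl | rfl | ⟨y, rfl⟩
          · exact absurd hl.symm hab
          · exact absurd rfl hne
          · rw [hf0, hfi, huniq b hb y β hl.symm hβ]
        · rw [hn1] at hne hl
          rw [hA₀] at hl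
          rcases hcases y with rfl | rfl | ⟨y, rfl⟩
          · exact absurd rfl hne
          · exact absurd hl hab
          · rw [hf1, hfi, huniq a ha y α hl.symm hα]
        · rw [hni] at hne hl
          rw [consEquiv_inr_label] at hl
          rcases hcases y with rfl | rfl | ⟨y, rfl⟩
          · rw [hfi, hf0]
            have hx : x.next = α := huniq a ha _ _ hl hα
            refine Quot.sound ⟨?_, ?_⟩
            · rw [hqn, hx]
              exact fun h => hαβ (r.injective h)
            · rw [hqn, hq, hq, hx, hα, hβ, hgb, hgo a hab]
          · rw [hfi, hf1]
            have hx : x.next = β := huniq b hb _ _ hl hβ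
            refine Quot.sound ⟨?_, ?_⟩
            · rw [hqn, hx]
              exact fun h => hαβ (r.injective h).symm
            · rw [hqn, hq, hq, hx, hα, hβ, hgb, hgo a hab]
          · rw [hfi, hfi]
            refine Quot.sound ⟨?_, ?_⟩
            · rw [hqn]
              exact fun h => hne (by rw [r.injective h])
            · rw [hqn, hq, hq, hl, consEquiv_inr_label]
      · induction Q using Quot.ind with | _ x
        obtain ⟨x, rfl⟩ := r.surjective x
        exact ⟨_, hfi x⟩
    have hedge : edgeCount (arc a b :: N) = edgeCount (N.map (Node.relabel g)) + 1 := by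
      have : (labels (arc a b :: N)).toFinset =
          insert b (labels (N.map (Node.relabel g))).toFinset := by
        ext l
        rw [labels_cons, hlab]
        simp only [legs, List.cons_append, List.nil_append, List.mem_toFinset, List.mem_cons,
          Finset.mem_insert, List.mem_map]
        constructor
        · rintro (rfl | rfl | hl)
          · exact Or.inr ⟨b, hbmem, hgb⟩
          · exact Or.inl rfl
          · by_cases h : l = b
            · exact Or.inl h
            · exact Or.inr ⟨l, hl, hgo l h⟩
        · rintro (rfl | ⟨m, hm, rfl⟩)
          · exact Or.inr (Or.inl rfl)
          · by_cases h : m = b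
            · subst h; exact Or.inl hgb
            · rw [hgo m h]; exact Or.inr (Or.inr hm)
      rw [Diagram.edgeCount, this, Finset.card_insert_of_notMem]
      · rfl
      · rw [List.mem_toFinset, ← List.count_pos_iff, hcount, if_neg hab.symm, if_pos rfl]
        exact lt_irrefl 0
    have := hD.euler
    rw [List.length_map] at this
    rw [List.length_cons, hedge]
    omega

/-- Two knot diagrams represent the same knot. -/
def SameKnot (D D' : Diagram) : Prop :=
  ∃ (h : D.IsKnotDiagram) (h' : D'.IsKnotDiagram),
    KnotDiagram.knot ⟨D, h⟩ = KnotDiagram.knot ⟨D', h'⟩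

namespace SameKnot

variable {D D' D'' : Diagram}

theorem refl (h : D.IsKnotDiagram) : SameKnot D D := ⟨h, h, rfl⟩

theorem symm (h : SameKnot D D') : SameKnot D' D := ⟨h.2.1, h.1, h.2.2.symm⟩

theorem trans (h : SameKnot D D') (h' : SameKnot D' D'') : SameKnot D D'' :=
  ⟨h.1, h'.2.1, h.2.2.trans h'.2.2⟩

theorem left (h : SameKnot D D') : D.IsKnotDiagram := h.1

theorem right (h : SameKnot D D') : D'.IsKnotDiagram := h.2.1

theorem of_move (h : Move D D') (hD : D.IsKnotDiagram) (hD' : D'.IsKnotDiagram) :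
    SameKnot D D' :=
  ⟨hD, hD', Quot.sound h⟩

theorem of_perm (h : D.Perm D') (hD : D.IsKnotDiagram) : SameKnot D D' :=
  of_move (.perm h) hD (hD.perm h)

theorem relabel (hD : D.IsKnotDiagram) {g : ℕ → ℕ} (hg : Function.Injective g) :
    SameKnot D (D.map (Node.relabel g)) :=
  of_move (.relabel g hg D) hD (hD.relabel g hg)

theorem split {N : Diagram} {a b : ℕ} (hab : a ≠ b)
    (hD : IsKnotDiagram (N.map (Node.relabel (Function.update id b a))))
    (hb : N.labels.count b = 1) :
    SameKnot (N.map (Node.relabel (Function.update id b a))) (arc a b :: N) :=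
  (of_move (.merge a b hab N) (hD.split hab hb) hD).symm

theorem turn_triple {h : Equiv.Perm (Fin 3)} {a b c d e f : ℕ} {R : Diagram}
    (hD : IsKnotDiagram (triple h a b c d e f :: R)) :
    SameKnot (triple h a b c d e f :: R) (triple ((finRotate 3).trans h) b c d e f a :: R) :=
  of_move (.turn_triple h a b c d e f R) hD hD.turn_triple

end SameKnot

end Diagram
end KnotTheory
-- Diagrams in two parts, and computable conditions on tangles.
namespace KnotTheory

open Node

theorem Node.length_legs_le (v : Node) : v.legs.length ≤ 6 := by
  cases v <;> simp [legs]

namespace Diagram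

open HalfEdge

/-- The half-edges of the first part of a diagram. -/
def HalfEdge.inl {L : Diagram} (R : Diagram) (x : HalfEdge L) : HalfEdge (L ++ R) :=
  ⟨⟨x.1, by have := x.1.2; rw [List.length_append]; omega⟩, ⟨x.2, by
    have := x.2.2
    simp only [List.get_eq_getElem] at this ⊢
    rwa [List.getElem_append_left]⟩⟩

/-- The half-edges of the second part of a diagram. -/
def HalfEdge.inr (L : Diagram) {R : Diagram} (x : HalfEdge R) : HalfEdge (L ++ R) :=
  ⟨⟨L.length + x.1, by have := x.1.2; rw [List.length_append]; omega⟩, ⟨x.2, by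
    have := x.2.2
    simp only [List.get_eq_getElem] at this ⊢
    rw [List.getElem_append_right (by omega)]
    simp only [Nat.add_sub_cancel_left]
    exact this⟩⟩

section append

variable {L R : Diagram}

theorem label_inl (x : HalfEdge L) : (x.inl R).label = x.label := by
  simp [label_eq, HalfEdge.inl, List.getElem_append_left]

theorem label_inr (x : HalfEdge R) : (x.inr L).label = x.label := by
  simp [label_eq, HalfEdge.inr, List.getElem_append_right]

theorem valence_inl (x : HalfEdge L) : (x.inl R).valence = x.valence := by
  simp [valence, HalfEdge.inl, List.getElem_append_left]

theorem valence_inr (x : HalfEdge R) : (x.inr L).valence = x.valence := by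
  simp [valence, HalfEdge.inr, List.getElem_append_right]

theorem next_inl (x : HalfEdge L) : (x.inl R).next = x.next.inl R := by
  refine ext' rfl ?_
  rw [next_snd_val, valence_inl]
  exact (next_snd_val x).symm

theorem next_inr (x : HalfEdge R) : (x.inr L).next = x.next.inr L := by
  refine ext' rfl ?_
  rw [next_snd_val, valence_inr]
  exact (next_snd_val x).symm

theorem opposite_inl (x : HalfEdge L) : (x.inl R).opposite = x.opposite.inl R := by
  refine ext' ?_ ?_
  · have h := opposite_fst x
    rw [opposite_fst]
    change x.1.val = x.opposite.1.val
    rw [h]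
  · rw [opposite_snd_val, valence_inl]
    exact (opposite_snd_val x).symm

theorem opposite_inr (x : HalfEdge R) : (x.inr L).opposite = x.opposite.inr L := by
  refine ext' ?_ ?_
  · have h := opposite_fst x
    rw [opposite_fst]
    change L.length + x.1.val = L.length + x.opposite.1.val
    rw [h]
  · rw [opposite_snd_val, valence_inr]
    exact (opposite_snd_val x).symm

theorem inl_injective : Function.Injective (HalfEdge.inl (L := L) R) := by
  intro x y h
  exact ext' (congrArg (fun z : HalfEdge (L ++ R) => z.1.val) h)
    (congrArg (fun z : HalfEdge (L ++ R) => z.2.val) h)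

theorem inr_injective : Function.Injective (HalfEdge.inr L (R := R)) := by
  intro x y h
  refine ext' ?_ (congrArg (fun z : HalfEdge (L ++ R) => z.2.val) h)
  have : L.length + x.1.val = L.length + y.1.val :=
    congrArg (fun z : HalfEdge (L ++ R) => z.1.val) h
  omega

theorem inl_ne_inr (x : HalfEdge L) (y : HalfEdge R) : x.inl R ≠ y.inr L := by
  intro h
  have : x.1.val = L.length + y.1.val := congrArg (fun z : HalfEdge (L ++ R) => z.1.val) h
  have := x.1.2
  omega

theorem eq_inl_or_eq_inr (z : HalfEdge (L ++ R)) :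
    (∃ x : HalfEdge L, z = x.inl R) ∨ ∃ x : HalfEdge R, z = x.inr L := by
  by_cases h : z.1.val < L.length
  · have h2 : z.2.val < (L.get ⟨z.1.val, h⟩).legs.length :=
      lt_of_lt_of_eq z.2.2 (by simp [List.getElem_append_left h])
    exact Or.inl ⟨⟨⟨z.1, h⟩, ⟨z.2, h2⟩⟩, rfl⟩
  · have h1 : z.1.val < L.length + R.length := lt_of_lt_of_eq z.1.2 List.length_append
    have h2 : z.2.val < (R.get ⟨z.1.val - L.length, by omega⟩).legs.length :=
      lt_of_lt_of_eq z.2.2 (by simp [List.getElem_append_right (Nat.le_of_not_lt h)])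
    refine Or.inr ⟨⟨⟨z.1 - L.length, by omega⟩, ⟨z.2, h2⟩⟩, ext' ?_ rfl⟩
    change z.1.val = L.length + (z.1.val - L.length)
    omega

/-- The half-edges of a diagram that consists of two parts. -/
noncomputable def appendEquiv (L R : Diagram) : HalfEdge L ⊕ HalfEdge R ≃ HalfEdge (L ++ R) :=
  Equiv.ofBijective (Sum.elim (HalfEdge.inl R) (HalfEdge.inr L)) (by
    constructor
    · rintro (x | x) (y | y) h
      · exact congrArg _ (inl_injective h)
      · exact absurd h (inl_ne_inr x y)
      · exact absurd h.symm (inl_ne_inr y x)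
      · exact congrArg _ (inr_injective h)
    · intro z
      rcases eq_inl_or_eq_inr z with ⟨x, rfl⟩ | ⟨x, rfl⟩
      exacts [⟨Sum.inl x, rfl⟩, ⟨Sum.inr x, rfl⟩])

/-- A function on the half-edges of a diagram that consists of two parts. -/
noncomputable def appendElim {α : Type*} (f : HalfEdge L → α) (g : HalfEdge R → α)
    (z : HalfEdge (L ++ R)) : α := Sum.elim f g ((appendEquiv L R).symm z)

theorem appendElim_inl {α : Type*} (f : HalfEdge L → α) (g : HalfEdge R → α) (x : HalfEdge L) :
    appendElim f g (x.inl R) = f x := by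
  have : x.inl R = appendEquiv L R (Sum.inl x) := rfl
  rw [appendElim, this, Equiv.symm_apply_apply, Sum.elim_inl]

theorem appendElim_inr {α : Type*} (f : HalfEdge L → α) (g : HalfEdge R → α) (x : HalfEdge R) :
    appendElim f g (x.inr L) = g x := by
  have : x.inr L = appendEquiv L R (Sum.inr x) := rfl
  rw [appendElim, this, Equiv.symm_apply_apply, Sum.elim_inr]

end append

/-- Each pair in the list merges at most two classes into one, so it costs at most one element. -/
theorem card_le_card_quot_add {Q : Type*} [Finite Q] (l : List (Q × Q)) :
    Nat.card Q ≤ Nat.card (Quot fun a b => (a, b) ∈ l) + l.length := by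
  classical
  induction l with
  | nil =>
    refine (Nat.card_le_card_of_injective (Quot.mk fun a b => (a, b) ∈ ([] : List (Q × Q)))
      fun a b h => ?_).trans (Nat.le_add_right _ _)
    exact congrArg (Quot.lift id fun a b (h : (a, b) ∈ []) => absurd h (by simp)) h
  | cons p l ih =>
    obtain ⟨a, b⟩ := p
    let Q₁ := Quot fun x y : Q => (x, y) ∈ l
    let Q₀ := Quot fun x y : Q => (x, y) ∈ (a, b) :: l
    let A : Q₁ := Quot.mk _ a
    let B : Q₁ := Quot.mk _ b
    -- `f` undoes the last identification by always choosing `B`, so its image misses at most `A`.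
    let f : Q₀ → Q₁ := Quot.lift (fun x => if (Quot.mk _ x : Q₁) = A then B else Quot.mk _ x) (by
      intro x y h
      rcases List.mem_cons.1 h with h | h
      · obtain ⟨rfl, rfl⟩ := Prod.mk.inj h
        simp only [A, B]
        split_ifs <;> simp_all
      · have : (Quot.mk _ x : Q₁) = Quot.mk _ y := Quot.sound h
        simp only [this])
    have hs : Function.Surjective (fun o : Option Q₀ => o.elim A f) := by
      intro q
      by_cases hq : q = A
      · exact ⟨none, hq.symm⟩
      · induction q using Quot.ind with | _ x
        exact ⟨some (Quot.mk _ x), if_neg hq⟩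
    have := Nat.card_le_card_of_surjective _ hs
    rw [Finite.card_option] at this
    rw [List.length_cons]
    change Nat.card Q ≤ Nat.card Q₀ + (l.length + 1)
    have ih' : Nat.card Q ≤ Nat.card Q₁ + l.length := ih
    omega

/-! ### Tangles -/

/-- A corner of a list of nodes: its half-edge and the next half-edge, both with their edges. -/
structure Corner where
  id : ℕ
  label : ℕ
  nextId : ℕ
  nextLabel : ℕ
deriving DecidableEq

/-- The corners of a list of nodes, given by the edges at the nodes. -/
def corners (M : List (List ℕ)) : List Corner :=
  M.zipIdx.flatMap fun p => (List.range p.1.length).map fun j =>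
    ⟨8 * p.2 + j, p.1.getD j 0, 8 * p.2 + (j + 1) % p.1.length,
      p.1.getD ((j + 1) % p.1.length) 0⟩

/-- The pairs of opposite edges of a list of nodes. -/
def opposites (M : List (List ℕ)) : List (ℕ × ℕ) :=
  M.flatMap fun v => (List.range v.length).map fun j =>
    (v.getD j 0, v.getD ((j + v.length / 2) % v.length) 0)

/-- The corners `c` and `d` are consecutive on the boundary of a face. -/
def Corner.step (c d : Corner) : Bool := Nat.beq c.nextLabel d.label && !Nat.beq c.nextId d.id

/-- The corners are equal or consecutive on the boundary of a face. -/
def Corner.near (c d : Corner) : Bool := c == d || c.step d || d.step c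

/-- The number of edges of a tangle that are not among the first `n`. -/
def innerCount (n : ℕ) (M : List (List ℕ)) : ℕ := (M.flatten.toFinset.filter (n ≤ ·)).card

/-- The first `n` edges are the ends of the tangle, the other ones have two ends in it. -/
def endsOK (n : ℕ) (M : List (List ℕ)) : Bool :=
  (M.flatten.all fun l => if l < n then M.flatten.count l == 1
    else decide (l < 100) && M.flatten.count l == 2) &&
  (List.range n).all fun t => M.flatten.contains t

/-- The edge before `t` among the `n` ends of a tangle. -/
def before (n t : ℕ) : ℕ := (t + n - 1) % n

/-- The conditions on a tangle that is replaced: the corners `K` represent its inner faces, and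
`tr` is constant on its strands. -/
def Source (n : ℕ) (K : List ℕ) (tr : ℕ → ℕ) (M : List (List ℕ)) : Bool :=
  let C := corners M
  endsOK n M &&
  M.length + K.length == innerCount n M + 1 &&
  (C.all fun c => !decide (c.nextLabel < n) ||
    C.any fun d => d.label == before n c.nextLabel && c.near d) &&
  (C.all fun c => C.any fun d => (decide (d.label < n) || K.contains d.id) && c.near d) &&
  ((opposites M).all fun p => tr p.1 == tr p.2) &&
  M.flatten.all fun l => decide (tr l < n)

/-- The conditions on a tangle with the corners `C` and the opposite edges `O` that replaces another
one: `f` describes the faces, `P` lists the strands; the sides `t` and `cls t` of the tangle belong to the same face. -/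
def Target (n : ℕ) (cls tr f : ℕ → ℕ) (P : List (List ℕ)) (M : List (List ℕ))
    (C : List Corner) (O : List (ℕ × ℕ)) : Bool :=
  endsOK n M &&
  M.length + ((C.map fun c => f c.id).toFinset.filter (n ≤ ·)).card ==
    innerCount n M + 1 + ((List.range n).filter fun t => cls t != t).length &&
  (C.all fun c => C.all fun d => !c.step d || f c.id == f d.id) &&
  (C.all fun c => (!decide (c.label < n) || f c.id == cls c.label) &&
    (!decide (c.nextLabel < n) || f c.id == cls (before n c.nextLabel))) &&
  ((List.range n).all fun t => decide (cls t < n)) &&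
  (P.all fun p => (p.zip p.tail).all fun q => O.contains q) &&
  ((List.range n).all fun t => P.any fun p => p.contains t && p.contains (tr t)) &&
  M.flatten.all fun l => P.any fun p => p.contains l && p.any fun t => decide (t < n)

/-- The corner of a half-edge. -/
def HalfEdge.corner {L : Diagram} (x : HalfEdge L) : Corner :=
  ⟨8 * x.1 + x.2, x.label, 8 * x.1 + x.next.2, x.next.label⟩

section tangle

variable {L : Diagram}

theorem getD_legs (x : HalfEdge L) : (L[x.1.val].legs).getD x.2.val 0 = x.label := by
  rw [label_eq]
  exact List.getD_eq_getElem _ _ x.2.2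

theorem corner_mem (x : HalfEdge L) : x.corner ∈ corners (L.map legs) := by
  refine List.mem_flatMap.2 ⟨(L[x.1.val].legs, x.1.val), ?_, ?_⟩
  · rw [List.mem_zipIdx_iff_getElem?]
    simp
  · refine List.mem_map.2 ⟨x.2.val, List.mem_range.2 x.2.2, ?_⟩
    have h := next_snd_val x
    have hv : x.valence = (L[x.1.val].legs).length := rfl
    rw [hv] at h
    simp only [HalfEdge.corner, Corner.mk.injEq]
    refine ⟨trivial, getD_legs x, by rw [h], ?_⟩
    rw [← h]
    exact getD_legs x.next

theorem exists_corner {c : Corner} (hc : c ∈ corners (L.map legs)) :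
    ∃ x : HalfEdge L, x.corner = c := by
  obtain ⟨⟨v, i⟩, hv, hc'⟩ := List.mem_flatMap.1 hc
  obtain ⟨j, hj, rfl⟩ := List.mem_map.1 hc'
  rw [List.mem_zipIdx_iff_getElem?] at hv
  simp only [List.getElem?_map, Option.map_eq_some_iff] at hv
  obtain ⟨w, hw, rfl⟩ := hv
  obtain ⟨hi, rfl⟩ := List.getElem?_eq_some_iff.1 hw
  have hj' := List.mem_range.1 hj
  let x : HalfEdge L := ⟨⟨i, hi⟩, ⟨j, hj'⟩⟩
  refine ⟨x, ?_⟩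
  have h := next_snd_val x
  have hv : x.valence = (L[i].legs).length := rfl
  rw [hv] at h
  have h1 := getD_legs x
  have h2 := getD_legs x.next
  simp only [HalfEdge.corner, Corner.mk.injEq]
  refine ⟨rfl, h1.symm, by rw [h], ?_⟩
  rw [← h2, h]
  rfl

/-- Nodes have at most six legs, and eight numbers are reserved for each node. -/
theorem corner_injective : Function.Injective (HalfEdge.corner (L := L)) := by
  intro x y h
  have h1 : 8 * x.1.val + x.2.val = 8 * y.1.val + y.2.val := congrArg Corner.id h
  have hx := x.2.2
  have hy := y.2.2
  have := (L.get x.1).length_legs_le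
  have := (L.get y.1).length_legs_le
  exact ext' (by omega) (by omega)

theorem corner_id_inj {x y : HalfEdge L} (h1 : x.corner.id = y.corner.id) : x = y := by
  replace h1 : 8 * x.1.val + x.2.val = 8 * y.1.val + y.2.val := h1
  have hx := x.2.2
  have hy := y.2.2
  have := (L.get x.1).length_legs_le
  have := (L.get y.1).length_legs_le
  exact ext' (by omega) (by omega)

theorem step_corner_iff {x y : HalfEdge L} : x.corner.step y.corner = true ↔ FaceRel x y := by
  have : x.corner.nextId = x.next.corner.id := rfl
  rw [Corner.step, this, Bool.and_eq_true, Bool.not_eq_true', ← Bool.not_eq_true, Nat.beq_eq,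
    Nat.beq_eq, FaceRel]
  refine and_comm.trans (and_congr (not_congr ⟨corner_id_inj, fun h => by rw [h]⟩) Iff.rfl)

/-- Adjacency of corners within a tangle persists in every diagram that contains it. -/
theorem near_corner {x y : HalfEdge L} (h : x.corner.near y.corner = true) (R : Diagram) :
    (x.inl R).face = (y.inl R).face := by
  have key : ∀ x y : HalfEdge L, FaceRel x y → (x.inl R).face = (y.inl R).face := by
    intro x y h
    refine Quot.sound ⟨?_, ?_⟩
    · rw [next_inl]
      exact fun h' => h.1 (inl_injective h')
    · rw [next_inl, label_inl, label_inl]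
      exact h.2
  simp only [Corner.near, Bool.or_eq_true, beq_iff_eq, step_corner_iff] at h
  rcases h with (h | h) | h
  · rw [corner_injective h]
  · exact key _ _ h
  · exact (key _ _ h).symm

theorem opposite_mem (x : HalfEdge L) : (x.label, x.opposite.label) ∈ opposites (L.map legs) := by
  refine List.mem_flatMap.2 ⟨L[x.1.val].legs, ?_, ?_⟩
  · exact List.mem_map.2 ⟨_, List.getElem_mem _, rfl⟩
  · refine List.mem_map.2 ⟨x.2.val, List.mem_range.2 x.2.2, ?_⟩
    have h := opposite_snd_val x
    have hv : x.valence = (L[x.1.val].legs).length := rfl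
    rw [hv] at h
    refine Prod.ext (getD_legs x) ?_
    have h2 := getD_legs x.opposite
    rw [h] at h2
    rw [← h2]
    simp only [opposite_fst]

theorem exists_opposite {p : ℕ × ℕ} (hp : p ∈ opposites (L.map legs)) :
    ∃ x : HalfEdge L, x.label = p.1 ∧ x.opposite.label = p.2 := by
  obtain ⟨v, hv, hp'⟩ := List.mem_flatMap.1 hp
  obtain ⟨j, hj, rfl⟩ := List.mem_map.1 hp'
  obtain ⟨w, hw, rfl⟩ := List.mem_map.1 hv
  obtain ⟨i, rfl⟩ := List.get_of_mem hw
  have hj' := List.mem_range.1 hj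
  let x : HalfEdge L := ⟨i, ⟨j, hj'⟩⟩
  refine ⟨x, (getD_legs x).symm, ?_⟩
  have h := opposite_snd_val x
  have hv : x.valence = ((L.get i).legs).length := rfl
  rw [hv] at h
  have h2 := getD_legs x.opposite
  rw [h] at h2
  rw [← h2]
  simp only [opposite_fst]
  rfl

theorem flatten_map_legs (L : Diagram) : (L.map legs).flatten = labels L := by
  rw [Diagram.labels, List.flatMap_def]

end tangle

end Diagram
end KnotTheory
-- Replacement of a tangle.
namespace KnotTheory

open Node

namespace Diagram

open HalfEdge

/-- The edges of a tangle with `n` ends: the ends occur once, the inner edges twice. -/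
structure HasEnds (n : ℕ) (L : Diagram) : Prop where
  count_end : ∀ l ∈ L.labels, l < n → L.labels.count l = 1
  inner_lt : ∀ l ∈ L.labels, n ≤ l → l < 100
  count_inner : ∀ l ∈ L.labels, n ≤ l → L.labels.count l = 2
  end_mem : ∀ t < n, t ∈ L.labels

theorem hasEnds_of_endsOK {n : ℕ} {L : Diagram} (h : endsOK n (L.map legs) = true) :
    HasEnds n L := by
  simp only [endsOK, flatten_map_legs, Bool.and_eq_true, List.all_eq_true, List.contains_eq_mem,
    decide_eq_true_eq, List.mem_range] at h
  refine ⟨fun l hl hn => ?_, fun l hl hn => ?_, fun l hl hn => ?_, h.2⟩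
  · simpa [hn] using h.1 l hl
  · have := h.1 l hl
    rw [if_neg (not_lt.2 hn)] at this
    simp at this
    exact this.1
  · have := h.1 l hl
    rw [if_neg (not_lt.2 hn)] at this
    simp at this
    exact this.2

theorem HasEnds.unique {n : ℕ} {L : Diagram} (h : HasEnds n L) {x y : HalfEdge L}
    (hx : x.label < n) (hxy : x.label = y.label) : x = y := by
  have := h.count_end _ x.label_mem hx
  rw [← card_label, Finset.card_eq_one] at this
  obtain ⟨w, hw⟩ := this
  have hz : ∀ z : HalfEdge L, z.label = x.label → z = w := fun z hz => by
    have : z ∈ (Finset.univ.filter fun y : HalfEdge L => y.label = x.label) := by simp [hz]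
    rw [hw] at this
    simpa using this
  rw [hz x rfl, hz y hxy.symm]

/-- The labels of the rest of a diagram outside a tangle with `n` ends. -/
def Outside (n : ℕ) (R : Diagram) : Prop := ∀ l ∈ R.labels, l < n ∨ 100 ≤ l

section ends

variable {n : ℕ} {L L' R : Diagram}

theorem HasEnds.lt_of_mem (hL : HasEnds n L) (hR : Outside n R) {l : ℕ} (h : l ∈ L.labels)
    (h' : l ∈ R.labels) : l < n := by
  by_contra hn
  have := hL.inner_lt l h (not_lt.1 hn)
  rcases hR l h' with h | h <;> omega

theorem HasEnds.end_mem_outside (hL : HasEnds n L) (hD : IsKnotDiagram (L ++ R)) {t : ℕ}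
    (ht : t < n) : R.labels.count t = 1 := by
  have h1 := hL.end_mem t ht
  have h2 := hL.count_end t h1 ht
  have h3 := hD.two_ends t (by rw [labels_append]; exact List.mem_append_left _ h1)
  rw [labels_append, List.count_append] at h3
  omega

theorem HasEnds.two_ends (hL : HasEnds n L) (hL' : HasEnds n L') (hR : Outside n R)
    (hD : IsKnotDiagram (L ++ R)) :
    ∀ l ∈ labels (L' ++ R), (labels (L' ++ R)).count l = 2 := by
  intro l hl
  rw [labels_append] at hl ⊢
  rw [List.count_append]
  by_cases hn : l < n
  · rw [hL'.count_end l (hL'.end_mem l hn) hn, hL.end_mem_outside hD hn]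
  · by_cases h : l ∈ L'.labels
    · rw [hL'.count_inner l h (not_lt.1 hn),
        List.count_eq_zero_of_not_mem fun h' => hn (hL'.lt_of_mem hR h h')]
    · have h' : l ∈ R.labels := (List.mem_append.1 hl).resolve_left h
      have h3 := hD.two_ends l (by rw [labels_append]; exact List.mem_append_right _ h')
      rw [labels_append, List.count_append,
        List.count_eq_zero_of_not_mem fun h => hn (hL.lt_of_mem hR h h')] at h3
      rw [List.count_eq_zero_of_not_mem h]
      exact h3

theorem HasEnds.edgeCount (hL : HasEnds n L) (hR : Outside n R)
    (hn : ∀ t < n, t ∈ R.labels) :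
    Diagram.edgeCount (L ++ R) = innerCount n (L.map legs) + R.labels.toFinset.card := by
  rw [Diagram.edgeCount, innerCount, flatten_map_legs, ← Finset.card_union_of_disjoint]
  · congr 1
    ext l
    simp only [labels_append, List.mem_toFinset, List.mem_append, Finset.mem_union,
      Finset.mem_filter]
    constructor
    · rintro (h | h)
      · by_cases hl : l < n
        · exact Or.inr (hn l hl)
        · exact Or.inl ⟨h, not_lt.1 hl⟩
      · exact Or.inr h
    · rintro (h | h)
      exacts [Or.inl h.1, Or.inr h]
  · rw [Finset.disjoint_left]
    intro l h h'
    simp only [List.mem_toFinset, Finset.mem_filter] at h h'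
    exact absurd (hL.lt_of_mem hR h.1 h') (not_lt.2 h.2)

end ends

/-- A tangle whose inner faces are represented by `K`, in terms of half-edges. -/
structure SourceSpec (n : ℕ) (K : List ℕ) (tr : ℕ → ℕ) (L : Diagram) : Prop where
  ends : HasEnds n L
  euler : L.length + K.length = innerCount n (L.map legs) + 1
  side : ∀ x : HalfEdge L, x.next.label < n →
    ∃ y : HalfEdge L, y.label = before n x.next.label ∧ x.corner.near y.corner = true
  inner : ∀ x : HalfEdge L, ∃ y : HalfEdge L, (y.label < n ∨ y.corner.id ∈ K) ∧
    x.corner.near y.corner = true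
  strand : ∀ x : HalfEdge L, tr x.label = tr x.opposite.label
  strand_lt : ∀ x : HalfEdge L, tr x.label < n

theorem sourceSpec {n : ℕ} {K : List ℕ} {tr : ℕ → ℕ} {L : Diagram}
    (h : Source n K tr (L.map legs) = true) : SourceSpec n K tr L := by
  simp only [Source, Bool.and_eq_true, List.all_eq_true, Bool.or_eq_true, Bool.not_eq_true',
    decide_eq_false_iff_not, List.any_eq_true, beq_iff_eq, List.length_map, decide_eq_true_eq,
    List.contains_eq_mem] at h
  obtain ⟨⟨⟨⟨⟨h1, h2⟩, h3⟩, h4⟩, h5⟩, h6⟩ := h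
  refine ⟨hasEnds_of_endsOK h1, h2, fun x hx => ?_, fun x => ?_, fun x => ?_, fun x => ?_⟩
  · obtain ⟨d, hd, h⟩ := (h3 _ (corner_mem x)).resolve_left (not_not.2 hx)
    obtain ⟨y, rfl⟩ := exists_corner hd
    exact ⟨y, h.1, h.2⟩
  · obtain ⟨d, hd, h⟩ := h4 _ (corner_mem x)
    obtain ⟨y, rfl⟩ := exists_corner hd
    exact ⟨y, h.1, h.2⟩
  · exact h5 _ (opposite_mem x)
  · exact h6 _ (by rw [flatten_map_legs]; exact x.label_mem)

/-- A tangle that can replace another one, in terms of half-edges. -/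
structure TargetSpec (n : ℕ) (cls tr f : ℕ → ℕ) (P : List (List ℕ)) (L : Diagram) : Prop where
  ends : HasEnds n L
  euler : L.length +
    (((corners (L.map legs)).map fun c => f c.id).toFinset.filter (n ≤ ·)).card =
    innerCount n (L.map legs) + 1 + ((List.range n).filter fun t => cls t != t).length
  step : ∀ x y : HalfEdge L, FaceRel x y → f x.corner.id = f y.corner.id
  label : ∀ x : HalfEdge L, x.label < n → f x.corner.id = cls x.label
  nextLabel : ∀ x : HalfEdge L, x.next.label < n →
    f x.corner.id = cls (before n x.next.label)
  cls_lt : ∀ t < n, cls t < n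
  path : ∀ p ∈ P, ∀ q ∈ p.zip p.tail, q ∈ opposites (L.map legs)
  strand : ∀ t < n, ∃ p ∈ P, t ∈ p ∧ tr t ∈ p
  cover : ∀ x : HalfEdge L, ∃ p ∈ P, x.label ∈ p ∧ ∃ t ∈ p, t < n

theorem targetSpec {n : ℕ} {cls tr f : ℕ → ℕ} {P : List (List ℕ)} {L : Diagram}
    (h : Target n cls tr f P (L.map legs) (corners (L.map legs))
      (opposites (L.map legs)) = true) : TargetSpec n cls tr f P L := by
  simp only [Target, Bool.and_eq_true, List.all_eq_true, Bool.or_eq_true, Bool.not_eq_true',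
    decide_eq_false_iff_not, List.any_eq_true, beq_iff_eq, List.length_map, decide_eq_true_eq,
    List.contains_eq_mem, List.mem_range] at h
  obtain ⟨⟨⟨⟨⟨⟨⟨h1, h2⟩, h3⟩, h4⟩, h5⟩, h6⟩, h7⟩, h8⟩ := h
  refine ⟨hasEnds_of_endsOK h1, h2, fun x y hxy => ?_, fun x hx => ?_, fun x hx => ?_, h5, h6,
    h7, fun x => ?_⟩
  · refine (h3 _ (corner_mem x) _ (corner_mem y)).resolve_left ?_
    rw [step_corner_iff.2 hxy]
    simp
  · exact (h4 _ (corner_mem x)).1.resolve_left (not_not.2 hx)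
  · exact (h4 _ (corner_mem x)).2.resolve_left (not_not.2 hx)
  · exact h8 _ (by rw [flatten_map_legs]; exact x.label_mem)

section replace

variable {n : ℕ} {K : List ℕ} {cls tr f : ℕ → ℕ} {P : List (List ℕ)} {L L' R : Diagram}

/-- A strand invariant of the new diagram is pulled back to the old one: it is kept outside, and on
an old inner edge it takes its value at the end `tr` of the strand. It is constant there, and by
`cover` each edge of the new tangle lies on a path that contains an end. -/
theorem componentCount_replace (hR : Outside n R) (hS : SourceSpec n K tr L)
    (hT : TargetSpec n cls tr f P L') (hD : IsKnotDiagram (L ++ R)) :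
    componentCount (L' ++ R) = 1 := by
  have hend : ∀ t < n, ∃ x : HalfEdge R, x.label = t := fun t ht =>
    exists_label (List.count_pos_iff.1 (by rw [hS.ends.end_mem_outside hD ht]; exact one_pos))
  have hne : Nonempty (HalfEdge (L' ++ R)) := by
    obtain ⟨z⟩ := nonempty_of_componentCount hD.one_component
    rcases eq_inl_or_eq_inr z with ⟨x, rfl⟩ | ⟨x, rfl⟩
    · obtain ⟨y, -⟩ := hend _ (hS.strand_lt x)
      exact ⟨y.inr L'⟩
    · exact ⟨x.inr L'⟩
  refine componentCount_eq_one fun φ h₁ h₂ => ?_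
  -- As `φ` depends on the edge only, it becomes a predicate on edge names, which the old and the
  -- new diagram share outside the tangle.
  let g : ℕ → Prop := fun l => ∃ x : HalfEdge (L' ++ R), x.label = l ∧ φ x
  have hg : ∀ x, φ x = g x.label := fun x =>
    propext ⟨fun h => ⟨x, rfl, h⟩, fun ⟨y, hy, h⟩ => by rwa [h₁ x y hy.symm]⟩
  have hopp : ∀ q ∈ opposites (L'.map legs), g q.1 = g q.2 := by
    intro q hq
    obtain ⟨x, hx, hx'⟩ := exists_opposite hq
    rw [← hx, ← hx', ← label_inl (R := R), ← label_inl (R := R) x.opposite, ← hg, ← hg,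
      ← opposite_inl, ← h₂]
  have hpath : ∀ p : List ℕ, (∀ q ∈ p.zip p.tail, g q.1 = g q.2) → ∀ l ∈ p, ∀ m ∈ p,
      g l = g m := by
    intro p hp
    have key : ∀ l ∈ p, some (g l) = p.head?.map g := by
      induction p with
      | nil => simp
      | cons a p ih =>
        intro l hl
        rcases List.mem_cons.1 hl with rfl | hl
        · rfl
        cases p with
        | nil => simp at hl
        | cons b p =>
          have h1 : g a = g b := hp (a, b) (by simp)
          rw [ih (fun q hq => hp q (by simp at hq ⊢; exact Or.inr hq)) l hl]
          simp [h1]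
    intro l hl m hm
    exact Option.some.inj ((key l hl).trans (key m hm).symm)
  have hP : ∀ p ∈ P, ∀ l ∈ p, ∀ m ∈ p, g l = g m := fun p hp =>
    hpath p fun q hq => hopp q (hT.path p hp q hq)
  have htr : ∀ t < n, g (tr t) = g t := by
    intro t ht
    obtain ⟨p, hp, h, h'⟩ := hT.strand t ht
    exact hP p hp _ h' _ h
  let F : HalfEdge (L ++ R) → Prop :=
    appendElim (fun x => g (tr x.label)) fun x => g x.label
  have hF := eq_of_componentCount hD.one_component F (by
    intro z w hzw
    rcases eq_inl_or_eq_inr z with ⟨x, rfl⟩ | ⟨x, rfl⟩ <;>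
    rcases eq_inl_or_eq_inr w with ⟨y, rfl⟩ | ⟨y, rfl⟩ <;>
    simp only [F, appendElim_inl, appendElim_inr] <;>
    simp only [label_inl, label_inr] at hzw
    · rw [hzw]
    · have := hS.ends.lt_of_mem hR x.label_mem (hzw ▸ y.label_mem)
      rw [htr _ this, hzw]
    · have := hS.ends.lt_of_mem hR y.label_mem (hzw ▸ x.label_mem)
      rw [htr _ this, hzw]
    · rw [hzw]) (by
    intro z
    rcases eq_inl_or_eq_inr z with ⟨x, rfl⟩ | ⟨x, rfl⟩
    · rw [opposite_inl]
      simp only [F, appendElim_inl, hS.strand x]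
    · rw [opposite_inr]
      simp only [F, appendElim_inr]
      rw [← label_inr (L := L'), ← hg, ← label_inr (L := L') x.opposite, ← hg, ← opposite_inr,
        ← h₂])
  have key : ∀ z : HalfEdge (L' ++ R), ∃ w, φ z = F w := by
    intro z
    rcases eq_inl_or_eq_inr z with ⟨x, rfl⟩ | ⟨x, rfl⟩
    · obtain ⟨p, hp, hx, t, ht, htn⟩ := hT.cover x
      obtain ⟨y, rfl⟩ := hend t htn
      refine ⟨y.inr L, ?_⟩
      rw [hg, label_inl, hP p hp _ hx _ ht]
      simp only [F, appendElim_inr]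
    · refine ⟨x.inr L, ?_⟩
      rw [hg, label_inr]
      simp only [F, appendElim_inr]
  intro z w
  obtain ⟨z', hz⟩ := key z
  obtain ⟨w', hw⟩ := key w
  rw [hz, hw, hF z' w']

/-- The new faces, together with the old inner faces `K` that may be lost, are mapped onto the new
inner faces and the old faces modulo identification of the sides `t` and `cls t`. Each
identification costs at most one face. -/
theorem faceCount_replace (hR : Outside n R) (hS : SourceSpec n K tr L)
    (hT : TargetSpec n cls tr f P L') (hD : IsKnotDiagram (L ++ R)) :
    faceCount (L ++ R) +
      (((corners (L'.map legs)).map fun c => f c.id).toFinset.filter (n ≤ ·)).card ≤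
    faceCount (L' ++ R) + K.length + ((List.range n).filter fun t => cls t != t).length := by
  classical
  have hend : ∀ t < n, ∃ x : HalfEdge R, x.label = t := fun t ht =>
    exists_label (List.count_pos_iff.1 (by rw [hS.ends.end_mem_outside hD ht]; exact one_pos))
  have hbef : ∀ t < n, before n t < n := fun t ht => Nat.mod_lt _ (by omega)
  let Q := Quot (FaceRel (D := L ++ R))
  have : Nonempty Q := (nonempty_of_componentCount hD.one_component).map face
  -- `ρ t` will be the old face at the side from the end `t` to the cyclically next end.
  have hdart : ∀ t, ∃ x : Q, ∀ y : HalfEdge L, t < n → y.label = t → (y.inl R).face = x := by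
    intro t
    by_cases ht : t < n
    · obtain ⟨y, rfl⟩ := exists_label (hS.ends.end_mem t ht)
      exact ⟨(y.inl R).face, fun z _ hz => by rw [hS.ends.unique ht hz.symm]⟩
    · exact ⟨Classical.arbitrary Q, fun y h => absurd h ht⟩
  choose ρ hρ using hdart
  have side : ∀ x : HalfEdge L, x.next.label < n →
      (x.inl R).face = ρ (before n x.next.label) := by
    intro x hx
    obtain ⟨y, hy, h⟩ := hS.side x hx
    rw [near_corner h R]
    exact hρ _ y (hbef _ hx) hy
  have out₁ : ∀ x : HalfEdge R, x.label < n → (x.inr L).face = ρ (before n x.label) := by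
    intro x hx
    obtain ⟨y, hy⟩ := exists_label (hS.ends.end_mem _ hx)
    have h := side y.prev (by rw [next_prev, hy]; exact hx)
    rw [next_prev, hy] at h
    rw [← h]
    refine (Quot.sound ⟨?_, ?_⟩).symm
    · rw [next_inl]
      exact inl_ne_inr _ _
    · rw [next_inl, next_prev, label_inl, label_inr, hy]
  have out₂ : ∀ x : HalfEdge R, x.next.label < n → (x.inr L).face = ρ x.next.label := by
    intro x hx
    obtain ⟨y, hy⟩ := exists_label (hS.ends.end_mem _ hx)
    rw [← hρ _ y hx hy]
    refine Quot.sound ⟨?_, ?_⟩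
    · rw [next_inr]
      exact (inl_ne_inr _ _).symm
    · rw [next_inr, label_inl, label_inr, hy]
  let ids : List (Q × Q) :=
    ((List.range n).filter fun t => cls t != t).map fun t => (ρ t, ρ (cls t))
  let Q₀ := Quot fun a b : Q => (a, b) ∈ ids
  have hids : ∀ t < n, (Quot.mk _ (ρ (cls t)) : Q₀) = Quot.mk _ (ρ t) := by
    intro t ht
    by_cases h : cls t = t
    · rw [h]
    · exact (Quot.sound (List.mem_map.2 ⟨t, by simp [ht, h], rfl⟩)).symm
  have hQ : faceCount (L ++ R) ≤ Nat.card Q₀ + _ := card_le_card_quot_add ids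
  simp only [ids, List.length_map] at hQ
  let I := ((corners (L'.map legs)).map fun c => f c.id).toFinset.filter (n ≤ ·)
  have hI : ∀ x : HalfEdge L', ¬ f x.corner.id < n → f x.corner.id ∈ I := fun x hx => by
    simp only [I, Finset.mem_filter, List.mem_toFinset, List.mem_map]
    exact ⟨⟨_, corner_mem x, rfl⟩, not_lt.1 hx⟩
  let φ₁ : HalfEdge L' → Q₀ ⊕ I := fun x =>
    if h : f x.corner.id < n then Sum.inl (Quot.mk _ (ρ (f x.corner.id)))
    else Sum.inr ⟨_, hI x h⟩
  have hφ₁ : ∀ x y, f x.corner.id = f y.corner.id → φ₁ x = φ₁ y := by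
    intro x y h
    simp only [φ₁, h]
  have hφ₁' : ∀ x, ∀ t < n, f x.corner.id = cls t → φ₁ x = Sum.inl (Quot.mk _ (ρ t)) := by
    intro x t ht h
    simp only [φ₁, h]
    rw [dif_pos (hT.cls_lt t ht), hids t ht]
  let φ : HalfEdge (L' ++ R) → Q₀ ⊕ I :=
    appendElim φ₁ fun x => Sum.inl (Quot.mk _ (x.inr L).face)
  have hφ : ∀ z w, FaceRel z w → φ z = φ w := by
    rintro z w ⟨hne, hl⟩
    rcases eq_inl_or_eq_inr z with ⟨x, rfl⟩ | ⟨x, rfl⟩ <;>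
    rcases eq_inl_or_eq_inr w with ⟨y, rfl⟩ | ⟨y, rfl⟩ <;>
    simp only [φ, appendElim_inl, appendElim_inr] <;>
    simp only [next_inl, next_inr, label_inl, label_inr] at hl hne
    · exact hφ₁ _ _ (hT.step x y ⟨fun h => hne (by rw [h]), hl⟩)
    · have hlt := hT.ends.lt_of_mem hR x.next.label_mem (hl ▸ y.label_mem)
      rw [hφ₁' x _ (hbef _ hlt) (hT.nextLabel x hlt), out₁ y (hl ▸ hlt), hl]
    · have hlt := hT.ends.lt_of_mem hR y.label_mem (hl ▸ x.next.label_mem)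
      rw [hφ₁' y _ hlt (hT.label y hlt), out₂ x (hl ▸ hlt), hl]
    · have : (x.inr L).face = (y.inr L).face := Quot.sound
        ⟨by rw [next_inr]; exact fun h => hne (by rw [inr_injective h]),
          by rw [next_inr, label_inr, label_inr, hl]⟩
      rw [this]
  let A : HalfEdge (L ++ R) → Q₀ := fun z => Quot.mk _ z.face
  have hA : Nonempty Q₀ := ‹Nonempty Q›.map (Quot.mk _)
  -- A class of `Q₀` is hit from outside, through an end of the tangle, or through one of the
  -- representatives in `K`; the arbitrary value is harmless.
  let Ψ : Quot (FaceRel (D := L' ++ R)) ⊕ Fin K.length → Q₀ ⊕ I :=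
    Sum.elim (Quot.lift φ hφ) fun i => Sum.inl
      (if h : ∃ y : HalfEdge L, y.corner.id = K.get i then A (h.choose.inl R)
        else Classical.arbitrary Q₀)
  have hΨ : Function.Surjective Ψ := by
    rintro (q | ⟨i, hi⟩)
    · induction q using Quot.ind with | _ q
      induction q using Quot.ind with | _ z
      have hend' : ∀ t < n, ∃ a, Ψ a = Sum.inl (Quot.mk _ (ρ t)) := by
        intro t ht
        obtain ⟨y, hy⟩ := hend t ht
        refine ⟨Sum.inl (Quot.mk _ (y.prev.inr L')), ?_⟩
        simp only [Ψ, Sum.elim_inl, φ, appendElim_inr]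
        rw [out₂ y.prev (by rw [next_prev, hy]; exact ht), next_prev, hy]
      rcases eq_inl_or_eq_inr z with ⟨x, rfl⟩ | ⟨x, rfl⟩
      · obtain ⟨y, hy, hxy⟩ := hS.inner x
        have hf : (Quot.mk _ (x.inl R) : Q) = (y.inl R).face := near_corner hxy R
        rw [hf]
        rcases hy with hy | hy
        · rw [hρ _ y hy rfl]
          exact hend' _ hy
        · obtain ⟨i, hi⟩ := List.get_of_mem hy
          have hex : ∃ y : HalfEdge L, y.corner.id = K.get i := ⟨y, hi.symm⟩
          refine ⟨Sum.inr i, ?_⟩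
          simp only [Ψ, Sum.elim_inr]
          rw [dif_pos hex, corner_id_inj (hex.choose_spec.trans hi)]
      · exact ⟨Sum.inl (Quot.mk _ (x.inr L')), by
          simp only [Ψ, Sum.elim_inl, φ, appendElim_inr]; rfl⟩
    · have hi' := hi
      simp only [I, Finset.mem_filter, List.mem_toFinset, List.mem_map] at hi'
      obtain ⟨⟨c, hc, rfl⟩, hn⟩ := hi'
      obtain ⟨x, rfl⟩ := exists_corner hc
      refine ⟨Sum.inl (Quot.mk _ (x.inl R)), ?_⟩
      simp only [Ψ, Sum.elim_inl, φ, appendElim_inl, φ₁]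
      rw [dif_neg (not_lt.2 hn)]
  have hcard := Nat.card_le_card_of_surjective Ψ hΨ
  rw [Nat.card_sum, Nat.card_sum, Nat.card_eq_fintype_card (α := I), Fintype.card_coe,
    Nat.card_eq_fintype_card (α := Fin _), Fintype.card_fin] at hcard
  have : Nat.card (Quot (FaceRel (D := L' ++ R))) = faceCount (L' ++ R) := rfl
  change faceCount (L ++ R) + I.card ≤ _
  omega

/-- A tangle can be replaced by another one with the same ends, connected in the same way. -/
theorem IsKnotDiagram.replace (hD : IsKnotDiagram (L ++ R)) (hR : Outside n R)
    (hS : Source n K tr (L.map legs) = true) (hT : Target n cls tr f P (L'.map legs) (corners (L'.map legs))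
      (opposites (L'.map legs)) = true) :
    IsKnotDiagram (L' ++ R) := by
  replace hS := sourceSpec hS
  replace hT := targetSpec hT
  refine isKnotDiagram_of_le (hS.ends.two_ends hT.ends hR hD) (componentCount_replace hR hS hT hD)
    ?_
  have h1 := faceCount_replace hR hS hT hD
  have hend : ∀ t < n, t ∈ R.labels := fun t ht =>
    List.count_pos_iff.1 (by rw [hS.ends.end_mem_outside hD ht]; exact one_pos)
  have h2 := hS.ends.edgeCount hR hend
  have h3 := hT.ends.edgeCount hR hend
  have h4 := hD.euler
  -- These are Euler counts for tangles in a disc. Every identification of sides compensates for one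
  -- further connected piece of the new tangle.
  have h5 := hS.euler
  have h6 := hT.euler
  rw [List.length_append] at h4 ⊢
  omega

end replace

end Diagram
end KnotTheory
-- Reidemeister moves on tangles, carried out by evaluation.
namespace KnotTheory

open Node

namespace Diagram

open HalfEdge

/-- Reading the edges at a node from another starting edge preserves knot diagrams. -/
theorem IsKnotDiagram.turn {v v' : Node} {R : Diagram} (k : ℕ) (h : v'.legs = v.legs.rotate k)
    (hD : IsKnotDiagram (v :: R)) : IsKnotDiagram (v' :: R) := by
  have hlen : v.legs.length = v'.legs.length := by rw [h, List.length_rotate]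
  have hp : (labels (v :: R)).Perm (labels (v' :: R)) := by
    rw [labels_cons, labels_cons, h]
    exact (List.rotate_perm _ _).symm.append_right _
  have hval : ∀ (m : ℕ) (i : Fin m), ((finRotate m ^ k) i).val = (i.val + k) % m := by
    intro m i
    induction k with
    | zero => exact (Nat.mod_eq_of_lt i.2).symm
    | succ k ih =>
      rw [pow_succ', Equiv.Perm.mul_apply, val_finRotate]
      have : ∀ j, ((finRotate m ^ j) i).val = (i.val + j) % m := by
        intro j
        induction j with
        | zero => exact (Nat.mod_eq_of_lt i.2).symm
        | succ j ih => rw [pow_succ', Equiv.Perm.mul_apply, val_finRotate, ih, Nat.mod_add_mod,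
            add_assoc]
      rw [this, Nat.mod_add_mod, add_assoc]
  let σ : Fin v'.legs.length ≃ Fin v.legs.length :=
    (finRotate v'.legs.length ^ k).trans (finCongr hlen.symm)
  have hσ : ∀ i, v.legs.get (σ i) = v'.legs.get i := by
    intro i
    simp only [List.get_eq_getElem, h, List.getElem_rotate]
    congr 1
    change ((finRotate v'.legs.length ^ k) i).val = _
    exact (hval _ i).trans (congrArg ((i.val + k) % ·) hlen.symm)
  have hrot : ∀ i, σ (finRotate _ i) = finRotate _ (σ i) := by
    intro i
    refine Fin.ext ?_
    rw [val_finRotate]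
    change ((finRotate v'.legs.length ^ k) (finRotate _ i)).val =
      (((finRotate v'.legs.length ^ k) i).val + 1) % _
    rw [hval, hval, val_finRotate, hlen, Nat.mod_add_mod, Nat.mod_add_mod]
    congr 1
    omega
  let i : HalfEdgeIso (v :: R) (v' :: R) := .cons σ.symm (fun j => by
    rw [Equiv.symm_apply_eq, hrot, Equiv.apply_symm_apply]) (.refl R)
  have hi : ∀ x, (i.toEquiv x).label = x.label := by
    intro x
    obtain ⟨x | x, rfl⟩ := (consEquiv v R).surjective x
    · change v'.legs.get (σ.symm x) = v.legs.get x
      rw [← hσ, Equiv.apply_symm_apply]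
    · rfl
  refine i.isKnotDiagram hD (fun x y => by rw [hi, hi]) (fun l hl => ?_) rfl ?_
  · rw [← hp.count_eq]
    exact hD.two_ends l (hp.mem_iff.2 hl)
  · rw [Diagram.edgeCount, Diagram.edgeCount, List.toFinset_eq_of_perm _ _ hp]

theorem SameKnot.turn_double {a b c d : ℕ} {R : Diagram}
    (hD : IsKnotDiagram (double a b c d :: R)) :
    SameKnot (double a b c d :: R) (double c d a b :: R) :=
  of_move (.turn_double a b c d R) hD (hD.turn 2 rfl)

theorem SameKnot.turn_arc {a b : ℕ} {R : Diagram} (hD : IsKnotDiagram (arc a b :: R)) :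
    SameKnot (arc a b :: R) (arc b a :: R) :=
  of_move (.turn_arc a b R) hD (hD.turn 1 rfl)

/-! ### Tangles with numbered edges and moves between them -/

/-- The heights of three strands, given by the flags which say that strand `0` is over
strand `1`, that strand `0` is over strand `2`, and that strand `1` is over strand `2`. -/
def heights : Bool → Bool → Bool → Equiv.Perm (Fin 3)
  | true, true, true => Equiv.swap 0 2
  | true, true, false => (finRotate 3).symm
  | true, false, false => Equiv.swap 0 1
  | false, true, true => finRotate 3
  | false, false, true => Equiv.swap 1 2
  | _, _, _ => 1

/-- The flags belong to three strands at different heights. -/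
def layered (s₀₁ s₀₂ s₁₂ : Bool) : Bool := !(s₀₁ != s₀₂ && s₀₁ == s₁₂)

/-- The patterns that `layered` excludes are the two cyclic ones `s, !s, s`, which are those of
delta-crossings. -/
theorem decide_heights : ∀ s₀₁ s₀₂ s₁₂ : Bool, layered s₀₁ s₀₂ s₁₂ = true →
    decide (heights s₀₁ s₀₂ s₁₂ 1 < heights s₀₁ s₀₂ s₁₂ 0) = s₀₁ ∧
    decide (heights s₀₁ s₀₂ s₁₂ 2 < heights s₀₁ s₀₂ s₁₂ 0) = s₀₂ ∧
    decide (heights s₀₁ s₀₂ s₁₂ 2 < heights s₀₁ s₀₂ s₁₂ 1) = s₁₂ := by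
  decide

theorem exists_heights : ∀ h : Equiv.Perm (Fin 3), ∃ s₀₁ s₀₂ s₁₂ : Bool,
    layered s₀₁ s₀₂ s₁₂ = true ∧ heights s₀₁ s₀₂ s₁₂ = h := by
  decide

theorem layeredTriangle_heights {s₀₁ s₀₂ s₁₂ : Bool} (h : layered s₀₁ s₀₂ s₁₂ = true)
    (a b c d e f p q r : ℕ) :
    layeredTriangle (heights s₀₁ s₀₂ s₁₂) a b c d e f p q r =
      triangle s₀₁ s₀₂ s₁₂ a b c d e f p q r := by
  obtain ⟨h₁, h₂, h₃⟩ := decide_heights _ _ _ h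
  rw [layeredTriangle, h₁, h₂, h₃]

/-- A node, where the heights at a triple crossing are given by flags. -/
inductive Item where
  | arc (a b : ℕ)
  | double (a b c d : ℕ)
  | triple (s₀₁ s₀₂ s₁₂ : Bool) (a b c d e f : ℕ)
deriving DecidableEq

namespace Item

/-- The node. -/
def node : Item → Node
  | arc a b => .arc a b
  | double a b c d => .double a b c d
  | triple s₀₁ s₀₂ s₁₂ a b c d e f => .triple (heights s₀₁ s₀₂ s₁₂) a b c d e f

/-- The edges at the node. -/
def legs : Item → List ℕ
  | arc a b => [a, b]
  | double a b c d => [a, b, c, d]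
  | triple _ _ _ a b c d e f => [a, b, c, d, e, f]

/-- Rename the edges. -/
def relabel (g : ℕ → ℕ) : Item → Item
  | arc a b => arc (g a) (g b)
  | double a b c d => double (g a) (g b) (g c) (g d)
  | triple s₀₁ s₀₂ s₁₂ a b c d e f => triple s₀₁ s₀₂ s₁₂ (g a) (g b) (g c) (g d) (g e) (g f)

theorem legs_node (i : Item) : i.node.legs = i.legs := by cases i <;> rfl

theorem node_relabel (g : ℕ → ℕ) (i : Item) : (i.relabel g).node = i.node.relabel g := by
  cases i <;> rfl

/-- The double crossing `Node.crossing s w x y z`. -/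
def crossing (s : Bool) (w x y z : ℕ) : Item := if s then double x y z w else double w x y z

theorem node_crossing (s : Bool) (w x y z : ℕ) :
    (crossing s w x y z).node = Node.crossing s w x y z := by cases s <;> rfl

/-- The nodes of `Node.triangle`. -/
def triangle (s₀₁ s₀₂ s₁₂ : Bool) (a b c d e f p q r : ℕ) : List Item :=
  [crossing s₀₁ a b r p, crossing s₀₂ r c d q, crossing s₁₂ p q e f]

theorem map_node_triangle (s₀₁ s₀₂ s₁₂ : Bool) (a b c d e f p q r : ℕ) :
    (triangle s₀₁ s₀₂ s₁₂ a b c d e f p q r).map node =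
      Node.triangle s₀₁ s₀₂ s₁₂ a b c d e f p q r := by
  simp [triangle, Node.triangle, node_crossing]

/-- A normal form of a node under reading its edges from another starting edge. -/
def canon : Item → Item
  | arc a b => if a ≤ b then arc a b else arc b a
  | double a b c d => if a < c || a == c && b ≤ d then double a b c d else double c d a b
  | i => i

theorem sameKnot_canon (i : Item) {S : Diagram} (hD : IsKnotDiagram (i.node :: S)) :
    SameKnot (i.node :: S) (i.canon.node :: S) := by
  cases i with
  | arc a b =>
    simp only [canon]
    split_ifs
    exacts [.refl hD, .turn_arc hD]
  | double a b c d =>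
    simp only [canon]
    split_ifs
    exacts [.refl hD, .turn_double hD]
  | triple => exact .refl hD

end Item

/-- A double crossing, read as `Node.crossing s w x y z`. -/
structure View where
  s : Bool
  (w x y z : ℕ)

/-- The four ways to read a double crossing. -/
def Item.views : Item → List View
  | double a b c d => [⟨false, a, b, c, d⟩, ⟨true, d, a, b, c⟩, ⟨false, c, d, a, b⟩,
      ⟨true, b, c, d, a⟩]
  | _ => []

theorem sameKnot_view {i : Item} {v : View} (hv : v ∈ i.views) {S : Diagram}
    (hD : IsKnotDiagram (i.node :: S)) :
    SameKnot (i.node :: S) (Node.crossing v.s v.w v.x v.y v.z :: S) := by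
  cases i with
  | double a b c d =>
    simp only [Item.views, List.mem_cons, List.not_mem_nil, or_false] at hv
    rcases hv with rfl | rfl | rfl | rfl
    exacts [.refl hD, .refl hD, .turn_double hD, .turn_double hD]
  | arc => simp [Item.views] at hv
  | triple => simp [Item.views] at hv

/-- The first item to which `f` applies, and the other items. -/
def pick {α : Type} (f : Item → Option α) : List Item → Option (α × List Item)
  | [] => none
  | i :: M => match f i with
    | some a => some (a, M)
    | none => (pick f M).map fun r => (r.1, i :: r.2)

theorem exists_of_pick {α : Type} {f : Item → Option α} {M N : List Item} {a : α}
    (h : pick f M = some (a, N)) : ∃ i, f i = some a ∧ M.Perm (i :: N) := by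
  induction M generalizing N with
  | nil => simp [pick] at h
  | cons i M ih =>
    rw [pick] at h
    cases hi : f i with
    | some b =>
      rw [hi] at h
      obtain ⟨rfl, rfl⟩ := Prod.mk.inj (Option.some.inj h)
      exact ⟨i, hi, .refl _⟩
    | none =>
      rw [hi] at h
      simp only [Option.map_eq_some_iff] at h
      obtain ⟨⟨b, N'⟩, h, h'⟩ := h
      obtain ⟨rfl, rfl⟩ := Prod.mk.inj h'
      obtain ⟨j, hj, hp⟩ := ih h
      exact ⟨j, hj, (hp.cons i).trans (.swap _ _ _)⟩

/-- A double crossing that can be read in a way that satisfies `t`. -/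
def pickView (t : View → Bool) (M : List Item) : Option (View × List Item) :=
  pick (fun i => i.views.find? t) M

/-- A move between tangles. -/
inductive Step where
  | deconstruct (p q r : ℕ)
  | kink (x : ℕ)
  | bigon (p q : ℕ)
  | slide (p q r p' q' r' : ℕ)
  | merge (a b : ℕ)

/-- The result of a move, if it applies. -/
def Step.run (n : ℕ) : Step → List Item → Option (List Item)
  | deconstruct p q r, M =>
    (pick (fun i => match i with
      | .triple s₀₁ s₀₂ s₁₂ a b c d e f => if layered s₀₁ s₀₂ s₁₂ then
          some (Item.triangle s₀₁ s₀₂ s₁₂ a b c d e f p q r) else none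
      | _ => none) M).map fun u => u.1 ++ u.2
  | kink x, M =>
    (pickView (fun v => v.w == x && v.x == x) M).map fun u => .arc u.1.y u.1.z :: u.2
  | bigon p q, M =>
    (pickView (fun v => v.w == p && v.z == q) M).bind fun u =>
      (pickView (fun v => v.s == u.1.s && (v.w == p && v.x == q)) u.2).map fun u' =>
        .arc u.1.y u'.1.y :: .arc u.1.x u'.1.z :: u'.2
  | slide p q r p' q' r', M =>
    (pickView (fun v => v.y == r && v.z == p) M).bind fun u =>
      (pickView (fun v => v.w == r && v.z == q) u.2).bind fun u' =>
        (pickView (fun v => v.w == p && v.x == q) u'.2).bind fun u'' =>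
          if layered u.1.s u'.1.s u''.1.s then some (
            Item.triangle u.1.s u'.1.s u''.1.s u'.1.y u''.1.y u''.1.z u.1.w u.1.x u'.1.x p' q' r'
              ++ u''.2) else none
  | merge a b, M =>
    if a ≠ b ∧ n ≤ b ∧ b < 100 then
      (pick (fun i => match i with
        | .arc c d => if (c == a && d == b) || (c == b && d == a) then some () else none
        | _ => none) M).map fun u => u.2.map (Item.relabel (Function.update id b a))
    else none

section run

variable {n : ℕ} {R : Diagram}

theorem perm_node {M N : List Item} {i : Item} (h : M.Perm (i :: N)) (S : Diagram) :
    (M.map Item.node ++ S).Perm (i.node :: (N.map Item.node ++ S)) :=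
  (h.map Item.node).append_right S

theorem exists_of_pickView {t : View → Bool} {M N : List Item} {v : View}
    (h : pickView t M = some (v, N)) : t v = true ∧ ∀ S, IsKnotDiagram (M.map Item.node ++ S) →
      SameKnot (M.map Item.node ++ S)
        (Node.crossing v.s v.w v.x v.y v.z :: (N.map Item.node ++ S)) := by
  obtain ⟨i, hi, hp⟩ := exists_of_pick h
  refine ⟨List.find?_some hi, fun S hS => ?_⟩
  exact (SameKnot.of_perm (perm_node hp S) hS).trans
    (sameKnot_view (List.mem_of_find?_eq_some hi) (hS.perm (perm_node hp S)))

theorem exists_of_pickView' {t : View → Bool} {M N : List Item} {v : View}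
    (h : pickView t M = some (v, N)) : t v = true ∧ ∀ L S,
      IsKnotDiagram (L ++ (M.map Item.node ++ S)) →
      SameKnot (L ++ (M.map Item.node ++ S))
        (L ++ Node.crossing v.s v.w v.x v.y v.z :: (N.map Item.node ++ S)) := by
  obtain ⟨h₁, h₂⟩ := exists_of_pickView h
  refine ⟨h₁, fun L S hS => ?_⟩
  have e₁ : (L ++ (M.map Item.node ++ S)).Perm (M.map Item.node ++ (S ++ L)) := by
    rw [← List.append_assoc (List.map _ _)]
    exact List.perm_append_comm
  have e₂ : (Node.crossing v.s v.w v.x v.y v.z :: (N.map Item.node ++ (S ++ L))).Perm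
      (L ++ Node.crossing v.s v.w v.x v.y v.z :: (N.map Item.node ++ S)) := by
    rw [← List.append_assoc (List.map _ _), ← List.cons_append]
    exact List.perm_append_comm
  have h₃ := h₂ (S ++ L) (hS.perm e₁)
  exact (SameKnot.of_perm e₁ hS).trans (h₃.trans (SameKnot.of_perm e₂ h₃.right))

/-- The result has to be a knot diagram by assumption, because only moves between knot diagrams
count; `isTarget` will provide this. In `merge` the name that disappears is that of an inner edge,
so `R` is not renamed. -/
theorem Step.sameKnot {st : Step} {M N : List Item} (h : st.run n M = some N)
    (hR : Outside n R) (hM : IsKnotDiagram (M.map Item.node ++ R))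
    (hN : IsKnotDiagram (N.map Item.node ++ R)) :
    SameKnot (M.map Item.node ++ R) (N.map Item.node ++ R) := by
  cases st with
  | deconstruct p q r =>
    simp only [run, Option.map_eq_some_iff] at h
    obtain ⟨⟨T, M'⟩, h, rfl⟩ := h
    obtain ⟨i, hi, hp⟩ := exists_of_pick h
    cases i with
    | triple s₀₁ s₀₂ s₁₂ a b c d e f =>
      simp only [Option.ite_none_right_eq_some, Option.some.injEq] at hi
      obtain ⟨hl, rfl⟩ := hi
      refine (SameKnot.of_perm (perm_node hp R) hM).trans ?_
      have hM' := hM.perm (perm_node hp R)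
      rw [List.map_append, Item.map_node_triangle, List.append_assoc,
        ← layeredTriangle_heights hl] at hN ⊢
      exact .of_move (.deconstruct _ _ _ _ _ _ _ _ _ _ _) hM' hN
    | _ => simp at hi
  | kink x =>
    simp only [run, Option.map_eq_some_iff] at h
    obtain ⟨⟨v, M'⟩, h, rfl⟩ := h
    obtain ⟨hv, h⟩ := exists_of_pickView h
    simp only [Bool.and_eq_true, beq_iff_eq] at hv
    have h := h R hM
    refine h.trans ?_
    have hl := h.right
    rw [hv.1, hv.2] at hl ⊢
    exact .of_move (.reidemeister₁ _ _ _ _ _) hl hN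
  | bigon p q =>
    simp only [run, Option.bind_eq_some_iff, Option.map_eq_some_iff] at h
    obtain ⟨⟨v, M₁⟩, h₁, ⟨w, M₂⟩, h₂, rfl⟩ := h
    obtain ⟨hv, h₁⟩ := exists_of_pickView h₁
    obtain ⟨hw, h₂⟩ := exists_of_pickView' h₂
    simp only [Bool.and_eq_true, beq_iff_eq] at hv hw
    have h₁ := h₁ R hM
    have h₂ := h₂ [Node.crossing v.s v.w v.x v.y v.z] R h₁.right
    refine h₁.trans (h₂.trans ?_)
    have hl := h₂.right
    rw [hw.1, hw.2.1, hw.2.2, hv.1, hv.2] at hl ⊢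
    exact .of_move (.reidemeister₂ _ _ _ _ _ _ _ _) hl hN
  | slide p q r p' q' r' =>
    simp only [run, Option.bind_eq_some_iff, Option.ite_none_right_eq_some,
      Option.some.injEq] at h
    obtain ⟨⟨v, M₁⟩, h₁, ⟨w, M₂⟩, h₂, ⟨u, M₃⟩, h₃, hl, rfl⟩ := h
    obtain ⟨hv, h₁⟩ := exists_of_pickView h₁
    obtain ⟨hw, h₂⟩ := exists_of_pickView' h₂
    obtain ⟨hu, h₃⟩ := exists_of_pickView' h₃
    simp only [Bool.and_eq_true, beq_iff_eq] at hv hw hu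
    have h₁ := h₁ R hM
    have h₂ := h₂ [Node.crossing v.s v.w v.x v.y v.z] R h₁.right
    have h₃ := h₃ [Node.crossing v.s v.w v.x v.y v.z, Node.crossing w.s w.w w.x w.y w.z] R h₂.right
    refine h₁.trans (h₂.trans (h₃.trans ?_))
    have hr := h₃.right
    rw [List.map_append, Item.map_node_triangle, List.append_assoc,
      ← layeredTriangle_heights hl] at hN ⊢
    have e : ([Node.crossing v.s v.w v.x v.y v.z, Node.crossing w.s w.w w.x w.y w.z] ++
        Node.crossing u.s u.w u.x u.y u.z :: (M₃.map Item.node ++ R)) =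
        layeredTriangle (heights v.s w.s u.s) v.w v.x w.x w.y u.y u.z p q r ++
          (M₃.map Item.node ++ R) := by
      rw [layeredTriangle_heights hl, Node.triangle, hv.1, hv.2, hw.1, hw.2, hu.1, hu.2]
      rfl
    rw [e] at hr ⊢
    exact .of_move (.reidemeister₃ _ _ _ _ _ _ _ _ _ _ _ _ _ _) hr hN
  | merge a b =>
    simp only [run, Option.ite_none_right_eq_some, Option.map_eq_some_iff] at h
    obtain ⟨⟨hab, hn, hb⟩, ⟨_, M'⟩, h, rfl⟩ := h
    obtain ⟨i, hi, hp⟩ := exists_of_pick h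
    have hM' := hM.perm (perm_node hp R)
    have hsame : SameKnot (i.node :: (M'.map Item.node ++ R))
        (.arc a b :: (M'.map Item.node ++ R)) := by
      cases i with
      | arc c d =>
        simp only [Option.ite_none_right_eq_some, Bool.or_eq_true, Bool.and_eq_true,
          beq_iff_eq] at hi
        rcases hi.1 with ⟨rfl, rfl⟩ | ⟨rfl, rfl⟩
        exacts [.refl hM', .turn_arc hM']
      | _ => simp at hi
    refine (SameKnot.of_perm (perm_node hp R) hM).trans (hsame.trans ?_)
    have e : (M'.map (Item.relabel (Function.update id b a))).map Item.node ++ R =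
        (M'.map Item.node ++ R).map (Node.relabel (Function.update id b a)) := by
      rw [List.map_append, map_relabel_eq_self (D := R), List.map_map, List.map_map]
      · congr 1
        refine List.map_congr_left fun i _ => Item.node_relabel _ i
      · intro l hl
        refine Function.update_of_ne ?_ _ _
        rintro rfl
        rcases hR l hl with h | h <;> omega
    rw [e] at hN ⊢
    exact .of_move (.merge a b hab _) hsame.right hN

end run

/-- The end of the side of a tangle, or a number for the inner face, that is reached from a corner
along the boundary of its face; `m` is the least corner so far. -/
def faceEnd (n : ℕ) (C : List Corner) : ℕ → ℕ → Corner → ℕ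
  | 0, m, _ => n + m
  | k + 1, m, c => match Nat.blt c.nextLabel n with
    | true => before n c.nextLabel
    | false => match C.find? c.step with
      | some d => faceEnd n C k (bif Nat.blt d.id m then d.id else m) d
      | none => n + m

/-- The least side of the tangle that belongs to the same face as the side `t`. -/
def sideClass (n : ℕ) (C : List Corner) : ℕ → ℕ → ℕ → ℕ
  | 0, m, _ => m
  | k + 1, m, t => match C.find? fun c => Nat.beq c.label t with
    | some c =>
      let t' := faceEnd n C 30 c.id c
      sideClass n C k (bif Nat.blt t' m then t' else m) t'
    | none => m

/-- The labels along a strand. -/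
def strandFrom (O : List (ℕ × ℕ)) : ℕ → ℕ → List ℕ → List ℕ
  | 0, _, p => p
  | k + 1, l, p => match O.find? fun q => Nat.beq q.1 l && p.all fun m => !Nat.beq m q.2 with
    | some q => strandFrom O k q.2 (q.2 :: p)
    | none => p

/-- Apply `k` to a number; the kernel evaluates the number first. -/
def force {β : Type} (n : ℕ) (k : ℕ → β) : β :=
  match n with
  | 0 => k 0
  | m + 1 => k (m + 1)

theorem force_eq {β : Type} (n : ℕ) (k : ℕ → β) : force n k = k n := by cases n <;> rfl

/-- Apply `k` to a list whose members are evaluated first. -/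
def forceList {α β : Type} (F : α → (α → β) → β) : List α → (List α → β) → β
  | [], k => k []
  | a :: l, k => F a fun a => forceList F l fun l => k (a :: l)

theorem forceList_eq {α β : Type} {F : α → (α → β) → β} (h : ∀ a k, F a k = k a) (l : List α)
    (k : List α → β) : forceList F l k = k l := by
  induction l generalizing k with
  | nil => rfl
  | cons a l ih => rw [forceList, h, ih]

/-- Apply `k` to a pair whose members are evaluated first. -/
def forcePair {β : Type} (p : ℕ × ℕ) (k : ℕ × ℕ → β) : β :=
  force p.1 fun a => force p.2 fun b => k (a, b)

theorem forcePair_eq {β : Type} (p : ℕ × ℕ) (k : ℕ × ℕ → β) : forcePair p k = k p := by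
  rw [forcePair, force_eq, force_eq]

/-- Apply `k` to a corner that is evaluated first. -/
def Corner.force {β : Type} (c : Corner) (k : Corner → β) : β :=
  Diagram.force c.id fun a => Diagram.force c.label fun b =>
    Diagram.force c.nextId fun a' => Diagram.force c.nextLabel fun b' => k ⟨a, b, a', b'⟩

theorem Corner.force_eq {β : Type} (c : Corner) (k : Corner → β) : c.force k = k c := by
  simp only [Corner.force, Diagram.force_eq]

/-- `Target` with the faces and the strands of the tangle. -/
def isTarget (n : ℕ) (tr : ℕ → ℕ) (M : List (List ℕ)) : Bool :=
  forceList (forceList force) M fun M =>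
  forceList Corner.force (corners M) fun C =>
  forceList forcePair (opposites M) fun O =>
  forceList force ((List.range n).map fun t => sideClass n C n t t) fun cls =>
  forceList forcePair (C.map fun c =>
    let t := faceEnd n C 30 c.id c
    (c.id, bif Nat.blt t n then cls.getD t 0 else t)) fun f =>
  forceList (forceList force) ((List.range n).map fun t => strandFrom O 30 t [t]) fun P =>
  Target n (fun t => cls.getD t 0) tr (fun i => ((f.find? fun u => Nat.beq u.1 i).map Prod.snd).getD 0) P M C O

/-- The searches for faces and strands need no proof of correctness: `Target` tests whatever they
return, so their step bounds and default values cannot affect soundness. -/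
theorem exists_target {n : ℕ} {tr : ℕ → ℕ} {M : List (List ℕ)} (h : isTarget n tr M = true) :
    ∃ cls f P, Target n cls tr f P M (corners M) (opposites M) = true := by
  simp only [isTarget, forceList_eq Corner.force_eq, forceList_eq forcePair_eq,
    forceList_eq force_eq, forceList_eq (forceList_eq force_eq)] at h
  exact ⟨_, _, _, h⟩

/-- Apply moves to a tangle; every tangle on the way has to pass `isTarget`. -/
def run (n : ℕ) (tr : ℕ → ℕ) : List Step → List Item → Option (List Item)
  | [], M => if isTarget n tr (M.map Item.legs) then some M else none
  | st :: l, M => if isTarget n tr (M.map Item.legs) then (st.run n M).bind (run n tr l) else none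

/-- Moves lead from both tangles to the same tangle. -/
def joins (n : ℕ) (K : List ℕ) (tr : ℕ → ℕ) (M M' : List Item) (l l' : List Step) : Bool :=
  Source n K tr (M.map Item.legs) &&
  match run n tr l M, run n tr l' M' with
  | some N, some N' => (N.map Item.canon).isPerm (N'.map Item.canon)
  | _, _ => false

section joins

variable {n : ℕ} {K : List ℕ} {tr : ℕ → ℕ} {L R : Diagram}

theorem map_legs_node (M : List Item) : (M.map Item.node).map Node.legs = M.map Item.legs := by
  rw [List.map_map]
  exact List.map_congr_left fun i _ => i.legs_node

/-- Each tangle is compared with one fixed tangle `L`, not with its predecessor, so `Source` is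
checked only once. -/
theorem IsKnotDiagram.of_isTarget (hD : IsKnotDiagram (L ++ R)) (hR : Outside n R)
    (hS : Source n K tr (L.map Node.legs) = true) {M : List Item}
    (hM : isTarget n tr (M.map Item.legs) = true) : IsKnotDiagram (M.map Item.node ++ R) := by
  rw [← map_legs_node] at hM
  obtain ⟨cls, f, P, h⟩ := exists_target hM
  exact hD.replace hR hS h

theorem sameKnot_run (hD : IsKnotDiagram (L ++ R)) (hR : Outside n R)
    (hS : Source n K tr (L.map Node.legs) = true) {l : List Step} {M N : List Item}
    (h : run n tr l M = some N) : SameKnot (M.map Item.node ++ R) (N.map Item.node ++ R) := by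
  induction l generalizing M with
  | nil =>
    simp only [run, Option.ite_none_right_eq_some, Option.some.injEq] at h
    obtain ⟨h, rfl⟩ := h
    exact .refl (hD.of_isTarget hR hS h)
  | cons st l ih =>
    simp only [run, Option.ite_none_right_eq_some, Option.bind_eq_some_iff] at h
    obtain ⟨h, M', hM, h'⟩ := h
    have := ih h'
    exact (Step.sameKnot hM hR (hD.of_isTarget hR hS h) this.left).trans this

theorem sameKnot_map_canon (M : List Item) (S : Diagram)
    (h : IsKnotDiagram (M.map Item.node ++ S)) :
    SameKnot (M.map Item.node ++ S) ((M.map Item.canon).map Item.node ++ S) := by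
  induction M generalizing S with
  | nil => exact .refl h
  | cons i M ih =>
    have h₁ := i.sameKnot_canon (S := M.map Item.node ++ S) h
    refine h₁.trans ?_
    have e₁ : (i.canon.node :: (M.map Item.node ++ S)).Perm
        (M.map Item.node ++ i.canon.node :: S) := List.perm_middle.symm
    have h₂ := ih (i.canon.node :: S) (h₁.right.perm e₁)
    exact (SameKnot.of_perm e₁ h₁.right).trans (h₂.trans (.of_perm List.perm_middle h₂.right))

/-- One evaluation of `joins` proves the equality of knots for every surrounding diagram `R`. The
moves from `M'` are run forwards and then reversed, so crossings never have to be created. -/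
theorem sameKnot_of_joins {M M' : List Item} {l l' : List Step}
    (h : joins n K tr M M' l l' = true) (hR : Outside n R)
    (hD : IsKnotDiagram (M.map Item.node ++ R)) :
    SameKnot (M.map Item.node ++ R) (M'.map Item.node ++ R) := by
  rw [joins, Bool.and_eq_true] at h
  obtain ⟨hS, h⟩ := h
  rw [← map_legs_node] at hS
  cases hN : run n tr l M with
  | none => simp [hN] at h
  | some N =>
    cases hN' : run n tr l' M' with
    | none => simp [hN, hN'] at h
    | some N' =>
      simp only [hN, hN', List.isPerm_iff] at h
      have h₁ := sameKnot_run hD hR hS hN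
      have h₂ := sameKnot_run hD hR hS hN'
      have h₃ := sameKnot_map_canon N R h₁.right
      have h₄ := sameKnot_map_canon N' R h₂.right
      exact h₁.trans (h₃.trans ((SameKnot.of_perm ((h.map _).append_right R) h₃.right).trans
        (h₄.symm.trans h₂.symm)))

end joins

end Diagram
end KnotTheory
-- The explicit replacements by delta-crossings.
namespace KnotTheory

open Node

namespace Diagram

/-- The parts of a diagram that is composed of arcs, delta-crossings and triple crossings. -/
inductive Block where
  | arc (a b : ℕ)
  | delta (s : Bool) (a b c d e f p q r : ℕ)
  | triple (s₀₁ s₀₂ s₁₂ : Bool) (a b c d e f : ℕ)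

namespace Block

/-- The items of a block. -/
def items : Block → List Item
  | arc a b => [.arc a b]
  | delta s a b c d e f p q r => Item.triangle s (!s) s a b c d e f p q r
  | triple s₀₁ s₀₂ s₁₂ a b c d e f => [.triple s₀₁ s₀₂ s₁₂ a b c d e f]

/-- The number of delta-crossings that are needed for a block. -/
def weight : Block → ℕ
  | arc _ _ => 0
  | delta .. => 1
  | triple .. => 2

end Block

/-- The sum of the weights of blocks. -/
def weights (B : List Block) : ℕ := (B.map Block.weight).sum

/-- A tangle made of blocks together with moves from it and from a given tangle to a common
one. -/
structure Plan where
  blocks : List Block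
  (steps steps' : List Step)

/-- The plan leads from `M` to blocks. -/
def Plan.works (n : ℕ) (K : List ℕ) (tr : ℕ → ℕ) (M : List Item) (T : Plan) : Bool :=
  joins n K tr M (T.blocks.flatMap Block.items) T.steps T.steps'

/-- Two delta-crossings for a triple crossing with middle strand `1`. -/
def triplePlan (t : Bool) : Plan where
  blocks := [.delta t 0 1 11 12 4 5 6 9 10, .delta (!t) 13 13 12 11 2 3 14 8 7]
  steps := [.deconstruct 6 7 8]
  steps' := [.kink 13, .merge 7 14, .bigon 11 12, .merge 7 9, .merge 8 10]

/-- A delta-crossing or arcs for a triple crossing with a monogon. -/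
def monogonPlan (s₀₂ s₁₂ : Bool) : Plan :=
  if s₀₂ = s₁₂ then ⟨[.arc 1 2, .arc 0 3], [.deconstruct 6 7 8, .kink 4, .merge 6 8, .bigon 6 7],
    []⟩
  else ⟨[.delta s₁₂ 4 4 0 1 2 3 6 7 8], [.deconstruct 6 7 8, .kink 4], [.kink 4]⟩

/-- Blocks for two triple crossings with two common bigons, if the strand `0` of the first one
(which is the strand `2` of the second one) is not in the middle at either of them. -/
def extremePlan (s₀₁ s₁₂ g₀₁ g₁₂ : Bool) : Plan :=
  let α := s₀₁
  let γ := s₁₂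
  let start : List Step := [.deconstruct 9 10 11, .deconstruct 12 13 14, .slide 8 7 11 16 17 15]
  if γ = !g₀₁ then
    let clasp : List Step := [.bigon 9 10, .merge 1 17, .merge 2 16]
    if α = !g₁₂ then ⟨[.arc 5 0, .arc 4 1, .arc 2 3],
      start ++ clasp ++ [.bigon 6 14, .merge 15 13, .bigon 15 12], []⟩
    else ⟨[.delta α 0 1 20 21 4 5 12 22 15, .delta (!α) 21 20 2 6 6 3 13 14 23],
      start ++ clasp, [.bigon 21 20, .merge 15 23, .merge 13 22]⟩
  else
    if α = !g₁₂ then ⟨[.delta γ 18 18 3 4 1 2 19 10 9, .arc 5 0],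
      start ++ [.bigon 6 14, .merge 15 13, .merge 3 16, .bigon 15 12, .merge 4 17],
      [.kink 18, .merge 9 19]⟩
    else ⟨[.delta γ 18 18 16 17 1 2 19 10 9, .delta α 0 17 20 21 4 5 12 22 15,
        .delta (!α) 21 20 16 6 6 3 13 14 23], start,
      [.kink 18, .merge 9 19, .bigon 21 20, .merge 15 23, .merge 13 22]⟩

/-- Blocks for two triple crossings with two common bigons, if the strand `0` is in the middle at
both of them. -/
def middlePlan (s₀₁ s₀₂ s₁₂ g₀₁ g₀₂ g₁₂ : Bool) : Plan :=
  if s₀₂ = !g₀₂ then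
    ⟨[.delta g₁₂ 18 18 0 1 7 5 19 11 9, .delta s₁₂ 20 20 3 4 7 2 21 10 12],
      [.deconstruct 9 10 11, .deconstruct 12 13 14, .slide 9 10 11 9 10 11,
        .slide 12 13 14 12 13 14, .slide 6 10 7 6 10 7, .bigon 8 13, .merge 10 14, .merge 5 6],
      [.kink 18, .merge 9 19, .kink 20, .merge 12 21]⟩
  else
    ⟨[.triple (!s₀₁) s₀₂ s₁₂ 6 7 8 0 1 2, .delta g₀₁ 3 4 5 8 7 6 12 13 14],
      [.deconstruct 9 10 11, .deconstruct 12 13 14, .slide 12 13 14 12 13 14, .bigon 6 7,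
        .merge 11 13, .merge 9 12],
      [.deconstruct 9 10 11, .bigon 6 7, .merge 11 13, .merge 9 12]⟩

/-- Blocks for two triple crossings with two common bigons, if the strand `2` is in the middle at
both of them. -/
def middlePlan' (s₀₂ s₁₂ g₀₁ g₀₂ g₁₂ : Bool) : Plan :=
  if s₀₂ = !g₀₂ then
    ⟨[.delta g₁₂ 18 18 0 17 4 5 19 15 12, .delta s₁₂ 20 20 3 17 1 2 21 10 9],
      [.deconstruct 9 10 11, .deconstruct 12 13 14, .slide 8 7 11 16 17 15, .bigon 6 14,
        .merge 15 13, .merge 3 16],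
      [.kink 18, .merge 12 19, .kink 20, .merge 9 21]⟩
  else
    ⟨[.delta s₁₂ 6 7 8 0 1 2 9 10 11, .triple g₀₁ g₀₂ (!g₁₂) 8 7 6 3 4 5],
      [.deconstruct 9 10 11, .deconstruct 12 13 14, .slide 12 13 14 12 13 14, .bigon 6 7,
        .merge 11 13, .merge 9 12],
      [.deconstruct 12 13 14, .slide 12 13 14 12 13 14, .bigon 6 7, .merge 11 13, .merge 9 12]⟩

/-- The strands of a triple crossing. -/
def tripleStrand (l : ℕ) : ℕ := l % 3

/-- The strands of a triple crossing with a monogon. -/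
def monogonStrand (l : ℕ) : ℕ := [0, 1, 1, 0, 1].getD l 0

/-- The strands of two triple crossings with two common bigons. -/
def bigonStrand (l : ℕ) : ℕ := [0, 1, 2, 2, 1, 0, 0, 1, 2].getD l 0

/-- Read from the triple crossing: a second Reidemeister move turns the crossing of the top and the
bottom strand into three. One of them, opposite to the original one, completes a delta-crossing with
the two crossings of the middle strand. The other two form the second delta-crossing together with a
kink, whose sign is free. -/
theorem triplePlan_works : ∀ t : Bool,
    (triplePlan t).works 6 [] tripleStrand [.triple t t t 0 1 2 3 4 5] = true := by
  decide +kernel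

/-- The monogon is a kink, and strand `2` crosses the kinked strand twice. If it does so twice on
the same level, kink and crossings go away. Otherwise a kink of suitable sign makes the triangle a
delta-crossing. -/
theorem monogonPlan_works : ∀ s₀₁ s₀₂ s₁₂ : Bool, layered s₀₁ s₀₂ s₁₂ = true →
    (monogonPlan s₀₂ s₁₂).works 4 [0] monogonStrand
      [.triple s₀₁ s₀₂ s₁₂ 4 4 0 1 2 3] = true := by
  decide +kernel

/-- The strand through `6` is top or bottom at both triple crossings. A third Reidemeister move
therefore brings the two crossings of the strands through `7` and `8` together; they cancel, or they
form one delta-crossing with a kink of free sign. The strand through `6` can be pulled off, or else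
a second move with itself turns its four crossings into two delta-crossings. -/
theorem extremePlan_works : ∀ s₀₁ s₁₂ g₀₁ g₁₂ : Bool,
    (extremePlan s₀₁ s₁₂ g₀₁ g₁₂).works 6 [0, 1] bigonStrand
      [.triple s₀₁ s₀₁ s₁₂ 6 7 8 0 1 2, .triple g₀₁ g₁₂ g₁₂ 8 7 6 3 4 5] = true := by
  decide +kernel

/-- The strand through `7` is top or bottom at both triple crossings; the strand through `6` is in
the middle at the first one, that through `8` at the second one. If the crossings of these two
cancel, the strand through `7` crosses each of them twice, and each such pair of crossings with a
kink is a delta-crossing. Otherwise the strands through `6` and `7` cross twice on the same level,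
so both crossings may be reversed: the first triple crossing stays one, and the second becomes a
delta-crossing. -/
theorem middlePlan_works : ∀ s₀₂ g₁₂ : Bool,
    (middlePlan (!s₀₂) s₀₂ s₀₂ (!g₁₂) g₁₂ g₁₂).works 6 [0, 1] bigonStrand
      [.triple (!s₀₂) s₀₂ s₀₂ 6 7 8 0 1 2, .triple (!g₁₂) g₁₂ g₁₂ 8 7 6 3 4 5] = true := by
  decide +kernel

/-- Now the strand through `8` is in the middle first and that through `6` second. When both
crossings of the strands through `6` and `7` are reversed, it is the first triple crossing that
becomes a delta-crossing. -/
theorem middlePlan'_works : ∀ s₁₂ g₀₁ : Bool,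
    (middlePlan' (!s₁₂) s₁₂ g₀₁ g₀₁ (!g₀₁)).works 6 [0, 1] bigonStrand
      [.triple (!s₁₂) (!s₁₂) s₁₂ 6 7 8 0 1 2, .triple g₀₁ g₀₁ (!g₀₁) 8 7 6 3 4 5] = true := by
  decide +kernel

end Diagram
end KnotTheory
-- Replacement inside an arbitrary diagram.
namespace KnotTheory

open Node

namespace Diagram

open HalfEdge

namespace Block

/-- Rename the edges of a block. -/
def relabel (g : ℕ → ℕ) : Block → Block
  | arc a b => arc (g a) (g b)
  | delta s a b c d e f p q r =>
    delta s (g a) (g b) (g c) (g d) (g e) (g f) (g p) (g q) (g r)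
  | triple s₀₁ s₀₂ s₁₂ a b c d e f => triple s₀₁ s₀₂ s₁₂ (g a) (g b) (g c) (g d) (g e) (g f)

/-- The block is a triple crossing. -/
def isTriple : Block → Bool
  | triple .. => true
  | _ => false

theorem weight_relabel (g : ℕ → ℕ) (b : Block) : (b.relabel g).weight = b.weight := by
  cases b <;> rfl

theorem isTriple_relabel (g : ℕ → ℕ) (b : Block) : (b.relabel g).isTriple = b.isTriple := by
  cases b <;> rfl

/-- The nodes of a block. -/
def nodes (b : Block) : List Node := b.items.map Item.node

theorem nodes_relabel (g : ℕ → ℕ) (b : Block) :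
    (b.relabel g).nodes = b.nodes.map (Node.relabel g) := by
  cases b with
  | delta s => cases s <;> rfl
  | _ => rfl

end Block

/-- The diagram composed of blocks. -/
def ofBlocks (B : List Block) : Diagram := B.flatMap Block.nodes

theorem ofBlocks_append (B C : List Block) : ofBlocks (B ++ C) = ofBlocks B ++ ofBlocks C :=
  List.flatMap_append

theorem ofBlocks_relabel (g : ℕ → ℕ) (B : List Block) :
    ofBlocks (B.map (Block.relabel g)) = (ofBlocks B).map (Node.relabel g) := by
  induction B with
  | nil => rfl
  | cons b B ih =>
    have h : ∀ (b : Block) (B : List Block), ofBlocks (b :: B) = b.nodes ++ ofBlocks B :=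
      fun _ _ => rfl
    rw [List.map_cons, h, h, List.map_append, ih, Block.nodes_relabel]

theorem weights_relabel (g : ℕ → ℕ) (B : List Block) :
    weights (B.map (Block.relabel g)) = weights B := by
  simp only [weights, List.map_map]
  congr 1
  exact List.map_congr_left fun b _ => b.weight_relabel g

theorem countP_isTriple_relabel (g : ℕ → ℕ) (B : List Block) :
    (B.map (Block.relabel g)).countP Block.isTriple = B.countP Block.isTriple := by
  rw [List.countP_map]
  exact List.countP_congr fun b _ => by rw [Function.comp_apply, b.isTriple_relabel]

theorem weights_append (B C : List Block) : weights (B ++ C) = weights B + weights C := by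
  simp [weights]

theorem count_add_count_le_countP {g : ℕ → ℕ} {l l' : ℕ} (h : l' ≠ l) (hg : g l' = g l)
    (L : List ℕ) : L.count l + L.count l' ≤ (L.map g).count (g l) := by
  induction L with
  | nil => simp
  | cons a L ih =>
    rw [List.map_cons, List.count_cons, List.count_cons, List.count_cons]
    by_cases h₁ : a = l
    · subst h₁
      simp [h.symm]
      omega
    · by_cases h₂ : a = l'
      · subst h₂
        simp [h, hg]
        omega
      · simp [h₁, h₂]
        omega

/-- Marker points that join the first `k` edges to the edges `β 0`, `β 1`, and so on. -/
def markers (β : ℕ → ℕ) : ℕ → List Block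
  | 0 => []
  | k + 1 => .arc (β k) k :: markers β k

theorem weights_markers (β : ℕ → ℕ) (k : ℕ) : weights (markers β k) = 0 := by
  induction k with
  | zero => rfl
  | succ k ih => simpa [weights, markers, Block.weight] using ih

theorem countP_markers (β : ℕ → ℕ) (k : ℕ) : (markers β k).countP Block.isTriple = 0 := by
  induction k with
  | zero => rfl
  | succ k ih => simpa [markers, Block.isTriple] using ih

theorem mem_labels_markers {β : ℕ → ℕ} {k l : ℕ} (h : l ∈ labels (ofBlocks (markers β k))) :
    ∃ t < k, l = t ∨ l = β t := by
  induction k with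
  | zero => simp [markers, ofBlocks, Diagram.labels] at h
  | succ k ih =>
    have h' : l ∈ [β k, k] ++ labels (ofBlocks (markers β k)) := h
    rcases List.mem_append.1 h' with h | h
    · simp only [List.mem_cons, List.not_mem_nil, or_false] at h
      exact ⟨k, by omega, h.symm⟩
    · obtain ⟨t, ht, h⟩ := ih h
      exact ⟨t, by omega, h⟩

section normalise

variable {n : ℕ} {L R : Diagram} {β : ℕ → ℕ}

/-- Separate the ends of a tangle from the rest of a diagram by marker points. -/
theorem sameKnot_markers (hL : HasEnds n L) (hβ : ∀ l ∈ L.labels, n ≤ l → β l = l)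
    (hβ' : ∀ t < n, 100 ≤ β t) (hR : ∀ l ∈ R.labels, 100 ≤ l) (hn : n ≤ 100)
    (hD : IsKnotDiagram (L.map (Node.relabel β) ++ R)) :
    SameKnot (L.map (Node.relabel β) ++ R) (L ++ (ofBlocks (markers β n) ++ R)) := by
  -- With `γ k` the first `k` ends have their own names. They are split off one at a time, because
  -- `β` may give two ends the same name when they are joined directly outside.
  let γ : ℕ → ℕ → ℕ := fun k l => if l < k then l else β l
  have key : ∀ k ≤ n, SameKnot (L.map (Node.relabel β) ++ R)
      (L.map (Node.relabel (γ k)) ++ (ofBlocks (markers β k) ++ R)) := by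
    intro k hk
    induction k with
    | zero =>
      have : γ 0 = β := funext fun l => if_neg (Nat.not_lt_zero l)
      rw [this]
      exact .refl hD
    | succ k ih =>
      have ih := ih (by omega)
      refine ih.trans ?_
      set N := L.map (Node.relabel (γ (k + 1))) ++ (ofBlocks (markers β k) ++ R) with hN
      have hout : ∀ l ∈ labels (ofBlocks (markers β k) ++ R), l ≠ k := by
        rintro l hl rfl
        rw [labels_append, List.mem_append] at hl
        rcases hl with hl | hl
        · obtain ⟨t, ht, h | h⟩ := mem_labels_markers hl
          · omega
          · have := hβ' t (by omega)
            omega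
        · have := hR _ hl
          omega
      have hg : ∀ l ∈ L.labels, γ (k + 1) l = k ↔ l = k := by
        intro l hl
        by_cases h : l < k + 1
        · simp only [γ, if_pos h]
        · simp only [γ, if_neg h]
          by_cases h' : l < n
          · have := hβ' l h'
            omega
          · rw [hβ l hl (not_lt.1 h')]
      have e : N.map (Node.relabel (Function.update id k (β k))) =
          L.map (Node.relabel (γ k)) ++ (ofBlocks (markers β k) ++ R) := by
        rw [hN, List.map_append]
        congr 1
        · rw [List.map_map]
          refine List.map_congr_left fun v hv => ?_
          rw [Function.comp_apply, relabel_relabel]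
          refine relabel_congr fun l hl => ?_
          have hl' : l ∈ L.labels := List.mem_flatMap.2 ⟨v, hv, hl⟩
          rw [Function.comp_apply]
          by_cases h : l = k
          · rw [(hg l hl').2 h, Function.update_self]
            simp only [γ, h, lt_irrefl, if_false]
          · rw [Function.update_of_ne (fun h' => h ((hg l hl').1 h'))]
            simp only [γ, id]
            have : l < k + 1 ↔ l < k := by omega
            simp only [this]
        · exact map_relabel_eq_self fun l hl => Function.update_of_ne (hout l hl) _ _
      have hc : (labels N).count k = 1 := by
        rw [hN, labels_append, List.count_append, List.count_eq_zero_of_not_mem (a := k)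
          (fun h => hout k h rfl), labels_map_relabel, add_zero]
        refine Eq.trans ?_ (hL.count_end k (hL.end_mem k (by omega)) (by omega))
        rw [List.count_eq_countP, List.countP_map, List.count_eq_countP]
        refine List.countP_congr fun l hl => ?_
        simpa using hg l hl
      have hne : β k ≠ k := by
        have := hβ' k (by omega)
        omega
      have h := ih.right
      rw [← e] at h ⊢
      have h₂ := SameKnot.split hne h hc
      exact h₂.trans (.of_perm List.perm_middle.symm h₂.right)
  have := key n le_rfl
  rwa [map_relabel_eq_self (D := L) (f := γ n)] at this
  intro l hl
  by_cases h : l < n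
  · simp only [γ, if_pos h]
  · simp only [γ, if_neg h]
    exact hβ l hl (not_lt.1 h)

end normalise

theorem weights_cons (b : Block) (B : List Block) : weights (b :: B) = b.weight + weights B := rfl

/-- Apply a plan to a part of a diagram. -/
theorem Plan.exists_blocks {n : ℕ} {K : List ℕ} {tr : ℕ → ℕ} {M : List Item} {T : Plan}
    (hT : T.works n K tr M = true) (hn : n ≤ 100) (g : ℕ → ℕ) (B : List Block)
    (hD : IsKnotDiagram ((M.map Item.node).map (Node.relabel g) ++ ofBlocks B)) :
    ∃ B', SameKnot ((M.map Item.node).map (Node.relabel g) ++ ofBlocks B) (ofBlocks B') ∧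
      weights B' = weights T.blocks + weights B ∧
      B'.countP Block.isTriple = T.blocks.countP Block.isTriple + B.countP Block.isTriple := by
  classical
  set L : Diagram := M.map Item.node with hLdef
  have hL : HasEnds n L := by
    rw [works, joins, Bool.and_eq_true, ← map_legs_node] at hT
    exact (sourceSpec hT.1).ends
  have hcount : ∀ l ∈ L.labels, n ≤ l →
      (L.labels.map g).count (g l) + (ofBlocks B).labels.count (g l) = 2 := by
    intro l hl _
    have := hD.two_ends (g l) (by
      rw [labels_append, labels_map_relabel]
      exact List.mem_append_left _ (List.mem_map_of_mem hl))
    rwa [labels_append, List.count_append, labels_map_relabel] at this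
  -- An inner edge has both of its ends in the tangle, which leaves no further occurrence for its
  -- name.
  have hinj : ∀ l ∈ L.labels, n ≤ l → ∀ l' ∈ L.labels, g l' = g l → l' = l := by
    intro l hl hln l' hl' h
    by_contra hne
    have h₁ := count_add_count_le_countP hne h L.labels
    have h₂ := hL.count_inner l hl hln
    have h₃ := List.count_pos_iff.2 hl'
    have h₄ := hcount l hl hln
    omega
  have hout : ∀ l ∈ L.labels, n ≤ l → g l ∉ (ofBlocks B).labels := by
    intro l hl hln h
    have h₁ := List.count_le_count_map (f := g) (x := l) (l := L.labels)
    have h₂ := hL.count_inner l hl hln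
    have h₃ := List.count_pos_iff.2 h
    have h₄ := hcount l hl hln
    omega
  -- Inner edges get back their numbers from `M`, which are below `100`; all other edges are moved
  -- out of that range.
  let σ : ℕ → ℕ := fun l => if h : ∃ i ∈ L.labels, n ≤ i ∧ g i = l then h.choose else l + 100
  have hσ : ∀ i ∈ L.labels, n ≤ i → σ (g i) = i := by
    intro i hi hin
    have h : ∃ j ∈ L.labels, n ≤ j ∧ g j = g i := ⟨i, hi, hin, rfl⟩
    simp only [σ, dif_pos h]
    exact hinj i hi hin _ h.choose_spec.1 h.choose_spec.2.2
  have hσ' : ∀ l, (¬ ∃ i ∈ L.labels, n ≤ i ∧ g i = l) → σ l = l + 100 := fun l h => dif_neg h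
  have hσinj : Function.Injective σ := by
    intro l l' h
    by_cases h₁ : ∃ i ∈ L.labels, n ≤ i ∧ g i = l
    · obtain ⟨i, hi, hin, rfl⟩ := h₁
      rw [hσ i hi hin] at h
      by_cases h₂ : ∃ i ∈ L.labels, n ≤ i ∧ g i = l'
      · obtain ⟨j, hj, hjn, rfl⟩ := h₂
        rw [h, hσ j hj hjn]
      · have := hL.inner_lt i hi hin
        rw [hσ' l' h₂] at h
        omega
    · rw [hσ' l h₁] at h
      by_cases h₂ : ∃ i ∈ L.labels, n ≤ i ∧ g i = l'
      · obtain ⟨j, hj, hjn, rfl⟩ := h₂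
        have := hL.inner_lt j hj hjn
        rw [hσ j hj hjn] at h
        omega
      · rw [hσ' l' h₂] at h
        omega
  let β : ℕ → ℕ := σ ∘ g
  have h₁ := SameKnot.relabel hD hσinj
  have e : ((L.map (Node.relabel g) ++ ofBlocks B).map (Node.relabel σ)) =
      L.map (Node.relabel β) ++ ofBlocks (B.map (Block.relabel σ)) := by
    rw [List.map_append, ofBlocks_relabel, List.map_map]
    congr 1
    exact List.map_congr_left fun v _ => relabel_relabel _ _ _
  rw [e] at h₁
  have hβ : ∀ t < n, 100 ≤ β t := by
    intro t ht
    change 100 ≤ σ (g t)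
    rw [hσ']
    · omega
    · rintro ⟨i, hi, hin, h⟩
      have := hinj i hi hin t (hL.end_mem t ht) h.symm
      omega
  have hR : ∀ l ∈ labels (ofBlocks (B.map (Block.relabel σ))), 100 ≤ l := by
    intro l hl
    rw [ofBlocks_relabel, labels_map_relabel] at hl
    obtain ⟨m, hm, rfl⟩ := List.mem_map.1 hl
    rw [hσ']
    · omega
    · rintro ⟨i, hi, hin, rfl⟩
      exact hout i hi hin hm
  have h₂ := sameKnot_markers (β := β) hL (fun l hl hln => hσ l hl hln) hβ hR hn h₁.right
  have hR' : Outside n (ofBlocks (markers β n) ++ ofBlocks (B.map (Block.relabel σ))) := by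
    intro l hl
    rw [labels_append, List.mem_append] at hl
    rcases hl with hl | hl
    · obtain ⟨t, ht, rfl | rfl⟩ := mem_labels_markers hl
      exacts [Or.inl ht, Or.inr (hβ t ht)]
    · exact Or.inr (hR l hl)
  have h₃ := sameKnot_of_joins hT hR' h₂.right
  refine ⟨T.blocks ++ (markers β n ++ B.map (Block.relabel σ)), ?_, ?_, ?_⟩
  · have e' : (T.blocks.flatMap Block.items).map Item.node = ofBlocks T.blocks := by
      rw [List.map_flatMap]
      rfl
    rw [e', ← ofBlocks_append, ← ofBlocks_append] at h₃
    exact h₁.trans (h₂.trans (by rwa [← ofBlocks_append]))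
  · rw [weights_append, weights_append, weights_markers, weights_relabel, zero_add]
  · rw [List.countP_append, List.countP_append, countP_markers, countP_isTriple_relabel, zero_add]

end Diagram
end KnotTheory
-- Numbers of delta-crossings that suffice.
namespace KnotTheory

open Node

namespace Diagram

open HalfEdge

/-- Turning permutes the strands cyclically, so at most two turns put strand `1` in the middle; then
all three flags agree. -/
theorem exists_heights_middle : ∀ h : Equiv.Perm (Fin 3), ∃ t : Bool, heights t t t = h ∨
    heights t t t = (finRotate 3).trans h ∨
    heights t t t = (finRotate 3).trans ((finRotate 3).trans h) := by
  decide

/-- A triple crossing can be replaced by two delta-crossings. -/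
theorem exists_blocks_of_triple {h : Equiv.Perm (Fin 3)} {a b c d e f : ℕ} {B : List Block}
    (hD : IsKnotDiagram (triple h a b c d e f :: ofBlocks B)) :
    ∃ B', SameKnot (triple h a b c d e f :: ofBlocks B) (ofBlocks B') ∧
      weights B' = 2 + weights B ∧ B'.countP Block.isTriple = B.countP Block.isTriple := by
  have key : ∀ (t : Bool) (a b c d e f : ℕ),
      IsKnotDiagram (triple (heights t t t) a b c d e f :: ofBlocks B) →
      ∃ B', SameKnot (triple (heights t t t) a b c d e f :: ofBlocks B) (ofBlocks B') ∧
        weights B' = 2 + weights B ∧ B'.countP Block.isTriple = B.countP Block.isTriple := by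
    intro t a b c d e f hD
    obtain ⟨B', h₁, h₂, h₃⟩ := (triplePlan t).exists_blocks (triplePlan_works t) (by omega)
      (fun l => [a, b, c, d, e, f].getD l 0) B hD
    exact ⟨B', h₁, h₂, h₃.trans (Nat.zero_add _)⟩
  obtain ⟨t, ht | ht | ht⟩ := exists_heights_middle h
  · rw [← ht] at hD ⊢
    exact key t _ _ _ _ _ _ hD
  · have h₁ := SameKnot.turn_triple hD
    rw [← ht] at h₁
    obtain ⟨B', h₂, h₃⟩ := key t _ _ _ _ _ _ h₁.right
    exact ⟨B', h₁.trans h₂, h₃⟩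
  · have h₀ := SameKnot.turn_triple hD
    have h₁ := SameKnot.turn_triple h₀.right
    rw [← ht] at h₁
    obtain ⟨B', h₂, h₃⟩ := key t _ _ _ _ _ _ h₁.right
    exact ⟨B', h₀.trans (h₁.trans h₂), h₃⟩

theorem ofBlocks_perm {B C : List Block} (h : B.Perm C) : (ofBlocks B).Perm (ofBlocks C) :=
  h.flatMap_right _

/-- All triple crossings can be replaced by delta-crossings. -/
theorem exists_blocks_without_triple (B : List Block) (hD : IsKnotDiagram (ofBlocks B)) :
    ∃ B', SameKnot (ofBlocks B) (ofBlocks B') ∧ weights B' = weights B ∧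
      B'.countP Block.isTriple = 0 := by
  induction hn : B.countP Block.isTriple generalizing B with
  | zero => exact ⟨B, .refl hD, rfl, hn⟩
  | succ n ih =>
    obtain ⟨b, hb, hb'⟩ := List.countP_pos_iff.1 (by omega : 0 < B.countP Block.isTriple)
    obtain ⟨B₁, B₂, rfl⟩ := List.append_of_mem hb
    have hp : (B₁ ++ b :: B₂).Perm (b :: (B₁ ++ B₂)) := List.perm_middle
    have h₁ := SameKnot.of_perm (ofBlocks_perm hp) hD
    have hc := hp.countP_eq Block.isTriple
    have hw : weights (B₁ ++ b :: B₂) = weights (b :: (B₁ ++ B₂)) := by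
      rw [weights_cons, weights_append, weights_append, weights_cons]
      omega
    rw [List.countP_cons, if_pos hb'] at hc
    cases b with
    | triple s₀₁ s₀₂ s₁₂ a b c d e f =>
      obtain ⟨B', h₂, h₃, h₄⟩ := exists_blocks_of_triple (B := B₁ ++ B₂) h₁.right
      obtain ⟨B'', h₅, h₆, h₇⟩ := ih B' h₂.right (by omega)
      exact ⟨B'', h₁.trans (SameKnot.trans h₂ h₅), by rw [h₆, h₃, hw]; rfl, h₇⟩
    | _ => simp [Block.isTriple] at hb'

theorem exists_deltaCrossings (B : List Block) (hB : B.countP Block.isTriple = 0) :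
    ∃ (T : List DeltaCrossing) (A : List (ℕ × ℕ)), T.length = weights B ∧
      (ofBlocks B).Perm (T.flatMap DeltaCrossing.nodes ++ A.map fun x => arc x.1 x.2) := by
  induction B with
  | nil => exact ⟨[], [], rfl, .refl _⟩
  | cons b B ih =>
    rw [List.countP_cons] at hB
    obtain ⟨T, A, hT, hp⟩ := ih (by omega)
    have e : ofBlocks (b :: B) = b.nodes ++ ofBlocks B := rfl
    cases b with
    | arc a b =>
      refine ⟨T, (a, b) :: A, by rw [weights_cons, hT]; exact (Nat.zero_add _).symm, ?_⟩
      rw [e]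
      exact (hp.cons (arc a b)).trans List.perm_middle.symm
    | delta s a b c d e' f p q r =>
      refine ⟨⟨s, a, b, c, d, e', f, p, q, r⟩ :: T, A, by
        rw [weights_cons, ← hT, List.length_cons, Nat.add_comm]; rfl, ?_⟩
      have e₁ : (Block.delta s a b c d e' f p q r).nodes =
          DeltaCrossing.nodes ⟨s, a, b, c, d, e', f, p, q, r⟩ := by
        rw [Block.nodes, Block.items, Item.map_node_triangle]
        rfl
      rw [e, e₁, List.flatMap_cons, List.append_assoc]
      exact hp.append_left _
    | triple => simp [Block.isTriple] at hB

/-- The delta-crossing number is at most the weight of a diagram made of blocks. -/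
theorem cDelta_le {D : KnotDiagram} {B : List Block} (h : SameKnot D.1 (ofBlocks B)) :
    cDelta D.knot ≤ weights B := by
  obtain ⟨B', h₁, h₂, h₃⟩ := exists_blocks_without_triple B h.right
  obtain ⟨T, A, hT, hp⟩ := exists_deltaCrossings B' h₃
  have h₄ := h.trans h₁
  refine sInf_le ⟨⟨ofBlocks B', h₄.right⟩, weights B, ?_, ⟨T, A, by rw [hT, h₂], hp⟩, rfl⟩
  exact h₄.2.2.symm

/-- A triple crossing with a monogon can be replaced by at most one delta-crossing. -/
theorem exists_blocks_of_monogon {h : Equiv.Perm (Fin 3)} {s a b c d : ℕ} {B : List Block}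
    (hD : IsKnotDiagram (triple h s s a b c d :: ofBlocks B)) :
    ∃ B', SameKnot (triple h s s a b c d :: ofBlocks B) (ofBlocks B') ∧
      weights B' ≤ 1 + weights B := by
  obtain ⟨s₀₁, s₀₂, s₁₂, hl, rfl⟩ := exists_heights h
  obtain ⟨B', h₁, h₂, -⟩ := (monogonPlan s₀₂ s₁₂).exists_blocks
    (monogonPlan_works s₀₁ s₀₂ s₁₂ hl) (by omega) (fun l => [a, b, c, d, s].getD l 0) B hD
  have hw : ∀ s₀₂ s₁₂, weights (monogonPlan s₀₂ s₁₂).blocks ≤ 1 := by decide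
  exact ⟨B', h₁, by have := hw s₀₂ s₁₂; omega⟩

theorem weights_extremePlan : ∀ s₀₁ s₁₂ g₀₁ g₁₂ : Bool,
    weights (extremePlan s₀₁ s₁₂ g₀₁ g₁₂).blocks ≤ 3 := by
  decide

/-- Two triple crossings with two common bigons can be replaced by at most three
delta-crossings. -/
theorem exists_blocks_of_bigons {h g : Equiv.Perm (Fin 3)} {u v w a b c d e f : ℕ}
    {B : List Block}
    (hD : IsKnotDiagram (triple h u v w a b c :: triple g w v u d e f :: ofBlocks B)) :
    ∃ B', SameKnot (triple h u v w a b c :: triple g w v u d e f :: ofBlocks B) (ofBlocks B') ∧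
      weights B' ≤ 3 + weights B := by
  obtain ⟨s₀₁, s₀₂, s₁₂, hs, rfl⟩ := exists_heights h
  obtain ⟨g₀₁, g₀₂, g₁₂, hg, rfl⟩ := exists_heights g
  let ι : ℕ → ℕ := fun l => [a, b, c, d, e, f, u, v, w].getD l 0
  let ι' : ℕ → ℕ := fun l => [d, e, f, a, b, c, w, v, u].getD l 0
  have hlay : ∀ s t r, layered s t r = true → (s = t ∨ r = t) ∧ (s ≠ t → s = !t) ∧
      (r ≠ t → r = !t) := by
    decide
  obtain ⟨hs₁, hs₂, hs₃⟩ := hlay _ _ _ hs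
  obtain ⟨hg₁, hg₂, hg₃⟩ := hlay _ _ _ hg
  have hp : (triple (heights s₀₁ s₀₂ s₁₂) u v w a b c ::
      triple (heights g₀₁ g₀₂ g₁₂) w v u d e f :: ofBlocks B).Perm
      (triple (heights g₀₁ g₀₂ g₁₂) w v u d e f ::
      triple (heights s₀₁ s₀₂ s₁₂) u v w a b c :: ofBlocks B) := .swap _ _ _
  -- The strand through `u` is top or bottom at both triple crossings.
  by_cases h₁ : s₀₁ = s₀₂ ∧ g₁₂ = g₀₂
  · obtain ⟨rfl, rfl⟩ := h₁
    obtain ⟨B', h₂, h₃, -⟩ := (extremePlan s₀₁ s₁₂ g₀₁ g₁₂).exists_blocks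
      (extremePlan_works s₀₁ s₁₂ g₀₁ g₁₂) (by omega) ι B hD
    exact ⟨B', h₂, by have := weights_extremePlan s₀₁ s₁₂ g₀₁ g₁₂; omega⟩
  -- The same for the strand through `w`; exchanging the two triple crossings exchanges the roles of
  -- `u` and `w`.
  by_cases h₂ : g₀₁ = g₀₂ ∧ s₁₂ = s₀₂
  · obtain ⟨rfl, rfl⟩ := h₂
    obtain ⟨B', h₂, h₃, -⟩ := (extremePlan g₀₁ g₁₂ s₀₁ s₁₂).exists_blocks
      (extremePlan_works g₀₁ g₁₂ s₀₁ s₁₂) (by omega) ι' B (hD.perm hp)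
    exact ⟨B', (SameKnot.of_perm hp hD).trans h₂,
      by have := weights_extremePlan g₀₁ g₁₂ s₀₁ s₁₂; omega⟩
  -- Now the strands through `u` and `w` are each in the middle at exactly one of the triple
  -- crossings, and not at the same one.
  by_cases h₃ : s₀₁ = s₀₂
  · have h₄ : g₁₂ ≠ g₀₂ := fun h => h₁ ⟨h₃, h⟩
    have h₅ : g₀₁ = g₀₂ := hg₁.resolve_right h₄
    have h₆ : s₁₂ ≠ s₀₂ := fun h => h₂ ⟨h₅, h⟩
    have h₇ : s₀₂ = !s₁₂ := by rw [hs₃ h₆, Bool.not_not]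
    have h₈ := hg₃ h₄
    subst h₅ h₃ h₈ h₇
    obtain ⟨B', h₂, h₃, -⟩ := (middlePlan' (!s₁₂) s₁₂ g₀₁ g₀₁ (!g₀₁)).exists_blocks
      (middlePlan'_works s₁₂ g₀₁) (by omega) ι B hD
    have hw : ∀ s₁₂ g₀₁, weights (middlePlan' (!s₁₂) s₁₂ g₀₁ g₀₁ (!g₀₁)).blocks ≤ 3 := by decide
    exact ⟨B', h₂, by have := hw s₁₂ g₀₁; omega⟩
  · have h₅ : s₁₂ = s₀₂ := hs₁.resolve_left h₃
    have h₄ : g₀₁ ≠ g₀₂ := fun h => h₂ ⟨h, h₅⟩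
    have h₆ : g₁₂ = g₀₂ := hg₁.resolve_left h₄
    have h₇ := hs₂ h₃
    have h₈ := hg₂ h₄
    subst h₅ h₆ h₇ h₈
    obtain ⟨B', h₂, h₃, -⟩ := (middlePlan (!s₁₂) s₁₂ s₁₂ (!g₁₂) g₁₂ g₁₂).exists_blocks
      (middlePlan_works s₁₂ g₁₂) (by omega) ι B hD
    have hw : ∀ s₀₂ g₁₂, weights (middlePlan (!s₀₂) s₀₂ s₀₂ (!g₁₂) g₁₂ g₁₂).blocks ≤ 3 := by
      decide
    exact ⟨B', h₂, by have := hw s₁₂ g₁₂; omega⟩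

/-- A diagram of triple crossings is composed of blocks. -/
theorem exists_ofBlocks_eq (D : Diagram) (h : ∀ v ∈ D, v.IsTriple) :
    ∃ B, ofBlocks B = D ∧ weights B = 2 * D.length := by
  induction D with
  | nil => exact ⟨[], rfl, rfl⟩
  | cons v D ih =>
    obtain ⟨B, hB, hw⟩ := ih fun w hw => h w (List.mem_cons_of_mem _ hw)
    cases v with
    | triple k a b c d e f =>
      obtain ⟨s₀₁, s₀₂, s₁₂, -, rfl⟩ := exists_heights k
      refine ⟨.triple s₀₁ s₀₂ s₁₂ a b c d e f :: B, by rw [← hB]; rfl, ?_⟩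
      rw [weights_cons, hw, List.length_cons, mul_add, Nat.add_comm]
      rfl
    | arc a b => exact absurd (h _ List.mem_cons_self) id
    | double a b c d => exact absurd (h _ List.mem_cons_self) id

end Diagram
end KnotTheory
-- Bigons and loops in 6-valent diagrams.
namespace KnotTheory

open Node

namespace Diagram

open HalfEdge

/-- Turn a half-edge counterclockwise by `k` steps around its node. -/
def HalfEdge.rot {D : Diagram} (x : HalfEdge D) (k : ℕ) : HalfEdge D := next^[k] x

/-- All nodes of the diagram have six edges. -/
def Hexavalent (D : Diagram) : Prop := ∀ x : HalfEdge D, x.valence = 6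

section rot

variable {D : Diagram}

theorem rot_rot (x : HalfEdge D) (j k : ℕ) : (x.rot j).rot k = x.rot (j + k) := by
  rw [HalfEdge.rot, HalfEdge.rot, HalfEdge.rot, ← Function.iterate_add_apply, add_comm]

theorem rot_zero (x : HalfEdge D) : x.rot 0 = x := rfl

theorem rot_one (x : HalfEdge D) : x.rot 1 = x.next := rfl

theorem rot_fst (x : HalfEdge D) (k : ℕ) : (x.rot k).1 = x.1 := iterate_next_fst x k

theorem Hexavalent.rot_snd (h6 : Hexavalent D) (x : HalfEdge D) (k : ℕ) :
    (x.rot k).2.val = (x.2.val + k) % 6 := by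
  rw [← h6 x]
  exact iterate_next_snd_val x k

theorem Hexavalent.snd_lt (h6 : Hexavalent D) (x : HalfEdge D) : x.2.val < 6 := by
  have := x.snd_lt
  rwa [h6] at this

theorem Hexavalent.rot_eq_rot (h6 : Hexavalent D) (x : HalfEdge D) (j k : ℕ) :
    x.rot j = x.rot k ↔ j % 6 = k % 6 := by
  constructor
  · intro h
    have := congrArg (fun z : HalfEdge D => z.2.val) h
    simp only [h6.rot_snd] at this
    omega
  · intro h
    refine ext' (by rw [rot_fst, rot_fst]) ?_
    rw [h6.rot_snd, h6.rot_snd]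
    omega

theorem Hexavalent.rot_ne (h6 : Hexavalent D) (x : HalfEdge D) {j k : ℕ} (h : j % 6 ≠ k % 6) :
    x.rot j ≠ x.rot k := fun h' => h ((h6.rot_eq_rot x j k).1 h')

theorem Hexavalent.rot_six (h6 : Hexavalent D) (x : HalfEdge D) : x.rot 6 = x :=
  (h6.rot_eq_rot x 6 0).2 rfl

theorem Hexavalent.exists_rot (h6 : Hexavalent D) {x y : HalfEdge D} (h : x.1 = y.1) :
    ∃ k < 6, y = x.rot k := by
  refine ⟨(y.2.val + 6 - x.2.val) % 6, Nat.mod_lt _ (by omega), ext' (by rw [rot_fst, h]) ?_⟩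
  rw [h6.rot_snd]
  have := h6.snd_lt x
  have := h6.snd_lt y
  omega

theorem Hexavalent.opposite_eq (h6 : Hexavalent D) (x : HalfEdge D) : x.opposite = x.rot 3 := by
  have h : (D.get x.1).legs.length = 6 := h6 x
  unfold HalfEdge.opposite
  rw [h]
  rfl

theorem Hexavalent.prev_eq (h6 : Hexavalent D) (x : HalfEdge D) : x.prev = x.rot 5 := by
  refine next_injective ?_
  rw [next_prev, ← rot_one (x.rot 5), rot_rot]
  exact (h6.rot_six x).symm

end rot

/-- The next corner on the boundary of a face. -/
noncomputable def faceNext {D : Diagram} (h : ∀ l ∈ D.labels, D.labels.count l = 2)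
    (x : HalfEdge D) : HalfEdge D := mate h (x.rot 1)

/-- A corner of a bigon face. -/
def IsBigon {D : Diagram} (h : ∀ l ∈ D.labels, D.labels.count l = 2) (x : HalfEdge D) : Prop :=
  faceNext h (faceNext h x) = x

section hexavalent

variable {D : Diagram} (h : ∀ l ∈ D.labels, D.labels.count l = 2)

theorem mate_injective : Function.Injective (mate h) := fun x y hxy => by
  rw [← mate_mate h x, hxy, mate_mate]

theorem mate_eq_iff {x y : HalfEdge D} : mate h x = y ↔ mate h y = x :=
  ⟨fun e => by rw [← e, mate_mate], fun e => by rw [← e, mate_mate]⟩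

theorem faceNext_injective : Function.Injective (faceNext h) := by
  intro x y hxy
  have := mate_injective h hxy
  exact next_injective this

variable {h}

/-- At a bigon, the two edges of the corner `x` end at the other corner of the bigon. -/
theorem IsBigon.mate_eq {x : HalfEdge D} (hx : IsBigon h x) :
    mate h x = (faceNext h x).rot 1 := (mate_eq_iff h).2 hx

theorem mate_faceNext (x : HalfEdge D) : mate h (faceNext h x) = x.rot 1 := mate_mate h _

/-- Suppose that the second corner is `k` turns away at the same node. For `k = 3` the two edges
close up to a strand that misses `x.rot 2`, contrary to there being only one. Every other `k` gives
a monogon or an edge whose two ends coincide. -/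
theorem IsBigon.node_ne (hD : D.IsKnotDiagram) (h6 : Hexavalent D)
    (hm : ∀ x, faceNext h x ≠ x) {x : HalfEdge D} (hx : IsBigon h x) :
    x.1 ≠ (faceNext h x).1 := by
  intro hn
  obtain ⟨k, hk, hy⟩ := h6.exists_rot hn
  have h₁ := hx.mate_eq
  have h₂ : mate h (x.rot 1) = x.rot k := hy
  rw [hy, rot_rot] at h₁
  interval_cases k
  · exact hm x hy
  · exact mate_ne h _ h₂
  · refine hm (x.rot 1) ?_
    rw [faceNext, rot_rot, mate_eq_iff]
    exact h₂
  · let S : HalfEdge D → Prop := fun z => z = x ∨ z = x.rot 1 ∨ z = x.rot 3 ∨ z = x.rot 4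
    have hS : ∀ z, S z → S (mate h z) := by
      rintro z (rfl | rfl | rfl | rfl)
      · exact Or.inr (Or.inr (Or.inr h₁))
      · exact Or.inr (Or.inr (Or.inl h₂))
      · exact Or.inr (Or.inl ((mate_eq_iff h).1 h₂))
      · exact Or.inl ((mate_eq_iff h).1 h₁)
    have hS' : ∀ z, S z → S z.opposite := by
      intro z hz
      rw [h6.opposite_eq]
      rcases hz with rfl | rfl | rfl | rfl
      · exact Or.inr (Or.inr (Or.inl rfl))
      · exact Or.inr (Or.inr (Or.inr (rot_rot _ _ _)))
      · exact Or.inl ((rot_rot _ _ _).trans (h6.rot_six x))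
      · exact Or.inr (Or.inl ((rot_rot _ _ _).trans ((h6.rot_eq_rot x 7 1).2 rfl)))
    have := eq_of_componentCount hD.one_component S (fun y z hyz => propext ⟨fun hy => ?_,
      fun hz => ?_⟩) (fun y => propext ⟨hS' y, fun hy => ?_⟩) x (x.rot 2)
    · have h₃ : S (x.rot 2) := this ▸ Or.inl rfl
      rcases h₃ with h₃ | h₃ | h₃ | h₃
      · exact h6.rot_ne x (j := 2) (k := 0) (by decide) h₃
      · exact h6.rot_ne x (by decide) h₃
      · exact h6.rot_ne x (by decide) h₃
      · exact h6.rot_ne x (by decide) h₃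
    · rcases eq_or_eq_mate h hyz.symm with rfl | rfl
      exacts [hy, hS _ hy]
    · rcases eq_or_eq_mate h hyz with rfl | rfl
      exacts [hz, hS _ hz]
    · have := hS' _ hy
      rwa [h6.opposite_eq, h6.opposite_eq, rot_rot, h6.rot_six] at this
  · refine hm (x.rot 5) ?_
    rw [faceNext, rot_rot, h6.rot_six]
    exact h₁
  · rw [h6.rot_six] at h₁
    exact mate_ne h _ h₁

/-- The two ends of an edge are not at distance two at a node. -/
theorem mate_ne_rot_two (hD : D.IsKnotDiagram) (h6 : Hexavalent D) (x : HalfEdge D) :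
    mate h x ≠ x.rot 2 := by
  intro hx
  have hl : ∀ y : HalfEdge D, y.label = x.label ↔ y = x ∨ y = x.rot 2 := by
    intro y
    rw [← hx]
    exact ⟨eq_or_eq_mate h, by rintro (rfl | rfl); exacts [rfl, label_mate h x]⟩
  have h02 : x ≠ x.rot 2 := h6.rot_ne x (j := 0) (k := 2) (by decide)
  -- The edge is a loop, hence a cycle, and on the sphere it bounds a set of faces `g`. What follows
  -- is a handshake argument for the part of the graph on one side of the loop, where an odd number
  -- of half-edges would start at the node of `x`.
  obtain ⟨g, hg⟩ := exists_faceCoboundary_eq hD (Pi.single x.edge 1) (fun f => by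
    rw [single_dotProduct, one_mul, nodeCoboundary_edge h, hx, rot_fst]
    exact CharTwo.add_self_eq_zero _)
  have hgx : ∀ y : HalfEdge D, g y.face + g y.prev.face = if y.label = x.label then 1 else 0 := by
    intro y
    rw [← faceCoboundary_edge h, hg, Pi.single_apply]
    refine if_congr ?_ rfl rfl
    rw [HalfEdge.edge_eq_iff]
    rfl
  have hprev : ∀ y : HalfEdge D, g y.prev.face = g y.face + if y.label = x.label then 1 else 0 := by
    intro y
    rw [← hgx y, ← add_assoc, CharTwo.add_self_eq_zero, zero_add]
  -- The two ends of an edge contribute the same product.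
  have S₀ : ∑ y : HalfEdge D, g y.face * g y.prev.face = 0 := by
    refine Finset.sum_involution (fun y _ => mate h y) (fun y _ => ?_) (fun y _ _ => mate_ne h y)
      (fun _ _ => Finset.mem_univ _) (fun y _ => mate_mate h y)
    have e : (mate h y).prev.face = y.face := by rw [← face_mate h, mate_mate]
    rw [e, face_mate h, mul_comm (g y.prev.face)]
    exact CharTwo.add_self_eq_zero _
  have hsq : ∀ a : ZMod 2, a * a = a := by decide
  -- Since six is even, the corners at a node fall into neighbouring pairs. A pair contributes only
  -- if it is separated by an end of the loop, and the two ends of the loop have positions of equal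
  -- parity, so they count twice or not at all.
  have S₁ : ∑ y : HalfEdge D, g y.face = 0 := by
    have hev : ∑ y : HalfEdge D, g y.face =
        ∑ y : HalfEdge D, if y.2.val % 2 = 1 then g y.face + g y.prev.face else 0 := by
      have e₁ : ∑ y : HalfEdge D, (if y.2.val % 2 = 1 then g y.prev.face else 0) =
          ∑ y : HalfEdge D, if y.2.val % 2 = 1 then 0 else g y.face := by
        refine Fintype.sum_equiv (nextEquiv D).symm _ _ fun y => ?_
        change _ = if y.prev.2.val % 2 = 1 then 0 else g y.prev.face
        have e : y.prev.2.val = (y.2.val + 5) % 6 := by rw [h6.prev_eq, h6.rot_snd]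
        by_cases hy : y.2.val % 2 = 1
        · rw [if_pos hy, if_neg (by omega)]
        · rw [if_neg hy, if_pos (by omega)]
      have e₂ : ∀ y : HalfEdge D, (if y.2.val % 2 = 1 then g y.face + g y.prev.face else 0) =
          (if y.2.val % 2 = 1 then g y.face else 0) +
            if y.2.val % 2 = 1 then g y.prev.face else 0 := by
        intro y
        split_ifs <;> simp
      rw [Finset.sum_congr rfl fun y _ => e₂ y, Finset.sum_add_distrib, e₁,
        ← Finset.sum_add_distrib]
      refine Finset.sum_congr rfl fun y _ => ?_
      split_ifs <;> simp
    rw [hev]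
    simp only [hgx]
    have e₃ : ∀ y : HalfEdge D, (if y.2.val % 2 = 1 then
        (if y.label = x.label then (1 : ZMod 2) else 0) else 0) =
        if y.label = x.label then (if x.2.val % 2 = 1 then 1 else 0) else 0 := by
      intro y
      by_cases hy : y.label = x.label
      · have : y.2.val % 2 = x.2.val % 2 := by
          rcases (hl y).1 hy with rfl | rfl
          · rfl
          · rw [h6.rot_snd]
            omega
        simp only [this, hy, if_true]
      · simp [hy]
    rw [Finset.sum_congr rfl fun y _ => e₃ y, sum_label h]
    exact CharTwo.add_self_eq_zero _
  have S₂ : ∑ y : HalfEdge D, g y.face * g y.prev.face =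
      ∑ y : HalfEdge D, g y.face +
        ∑ y : HalfEdge D, if y.label = x.label then g y.face else 0 := by
    rw [← Finset.sum_add_distrib]
    refine Finset.sum_congr rfl fun y _ => ?_
    rw [hprev, mul_add, hsq]
    split_ifs <;> simp
  rw [S₀, S₁, zero_add, sum_label h, hx] at S₂
  -- The sums force `g` to agree at the corners `x` and `x.rot 2`. But `x` and `x.rot 1` are on the
  -- same side of the loop, and `x.rot 2` is on the other.
  have e₀ := hgx (x.rot 2)
  rw [if_pos ((hl _).2 (Or.inr rfl))] at e₀
  have e₁ := hgx (x.rot 1)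
  rw [if_neg (fun h' => by
    rcases (hl _).1 h' with h' | h'
    · exact h6.rot_ne x (j := 1) (k := 0) (by decide) h'
    · exact h6.rot_ne x (by decide) h')] at e₁
  have p₂ : (x.rot 2).prev = x.rot 1 := prev_next (x.rot 1)
  have p₁ : (x.rot 1).prev = x := prev_next x
  rw [p₂] at e₀
  rw [p₁] at e₁
  have : ∀ a b c : ZMod 2, 0 = a + b → b + c = 1 → c + a = 0 → False := by decide
  exact this _ _ _ S₂ e₀ e₁

end hexavalent

end Diagram
end KnotTheory
-- Detection of the tangles `T₃` and `T₄`.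
namespace KnotTheory

open Node

namespace Diagram

open HalfEdge

section select

variable {D : Diagram}

/-- List some nodes of a diagram first. -/
theorem exists_perm_of_nodup {I : List (Fin D.length)} (hI : I.Nodup) :
    ∃ R, D.Perm (I.map D.get ++ R) := by
  obtain ⟨I', hI', hs⟩ := hI.subperm (l₂ := List.finRange D.length) fun i _ => List.mem_finRange i
  obtain ⟨J, hJ⟩ := hs.exists_perm_append
  refine ⟨J.map D.get, ?_⟩
  rw [← List.map_append]
  have := (hJ.trans (hI'.append_right J)).map D.get
  rwa [List.map_get_finRange] at this

theorem Hexavalent.label_rot (h6 : Hexavalent D) (x : HalfEdge D) (j : ℕ) :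
    (x.rot j).label = ((D.get x.1).legs).getD ((x.2.val + j) % 6) 0 := by
  rw [← getD_legs, h6.rot_snd]
  simp only [rot_fst]
  rfl

theorem Hexavalent.rotate_legs (h6 : Hexavalent D) (x : HalfEdge D) :
    (D.get x.1).legs.rotate x.2.val = [x.label, (x.rot 1).label, (x.rot 2).label,
      (x.rot 3).label, (x.rot 4).label, (x.rot 5).label] := by
  have hlen : (D.get x.1).legs.length = 6 := h6 x
  change _ = (List.range 6).map fun j => (x.rot j).label
  refine List.ext_getElem (by
    rw [List.length_rotate, List.length_map, List.length_range]
    exact hlen) fun j h₁ h₂ => ?_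
  rw [List.getElem_rotate, List.getElem_map, h6.label_rot, List.getElem_range,
    List.getD_eq_getElem _ _ (lt_of_lt_of_eq (Nat.mod_lt _ (by omega)) hlen.symm)]
  congr 1
  exact (congrArg ((j + x.2.val) % ·) hlen).trans (by rw [add_comm])

theorem Hexavalent.cycle_legs (h6 : Hexavalent D) (x : HalfEdge D) :
    ((D.get x.1).legs : Cycle ℕ) = ([x.label, (x.rot 1).label, (x.rot 2).label,
      (x.rot 3).label, (x.rot 4).label, (x.rot 5).label] : Cycle ℕ) := by
  rw [← h6.rotate_legs]
  exact Cycle.coe_eq_coe.2 ⟨_, rfl⟩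

theorem exists_projection {D : KnotDiagram} {I : List (Fin D.1.length)} (hI : I.Nodup) :
    ∃ R : Multiset (Cycle ℕ), D.projection =
      ((I.map fun i => ((D.1.get i).legs : Cycle ℕ) : List (Cycle ℕ)) : Multiset (Cycle ℕ)) +
        R := by
  obtain ⟨R, hR⟩ := exists_perm_of_nodup hI
  refine ⟨(R.map fun v => (v.legs : Cycle ℕ) : List (Cycle ℕ)), ?_⟩
  rw [KnotDiagram.projection, Multiset.coe_add, Multiset.coe_eq_coe]
  have := hR.map fun v => (v.legs : Cycle ℕ)
  rwa [List.map_append, List.map_map] at this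

end select

section configurations

variable {D : KnotDiagram} {h : ∀ l ∈ D.1.labels, D.1.labels.count l = 2}

/-- A bigon next to a triangle. -/
theorem hasT₃_of_bigon (h6 : Hexavalent D.1) (hm : ∀ x, faceNext h x ≠ x) {x : HalfEdge D.1}
    (hx : IsBigon h x)
    (ht : faceNext h (faceNext h (faceNext h (x.rot 1))) = x.rot 1) : D.HasT₃ := by
  have hxy := hx.node_ne D.2 h6 hm
  obtain ⟨c, hc⟩ : ∃ c, c = faceNext h (x.rot 1) := ⟨_, rfl⟩
  obtain ⟨d, hd⟩ : ∃ d, d = faceNext h c := ⟨_, rfl⟩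
  rw [← hc, ← hd] at ht
  have m₁ : mate h (x.rot 2) = c := by rw [hc, faceNext, rot_rot]
  have m₂ : mate h d = c.rot 1 := by rw [hd, mate_faceNext]
  have m₃ : faceNext h x = d.rot 1 := by
    rw [faceNext, mate_eq_iff]
    exact ht
  have m₄ : mate h x = d.rot 2 := by rw [hx.mate_eq, m₃, rot_rot]
  have hxd : x.1 ≠ d.1 := by rwa [m₃, rot_fst] at hxy
  -- Each coincidence of nodes leads to a monogon, an edge whose ends coincide, a loop excluded by
  -- `mate_ne_rot_two`, or two different other ends of one edge.
  have hxc : x.1 ≠ c.1 := by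
    intro hn
    obtain ⟨k, hk, rfl⟩ := h6.exists_rot hn
    rw [rot_rot] at m₂
    interval_cases k
    · exact mate_ne_rot_two D.2 h6 x ((mate_eq_iff h).1 m₁)
    · exact hm (x.rot 1) (by rw [faceNext, rot_rot]; exact m₁)
    · exact mate_ne h _ m₁
    · exact hm (x.rot 2) (by rw [faceNext, rot_rot, mate_eq_iff]; exact m₁)
    · exact mate_ne_rot_two D.2 h6 (x.rot 2) (by rw [rot_rot]; exact m₁)
    · rw [h6.rot_six, mate_eq_iff, m₄] at m₂
      exact h6.rot_ne d (j := 2) (k := 0) (by decide) m₂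
  have hdc : d.1 ≠ c.1 := by
    intro hn
    obtain ⟨k, hk, rfl⟩ := h6.exists_rot hn
    rw [rot_rot] at m₂
    interval_cases k
    · exact hm d (by rw [faceNext, mate_eq_iff]; exact m₂)
    · exact mate_ne_rot_two D.2 h6 d m₂
    · rw [← m₄] at m₁
      exact h6.rot_ne x (j := 2) (k := 0) (by decide) (mate_injective h m₁)
    · refine mate_ne_rot_two (h := h) D.2 h6 (d.rot 4) ?_
      rw [rot_rot, h6.rot_six, mate_eq_iff]
      exact m₂
    · refine hm (d.rot 5) ?_
      rw [faceNext, rot_rot, h6.rot_six]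
      exact m₂
    · rw [h6.rot_six] at m₂
      exact mate_ne h _ m₂
  have l₁ : c.label = (x.rot 2).label := by rw [← m₁, label_mate]
  have l₂ : (c.rot 1).label = d.label := by rw [← m₂, label_mate]
  have l₃ : (d.rot 1).label = (x.rot 1).label := by rw [← m₃, faceNext, label_mate]
  have l₄ : (d.rot 2).label = x.label := by rw [← m₄, label_mate]
  obtain ⟨R, hR⟩ := exists_projection (D := D) (I := [d.1, x.1, c.1])
    (by simp [hxd.symm, hxc, hdc])
  refine ⟨x.label, (x.rot 1).label, (x.rot 2).label, d.label, (d.rot 3).label,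
    (d.rot 4).label, (d.rot 5).label, (x.rot 3).label, (x.rot 4).label, (x.rot 5).label,
    (c.rot 2).label, (c.rot 3).label, (c.rot 4).label, (c.rot 5).label, R, ?_⟩
  rw [hR, List.map_cons, List.map_cons, List.map_cons, h6.cycle_legs d, h6.cycle_legs x,
    h6.cycle_legs c, l₁, l₂, l₃, l₄]
  rfl

/-- The edges of a bigon that lies at the side `z` of a face. -/
theorem mate_of_isBigon {z w : HalfEdge D.1} (h6 : Hexavalent D.1)
    (hm : ∀ x, faceNext h x ≠ x) (hz : IsBigon h (z.rot 5)) (hw : faceNext h w = z) :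
    mate h z = w.rot 1 ∧ mate h (z.rot 5) = w.rot 2 ∧ w.1 ≠ z.1 := by
  have h₁ : mate h z = w.rot 1 := by rw [← hw, mate_faceNext]
  have h₂ : faceNext h (z.rot 5) = w.rot 1 := by rw [faceNext, rot_rot, h6.rot_six, h₁]
  refine ⟨h₁, by rw [hz.mate_eq, h₂, rot_rot], ?_⟩
  have := hz.node_ne D.2 h6 hm
  rw [h₂, rot_fst, rot_fst] at this
  exact this.symm

/-- The corner `z.rot 5` lies across the edge of `z`, so bigons are attached to three consecutive
sides of the face. Their nodes form the chain of `T₄`; consecutive ones differ because the corners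
of a bigon lie at different nodes, and the other three pairs are assumed to differ. -/
theorem hasT₄_of_bigons (h6 : Hexavalent D.1) (hm : ∀ x, faceNext h x ≠ x)
    {w z₀ z₁ z₂ : HalfEdge D.1} (e₀ : faceNext h w = z₀) (e₁ : faceNext h z₀ = z₁)
    (e₂ : faceNext h z₁ = z₂) (b₀ : IsBigon h (z₀.rot 5)) (b₁ : IsBigon h (z₁.rot 5))
    (b₂ : IsBigon h (z₂.rot 5)) (n₁ : w.1 ≠ z₁.1) (n₂ : w.1 ≠ z₂.1) (n₃ : z₀.1 ≠ z₂.1) :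
    D.HasT₄ := by
  obtain ⟨m₁, m₂, n₄⟩ := mate_of_isBigon h6 hm b₀ e₀
  obtain ⟨m₃, m₄, n₅⟩ := mate_of_isBigon h6 hm b₁ e₁
  obtain ⟨m₅, m₆, n₆⟩ := mate_of_isBigon h6 hm b₂ e₂
  have l₁ : (w.rot 1).label = z₀.label := by rw [← m₁, label_mate]
  have l₂ : (w.rot 2).label = (z₀.rot 5).label := by rw [← m₂, label_mate]
  have l₃ : (z₀.rot 1).label = z₁.label := by rw [← m₃, label_mate]
  have l₄ : (z₀.rot 2).label = (z₁.rot 5).label := by rw [← m₄, label_mate]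
  have l₅ : (z₁.rot 1).label = z₂.label := by rw [← m₅, label_mate]
  have l₆ : (z₁.rot 2).label = (z₂.rot 5).label := by rw [← m₆, label_mate]
  have hrot : ∀ (z : HalfEdge D.1) (k : ℕ), (z.rot (k + 6)).label = (z.rot k).label :=
    fun z k => by rw [(h6.rot_eq_rot z (k + 6) k).2 (Nat.add_mod_right k 6)]
  obtain ⟨R, hR⟩ := exists_projection (D := D)
    (I := [(w.rot 1).1, (z₀.rot 5).1, (z₁.rot 5).1, (z₂.rot 5).1])
    (by simp [rot_fst, n₁, n₂, n₃, n₄, n₅, n₆])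
  refine ⟨(z₀.rot 5).label, (z₁.rot 5).label, (z₂.rot 5).label, z₀.label, z₁.label, z₂.label,
    (w.rot 3).label, (w.rot 4).label, (w.rot 5).label, w.label, (z₀.rot 3).label, (z₀.rot 4).label,
    (z₁.rot 3).label, (z₁.rot 4).label, (z₂.rot 1).label, (z₂.rot 2).label, (z₂.rot 3).label,
    (z₂.rot 4).label, R, ?_⟩
  rw [hR, List.map_cons, List.map_cons, List.map_cons, List.map_cons, h6.cycle_legs (w.rot 1),
    h6.cycle_legs (z₀.rot 5), h6.cycle_legs (z₁.rot 5), h6.cycle_legs (z₂.rot 5)]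
  simp only [rot_rot, Nat.reduceAdd, hrot _ 0, hrot _ 1, hrot _ 2, hrot _ 3, hrot _ 4, l₁, l₂, l₃,
    l₄, l₅, l₆, rot_zero]
  rfl

theorem rot_eq_of_mate {x y : HalfEdge D.1} (h6 : Hexavalent D.1) {j k : ℕ}
    (hj : mate h y = x.rot j) (hk : mate h y = x.rot k) : j % 6 = k % 6 :=
  (h6.rot_eq_rot x j k).1 (hj.symm.trans hk)

/-- The corners `z₀` and `z₂` of a face with bigons at its sides are at different nodes. -/
theorem node_ne_of_bigons (h6 : Hexavalent D.1) (hm : ∀ x, faceNext h x ≠ x)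
    {w z₀ z₁ z₂ z₃ : HalfEdge D.1} (e₀ : faceNext h w = z₀) (e₁ : faceNext h z₀ = z₁)
    (e₂ : faceNext h z₁ = z₂) (e₃ : faceNext h z₂ = z₃) (b₀ : IsBigon h (z₀.rot 5))
    (b₁ : IsBigon h (z₁.rot 5)) (b₂ : IsBigon h (z₂.rot 5)) (h₀₂ : z₂ ≠ z₀)
    (hw : z₃ ≠ w.rot 2) : z₀.1 ≠ z₂.1 := by
  obtain ⟨m₁, m₂, -⟩ := mate_of_isBigon h6 hm b₀ e₀
  obtain ⟨m₃, m₄, -⟩ := mate_of_isBigon h6 hm b₁ e₁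
  obtain ⟨m₅, m₆, -⟩ := mate_of_isBigon h6 hm b₂ e₂
  have m₇ : mate h z₃ = z₂.rot 1 := by rw [← e₃, mate_faceNext]
  rw [mate_eq_iff] at m₃ m₄
  intro hn
  obtain ⟨k, hk, rfl⟩ := h6.exists_rot hn
  rw [rot_rot] at m₆ m₇
  interval_cases k
  · exact h₀₂ rfl
  · exact absurd (rot_eq_of_mate h6 (k := 0) m₅ m₃) (by decide)
  · exact absurd (rot_eq_of_mate h6 m₅ m₄) (by decide)
  · rw [(h6.rot_eq_rot z₀ 8 2).2 rfl] at m₆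
    exact absurd (rot_eq_of_mate h6 m₆ m₄) (by decide)
  -- For distinct corners, this is the only position that the three bigons alone do not exclude.
  · exact hw (((mate_eq_iff h).1 m₇).symm.trans m₂)
  · have e : z₁ = w.rot 1 := by
      refine next_injective ?_
      rw [← rot_one, ← rot_one, rot_rot, ← m₂, m₅]
    rw [e, mate_eq_iff] at m₃
    exact absurd (rot_eq_of_mate h6 (k := 0) m₃ ((mate_eq_iff h).1 m₁)) (by decide)

/-- Three bigons at the sides of a quadrilateral. -/
theorem hasT₄_of_quadrilateral (h6 : Hexavalent D.1) (hm : ∀ x, faceNext h x ≠ x)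
    {z₀ z₁ z₂ z₃ : HalfEdge D.1} (e₀ : faceNext h z₃ = z₀) (e₁ : faceNext h z₀ = z₁)
    (e₂ : faceNext h z₁ = z₂) (e₃ : faceNext h z₂ = z₃) (b₀ : IsBigon h (z₀.rot 5))
    (b₁ : IsBigon h (z₁.rot 5)) (b₂ : IsBigon h (z₂.rot 5)) (h₀₂ : z₂ ≠ z₀) (h₁₃ : z₃ ≠ z₁) :
    D.HasT₄ := by
  obtain ⟨m₁, m₂, n₄⟩ := mate_of_isBigon h6 hm b₀ e₀
  obtain ⟨m₃, m₄, n₅⟩ := mate_of_isBigon h6 hm b₁ e₁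
  obtain ⟨m₅, m₆, n₆⟩ := mate_of_isBigon h6 hm b₂ e₂
  have m₇ : mate h z₃ = z₂.rot 1 := by rw [← e₃, mate_faceNext]
  refine hasT₄_of_bigons h6 hm e₀ e₁ e₂ b₀ b₁ b₂ (fun hn => ?_) (fun hn => ?_)
    (node_ne_of_bigons h6 hm e₀ e₁ e₂ e₃ b₀ b₁ b₂ h₀₂
      (h6.rot_ne z₃ (j := 0) (k := 2) (by decide)))
  · obtain ⟨k, hk, rfl⟩ := h6.exists_rot hn.symm
    rw [rot_rot] at m₁ m₂
    interval_cases k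
    · exact h₁₃ rfl
    · rw [mate_eq_iff] at m₅
      exact absurd (rot_eq_of_mate h6 (k := 0) m₇ m₅) (by decide)
    · rw [mate_eq_iff] at m₆
      exact absurd (rot_eq_of_mate h6 m₇ m₆) (by decide)
    · rw [mate_eq_iff] at m₂
      exact absurd (rot_eq_of_mate h6 m₂ m₄) (by decide)
    · rw [mate_eq_iff] at m₁
      exact absurd (rot_eq_of_mate h6 (j := 0) m₁ m₄) (by decide)
    · rw [mate_eq_iff, h6.rot_six] at m₁
      exact absurd (rot_eq_of_mate h6 (j := 0) m₁ m₃) (by decide)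
  -- The fourth side need not belong to a bigon, so loops along it are excluded separately.
  · obtain ⟨k, hk, rfl⟩ := h6.exists_rot hn.symm
    rw [rot_rot] at m₁
    interval_cases k
    · exact hm _ e₃
    · exact mate_ne h _ m₇
    · refine hm (z₂.rot 1) ?_
      rw [faceNext, rot_rot]
      exact m₇
    · refine mate_ne_rot_two (h := h) D.2 h6 (z₂.rot 1) ?_
      rw [rot_rot, mate_eq_iff]
      exact m₇
    · rw [mate_eq_iff] at m₁
      refine n₅ ?_
      rw [← m₁, m₆, rot_fst]
    · refine n₆ ?_
      have := congrArg Sigma.fst (m₆.symm.trans m₇)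
      rwa [rot_fst, rot_fst] at this

/-- Bigons at all sides of a pentagon. -/
theorem hasT₄_of_pentagon (h6 : Hexavalent D.1) (hm : ∀ x, faceNext h x ≠ x)
    {z₀ z₁ z₂ z₃ z₄ : HalfEdge D.1} (e₀ : faceNext h z₄ = z₀) (e₁ : faceNext h z₀ = z₁)
    (e₂ : faceNext h z₁ = z₂) (e₃ : faceNext h z₂ = z₃) (e₄ : faceNext h z₃ = z₄)
    (b₀ : IsBigon h (z₀.rot 5)) (b₁ : IsBigon h (z₁.rot 5)) (b₂ : IsBigon h (z₂.rot 5))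
    (b₃ : IsBigon h (z₃.rot 5)) (b₄ : IsBigon h (z₄.rot 5)) (h₀₂ : z₂ ≠ z₀) (h₂₄ : z₄ ≠ z₂)
    (h₄₁ : z₁ ≠ z₄) : D.HasT₄ := by
  have key : ∀ {x y : HalfEdge D.1}, x.1 ≠ y.1 → y ≠ x.rot 2 := by
    rintro x _ hxy rfl
    exact hxy (rot_fst x 2).symm
  have n₃ := (mate_of_isBigon h6 hm b₃ e₃).2.2
  have n₄ := (mate_of_isBigon h6 hm b₄ e₄).2.2
  have n₁ := (mate_of_isBigon h6 hm b₁ e₁).2.2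
  -- The three pairs of nodes that are not neighbours in the chain are separated by three different
  -- triples of consecutive sides, which together use all five bigons.
  exact hasT₄_of_bigons h6 hm e₀ e₁ e₂ b₀ b₁ b₂
    (node_ne_of_bigons h6 hm e₄ e₀ e₁ e₂ b₄ b₀ b₁ h₄₁ (key n₃.symm))
    (node_ne_of_bigons h6 hm e₂ e₃ e₄ e₀ b₂ b₃ b₄ h₂₄ (key n₁.symm)).symm
    (node_ne_of_bigons h6 hm e₀ e₁ e₂ e₃ b₀ b₁ b₂ h₀₂ (key n₄.symm))

end configurations

end Diagram
end KnotTheory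
-- Discharging.
namespace KnotTheory

open Node

namespace Diagram

open HalfEdge

theorem length_legs_of_isTriple {v : Node} (hv : v.IsTriple) : v.legs.length = 6 := by
  cases v
  · exact hv.elim
  · exact hv.elim
  · rfl

theorem hexavalent_of_isTriple {D : Diagram} (hD : ∀ v ∈ D, v.IsTriple) : Hexavalent D :=
  fun x => length_legs_of_isTriple (hD _ (List.get_mem D x.1))

theorem length_labels_of_isTriple {D : Diagram} (hD : ∀ v ∈ D, v.IsTriple) :
    D.labels.length = 6 * D.length := by
  induction D with
  | nil => rfl
  | cons v D ih =>
    rw [labels_cons, List.length_append, ih fun w hw => hD w (List.mem_cons_of_mem v hw),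
      length_legs_of_isTriple (hD v List.mem_cons_self), List.length_cons]
    omega

theorem two_mul_edgeCount {D : Diagram} (h : ∀ l ∈ D.labels, D.labels.count l = 2) :
    2 * D.edgeCount = D.labels.length := by
  rw [← List.sum_toFinset_count_eq_length, Finset.sum_congr rfl fun l hl =>
    h l (List.mem_toFinset.1 hl), Finset.sum_const, smul_eq_mul, mul_comm]
  rfl

theorem card_halfEdge_of_isTriple {D : Diagram} (hD : ∀ v ∈ D, v.IsTriple) :
    Fintype.card (HalfEdge D) = 6 * D.length := by
  rw [Fintype.card_sigma, Finset.sum_congr rfl (g := fun _ => 6) fun i _ => ?_, Finset.sum_const,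
    Finset.card_univ, Fintype.card_fin, smul_eq_mul, mul_comm]
  rw [Fintype.card_fin]
  exact length_legs_of_isTriple (hD _ (List.get_mem D i))

/-- A hexavalent diagram with `n` nodes has `2 * n + 2` faces. -/
theorem faceCount_of_isTriple {D : Diagram} (hD : D.IsKnotDiagram) (hT : ∀ v ∈ D, v.IsTriple) :
    D.faceCount = 2 * D.length + 2 := by
  have h₁ := two_mul_edgeCount hD.two_ends
  have h₂ := length_labels_of_isTriple hT
  have h₃ := hD.euler
  omega

theorem sum_iterate_comp {α : Type*} [Fintype α] {φ : α → α} (hφ : Function.Bijective φ)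
    (f : α → ℕ) (i : ℕ) : ∑ x, f (φ^[i] x) = ∑ x, f x :=
  (hφ.iterate i).sum_comp f

/-- It suffices to compare two functions after averaging over iterates. -/
theorem sum_le_sum_of_iterate {α : Type*} [Fintype α] {φ : α → α} (hφ : Function.Bijective φ)
    {f g : α → ℕ} {N : ℕ} (hN : 0 < N)
    (hfg : ∀ x, ∑ i ∈ Finset.range N, f (φ^[i] x) ≤ ∑ i ∈ Finset.range N, g (φ^[i] x)) :
    ∑ x, f x ≤ ∑ x, g x := by
  have key : ∀ f : α → ℕ, ∑ x, ∑ i ∈ Finset.range N, f (φ^[i] x) = N * ∑ x, f x := by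
    intro f
    rw [Finset.sum_comm, Finset.sum_congr rfl fun i _ => sum_iterate_comp hφ f i,
      Finset.sum_const, Finset.card_range, smul_eq_mul]
  have := Finset.sum_le_sum fun x (_ : x ∈ Finset.univ) => hfg x
  rw [key, key] at this
  exact Nat.le_of_mul_le_mul_left this hN

theorem sum_range_of_periodic {u : ℕ → ℕ} {k : ℕ} (hu : Function.Periodic u k) (m : ℕ) :
    ∑ i ∈ Finset.range (k * m), u i = m * ∑ i ∈ Finset.range k, u i := by
  induction m with
  | zero => simp
  | succ m ih =>
    rw [Nat.mul_succ, Finset.sum_range_add, ih, Nat.succ_mul]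
    congr 1
    refine Finset.sum_congr rfl fun i _ => ?_
    rw [add_comm, mul_comm]
    exact hu.nat_mul m i

section faces

variable {D : Diagram} (h : ∀ l ∈ D.labels, D.labels.count l = 2)

theorem face_faceNext (x : HalfEdge D) : (faceNext h x).face = x.face :=
  (Quot.sound ((faceRel_iff h).2 rfl)).symm

theorem face_iterate_faceNext (x : HalfEdge D) (i : ℕ) : ((faceNext h)^[i] x).face = x.face := by
  induction i with
  | zero => rfl
  | succ i ih => rw [Function.iterate_succ_apply', face_faceNext, ih]

theorem faceNext_bijective : Function.Bijective (faceNext h) :=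
  Finite.injective_iff_bijective.1 (faceNext_injective h)

/-- The number of corners of the face at a corner. -/
noncomputable def faceSize (x : HalfEdge D) : ℕ := Function.minimalPeriod (faceNext h) x

theorem mem_periodicPts_faceNext (x : HalfEdge D) : x ∈ Function.periodicPts (faceNext h) :=
  (faceNext_injective h).mem_periodicPts x

theorem faceSize_pos (x : HalfEdge D) : 0 < faceSize h x :=
  Function.minimalPeriod_pos_of_mem_periodicPts (mem_periodicPts_faceNext h x)

theorem faceSize_iterate (x : HalfEdge D) (i : ℕ) :
    faceSize h ((faceNext h)^[i] x) = faceSize h x :=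
  Function.minimalPeriod_apply_iterate (mem_periodicPts_faceNext h x) i

/-- Each face receives at least `60` from its corners if a corner of a face of size `k`
contributes `60 / min k 6`. -/
theorem mul_faceCount_le :
    60 * D.faceCount ≤ ∑ x : HalfEdge D, 60 / min (faceSize h x) 6 := by
  classical
  have : Fintype (Quot (FaceRel (D := D))) := Fintype.ofFinite _
  rw [← Finset.sum_fiberwise Finset.univ (fun x : HalfEdge D => x.face), faceCount,
    Nat.card_eq_fintype_card, mul_comm, ← smul_eq_mul, ← Finset.card_univ]
  refine Finset.card_nsmul_le_sum _ _ _ fun f _ => ?_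
  induction f using Quot.ind with | _ x
  -- For a face with more than six corners, six of them already contribute `60`. As `60` is
  -- divisible by all numbers up to six, nothing is lost by rounding.
  let k := min (faceSize h x) 6
  have hk : 0 < k := lt_min (faceSize_pos h x) (by omega)
  have hinj : Set.InjOn (fun i => (faceNext h)^[i] x) (Finset.range k) := by
    refine (Function.iterate_injOn_Iio_minimalPeriod (f := faceNext h) (x := x)).mono fun i hi => ?_
    exact lt_of_lt_of_le (Finset.mem_range.1 (Finset.mem_coe.1 hi)) (min_le_left _ _)
  have h60 : ∀ m ≤ 6, 0 < m → m * (60 / m) = 60 := by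
    intro m hm hm'
    interval_cases m <;> rfl
  calc 60 = ∑ i ∈ Finset.range k, 60 / min (faceSize h ((faceNext h)^[i] x)) 6 := by
        rw [Finset.sum_congr rfl fun i _ => by rw [faceSize_iterate], Finset.sum_const,
          Finset.card_range, smul_eq_mul, h60 k (min_le_right _ _) hk]
    _ = ∑ y ∈ (Finset.range k).image fun i => (faceNext h)^[i] x, 60 / min (faceSize h y) 6 :=
        (Finset.sum_image (f := fun y => 60 / min (faceSize h y) 6) hinj).symm
    _ ≤ _ := by
        refine Finset.sum_le_sum_of_subset fun y hy => ?_
        obtain ⟨i, -, rfl⟩ := Finset.mem_image.1 hy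
        exact Finset.mem_filter.2 ⟨Finset.mem_univ _, face_iterate_faceNext h x i⟩

end faces

section discharging

variable {D : KnotDiagram} {h : ∀ l ∈ D.1.labels, D.1.labels.count l = 2}

theorem isBigon_iff_faceSize (hm : ∀ x, faceNext h x ≠ x) (x : HalfEdge D.1) :
    IsBigon h x ↔ faceSize h x = 2 := by
  constructor
  · intro hx
    have h₁ : faceSize h x ∣ 2 := Function.IsPeriodicPt.minimalPeriod_dvd hx
    rcases (Nat.dvd_prime Nat.prime_two).1 h₁ with h₂ | h₂
    · exact absurd (Function.minimalPeriod_eq_one_iff_isFixedPt.1 h₂) (hm x)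
    · exact h₂
  · intro hx
    have := Function.isPeriodicPt_minimalPeriod (faceNext h) x
    rwa [show Function.minimalPeriod (faceNext h) x = 2 from hx] at this

theorem iterate_faceSize (x : HalfEdge D.1) : (faceNext h)^[faceSize h x] x = x :=
  Function.iterate_minimalPeriod

/-- Three consecutive sides of a quadrilateral are not all sides of bigons. -/
theorem not_bigons_of_faceSize_eq_four (h6 : Hexavalent D.1) (hm : ∀ x, faceNext h x ≠ x)
    (hT₄ : ¬ D.HasT₄) {x : HalfEdge D.1} (hx : faceSize h x = 4)
    (b₀ : IsBigon h (x.rot 5)) (b₁ : IsBigon h ((faceNext h x).rot 5)) :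
    ¬ IsBigon h ((faceNext h (faceNext h x)).rot 5) := by
  intro b₂
  have hp := iterate_faceSize (h := h) x
  rw [hx] at hp
  have hn : ∀ y, faceSize h y = 4 → faceNext h (faceNext h y) ≠ y := by
    intro y hy hy'
    rw [(isBigon_iff_faceSize hm y).1 hy'] at hy
    omega
  exact hT₄ (hasT₄_of_quadrilateral h6 hm hp rfl rfl rfl b₀ b₁ b₂ (hn x hx)
    (hn _ ((faceSize_iterate h x 1).trans hx)))

/-- The sides of a pentagon are not all sides of bigons. -/
theorem not_bigons_of_faceSize_eq_five (h6 : Hexavalent D.1) (hm : ∀ x, faceNext h x ≠ x)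
    (hT₄ : ¬ D.HasT₄) {x : HalfEdge D.1} (hx : faceSize h x = 5) :
    ¬ ∀ i, IsBigon h (((faceNext h)^[i] x).rot 5) := by
  intro b
  have hp := iterate_faceSize (h := h) x
  rw [hx] at hp
  have hn : ∀ i, faceNext h (faceNext h ((faceNext h)^[i] x)) ≠ (faceNext h)^[i] x := by
    intro i hi
    have := (isBigon_iff_faceSize hm _).1 hi
    rw [faceSize_iterate, hx] at this
    omega
  refine hT₄ (hasT₄_of_pentagon h6 hm hp rfl rfl rfl rfl (b 0) (b 1) (b 2) (b 3) (b 4)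
    (hn 0) (hn 2) fun h₄₁ => hn 4 ?_)
  exact (congrArg (faceNext h) hp).trans h₄₁

open Classical in
/-- The number of bigons at a corner, `0` or `1`. -/
noncomputable def bigonCount (h : ∀ l ∈ D.1.labels, D.1.labels.count l = 2)
    (x : HalfEdge D.1) : ℕ := if IsBigon h x then 1 else 0

theorem bigonCount_eq_one {x : HalfEdge D.1} (hx : IsBigon h x) : bigonCount h x = 1 :=
  if_pos hx

theorem bigonCount_eq_zero {x : HalfEdge D.1} (hx : ¬ IsBigon h x) : bigonCount h x = 0 :=
  if_neg hx

theorem bigonCount_le (x : HalfEdge D.1) : bigonCount h x ≤ 1 := by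
  unfold bigonCount
  split_ifs <;> omega

/-- A choice of three among four cyclically ordered sides is always consecutive. -/
theorem sum_bigonCount_of_faceSize_eq_four (h6 : Hexavalent D.1) (hm : ∀ x, faceNext h x ≠ x)
    (hT₄ : ¬ D.HasT₄) {x : HalfEdge D.1} (hx : faceSize h x = 4) :
    ∑ i ∈ Finset.range 4, bigonCount h (((faceNext h)^[i] x).rot 5) ≤ 2 := by
  have key : ∀ i, ¬ (IsBigon h (((faceNext h)^[i] x).rot 5) ∧
      IsBigon h (((faceNext h)^[i + 1] x).rot 5) ∧
      IsBigon h (((faceNext h)^[i + 2] x).rot 5)) := by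
    rintro i ⟨b₀, b₁, b₂⟩
    refine not_bigons_of_faceSize_eq_four h6 hm hT₄ ((faceSize_iterate h x i).trans hx) b₀ ?_ ?_
    · rwa [Function.iterate_succ_apply'] at b₁
    · rwa [Function.iterate_succ_apply', Function.iterate_succ_apply'] at b₂
  have hp := iterate_faceSize (h := h) x
  rw [hx] at hp
  have hp' : ∀ i, (faceNext h)^[i + 4] x = (faceNext h)^[i] x := fun i => by
    rw [Function.iterate_add_apply, hp]
  have k₀ := key 0
  have k₁ := key 1
  have k₂ := key 2
  have k₃ := key 3
  rw [hp' 0] at k₂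
  rw [hp' 0, hp' 1] at k₃
  simp only [bigonCount, Finset.sum_range_succ, Finset.sum_range_zero]
  simp only [Nat.zero_add] at *
  split_ifs <;> first | omega | tauto

theorem sum_bigonCount_of_faceSize_eq_five (h6 : Hexavalent D.1) (hm : ∀ x, faceNext h x ≠ x)
    (hT₄ : ¬ D.HasT₄) {x : HalfEdge D.1} (hx : faceSize h x = 5) :
    ∑ i ∈ Finset.range 5, bigonCount h (((faceNext h)^[i] x).rot 5) ≤ 4 := by
  by_contra hc
  refine not_bigons_of_faceSize_eq_five h6 hm hT₄ hx fun i => ?_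
  have hp := iterate_faceSize (h := h) x
  rw [hx] at hp
  rw [← Nat.mod_add_div i 5, Function.iterate_add_apply, Function.iterate_mul,
    Function.iterate_fixed hp]
  by_contra hb
  have hlt : ∑ i ∈ Finset.range 5, bigonCount h (((faceNext h)^[i] x).rot 5) <
      ∑ _i ∈ Finset.range 5, 1 :=
    Finset.sum_lt_sum (fun j _ => bigonCount_le _)
      ⟨i % 5, Finset.mem_range.2 (Nat.mod_lt _ (by omega)), by
        rw [bigonCount_eq_zero hb]
        omega⟩
  rw [Finset.sum_const, Finset.card_range, smul_eq_mul] at hlt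
  omega

/-- A bigon corner `z` passes `10` to the corner `z.rot 1`, that is, across the edge between them;
the claim is that afterwards a face has on average at most `20` per corner. Sizes `2`, `3` and at
least `6` work corner by corner: `30 ≤ 20 + 10`, `20 ≤ 20` and `10 + 10 ≤ 20`. Around a
quadrilateral, `4 * 15 + 2 * 10 = 4 * 20`; around a pentagon, `5 * 12 + 4 * 10 = 5 * 20`. Twenty
steps make full rounds of both. -/
theorem sum_iterate_le (h6 : Hexavalent D.1) (hm : ∀ x, faceNext h x ≠ x)
    (hb : ∀ x, IsBigon h x → ¬ IsBigon h (x.rot 1)) (hT₃ : ¬ D.HasT₃) (hT₄ : ¬ D.HasT₄)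
    (x : HalfEdge D.1) :
    ∑ i ∈ Finset.range 20, (60 / min (faceSize h ((faceNext h)^[i] x)) 6 +
        10 * bigonCount h (((faceNext h)^[i] x).rot 5)) ≤
      ∑ i ∈ Finset.range 20, (20 + 10 * bigonCount h ((faceNext h)^[i] x)) := by
  have hper : ∀ k, faceSize h x = k → ∀ f : HalfEdge D.1 → ℕ,
      Function.Periodic (fun i => f ((faceNext h)^[i] x)) k := by
    rintro _ rfl f i
    change f _ = f _
    rw [Function.iterate_add_apply, iterate_faceSize]
  have hpt : (∀ y, faceSize h y = faceSize h x → 60 / min (faceSize h y) 6 +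
      10 * bigonCount h (y.rot 5) ≤ 20 + 10 * bigonCount h y) → ∑ i ∈ Finset.range 20,
      (60 / min (faceSize h ((faceNext h)^[i] x)) 6 +
        10 * bigonCount h (((faceNext h)^[i] x).rot 5)) ≤
      ∑ i ∈ Finset.range 20, (20 + 10 * bigonCount h ((faceNext h)^[i] x)) := fun H =>
    Finset.sum_le_sum fun i _ => H _ (faceSize_iterate h x i)
  have hrot : ∀ y : HalfEdge D.1, (y.rot 5).rot 1 = y := fun y => by
    rw [rot_rot]
    exact h6.rot_six y
  have hpos := faceSize_pos h x
  rcases Nat.lt_or_ge (faceSize h x) 6 with hlt | hge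
  · generalize hk : faceSize h x = k at *
    have hsum : ∑ i ∈ Finset.range 20, (60 / min (faceSize h ((faceNext h)^[i] x)) 6 +
        10 * bigonCount h (((faceNext h)^[i] x).rot 5)) = 20 * (60 / min k 6) +
        10 * ∑ i ∈ Finset.range 20, bigonCount h (((faceNext h)^[i] x).rot 5) := by
      rw [Finset.sum_add_distrib, ← Finset.mul_sum, Finset.sum_congr rfl fun i _ => by
        rw [faceSize_iterate, hk], Finset.sum_const, Finset.card_range, smul_eq_mul]
    have hsum' : ∑ i ∈ Finset.range 20, (20 + 10 * bigonCount h ((faceNext h)^[i] x)) ≥ 400 := by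
      rw [Finset.sum_add_distrib, Finset.sum_const, Finset.card_range, smul_eq_mul]
      omega
    interval_cases k
    · exact absurd (Function.minimalPeriod_eq_one_iff_isFixedPt.1 hk) (hm x)
    · refine hpt fun y hy => ?_
      have h₁ := (isBigon_iff_faceSize hm y).2 hy
      rw [hy, bigonCount_eq_one h₁, bigonCount_eq_zero fun h₂ => hb _ h₂ (by rwa [hrot]),
        show 60 / min 2 6 = 30 from rfl]
    · refine hpt fun y hy => ?_
      rw [hy, bigonCount_eq_zero (x := y.rot 5) fun h₂ => hT₃ (hasT₃_of_bigon h6 hm h₂ ?_),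
        show 60 / min 3 6 = 20 from rfl]
      · omega
      · rw [hrot]
        have hp := iterate_faceSize (h := h) y
        rwa [hy] at hp
    · have e := sum_range_of_periodic (hper 4 rfl fun y => bigonCount h (y.rot 5)) 5
      have := sum_bigonCount_of_faceSize_eq_four h6 hm hT₄ hk
      rw [show 4 * 5 = 20 from rfl] at e
      rw [hsum, e, show 60 / min 4 6 = 15 from rfl]
      omega
    · have e := sum_range_of_periodic (hper 5 rfl fun y => bigonCount h (y.rot 5)) 4
      have := sum_bigonCount_of_faceSize_eq_five h6 hm hT₄ hk
      rw [show 5 * 4 = 20 from rfl] at e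
      rw [hsum, e, show 60 / min 5 6 = 12 from rfl]
      omega
  · refine hpt fun y hy => ?_
    rw [hy, min_eq_right hge]
    have := bigonCount_le (h := h) (y.rot 5)
    omega

/-- A diagram with triple crossings only that contains neither `T₃` nor `T₄` has a monogon or two
bigons at consecutive corners of a node. -/
theorem exists_monogon_or_bigons (hT : ∀ v ∈ D.1, v.IsTriple) (hT₃ : ¬ D.HasT₃)
    (hT₄ : ¬ D.HasT₄) :
    (∃ x, faceNext h x = x) ∨ ((∀ x, faceNext h x ≠ x) ∧
      ∃ x, IsBigon h x ∧ IsBigon h (x.rot 1)) := by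
  by_contra! hc
  obtain ⟨hm, hb⟩ := hc
  specialize hb hm
  have h6 := hexavalent_of_isTriple hT
  have h₁ := mul_faceCount_le h
  have h₂ := sum_le_sum_of_iterate (faceNext_bijective h) (N := 20) (by omega)
    (f := fun x => 60 / min (faceSize h x) 6 + 10 * bigonCount h (x.rot 5))
    (g := fun x => 20 + 10 * bigonCount h x) (sum_iterate_le h6 hm hb hT₃ hT₄)
  -- What is received equals what is passed on, so the transfers drop out and leave `60 * (2 * n +
  -- 2) ≤ 20 * (6 * n)`, where `n` is the number of nodes.
  have h₃ : ∑ x : HalfEdge D.1, bigonCount h (x.rot 5) = ∑ x, bigonCount h x :=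
    ((nextEquiv D.1).bijective.iterate 5).sum_comp (bigonCount h)
  rw [Finset.sum_add_distrib, Finset.sum_add_distrib, ← Finset.mul_sum, ← Finset.mul_sum, h₃,
    Finset.sum_const, Finset.card_univ, smul_eq_mul, card_halfEdge_of_isTriple hT] at h₂
  have := faceCount_of_isTriple D.2 hT
  omega

end discharging

end Diagram
end KnotTheory
-- Conclusion.
namespace KnotTheory

open Node

namespace Diagram

open HalfEdge

theorem exists_eq_triple {v : Node} (hv : v.IsTriple) {a b c d e f : ℕ}
    (hl : v.legs = [a, b, c, d, e, f]) : ∃ k, v = triple k a b c d e f := by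
  cases v with
  | arc => exact hv.elim
  | double => exact hv.elim
  | triple k =>
    simp only [legs, List.cons.injEq, and_true] at hl
    obtain ⟨rfl, rfl, rfl, rfl, rfl, rfl⟩ := hl
    exact ⟨k, rfl⟩

theorem SameKnot.exists_rotate {v : Node} {R : Diagram} (hv : v.IsTriple)
    (hD : IsKnotDiagram (v :: R)) (j : ℕ) :
    ∃ v' : Node, v'.IsTriple ∧ v'.legs = v.legs.rotate j ∧ SameKnot (v :: R) (v' :: R) := by
  induction j with
  | zero => exact ⟨v, hv, (List.rotate_zero _).symm, .refl hD⟩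
  | succ j ih =>
    obtain ⟨v', h₁, h₂, h₃⟩ := ih
    cases v' with
    | arc => exact h₁.elim
    | double => exact h₁.elim
    | triple k a b c d e f =>
      refine ⟨triple ((finRotate 3).trans k) b c d e f a, trivial, ?_,
        h₃.trans (.turn_triple h₃.right)⟩
      rw [← List.rotate_rotate, ← h₂]
      rfl

/-- Read the edges at a triple crossing from any of them. -/
theorem SameKnot.exists_turn {D : Diagram} {x : HalfEdge D} {R : Diagram}
    (hT : ∀ v ∈ D, v.IsTriple) (hD : IsKnotDiagram (D.get x.1 :: R)) :
    ∃ k, SameKnot (D.get x.1 :: R) (triple k x.label (x.rot 1).label (x.rot 2).label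
      (x.rot 3).label (x.rot 4).label (x.rot 5).label :: R) := by
  obtain ⟨v', h₁, h₂, h₃⟩ := SameKnot.exists_rotate (hT _ (List.get_mem D x.1)) hD x.2.val
  rw [(hexavalent_of_isTriple hT).rotate_legs] at h₂
  obtain ⟨k, rfl⟩ := exists_eq_triple h₁ h₂
  exact ⟨k, h₃⟩

variable {D : KnotDiagram} {h : ∀ l ∈ D.1.labels, D.1.labels.count l = 2}

/-- The node with the monogon costs at most one delta-crossing, and every other node costs two. -/
theorem cDelta_lt_of_monogon (hT : ∀ v ∈ D.1, v.IsTriple) {x : HalfEdge D.1}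
    (hx : faceNext h x = x) : ∃ m < 2 * D.1.length, cDelta D.knot ≤ m := by
  obtain ⟨R, hR⟩ := exists_perm_of_nodup (D := D.1) (I := [x.1]) (List.nodup_singleton _)
  obtain ⟨k, hk⟩ := SameKnot.exists_turn hT (D.2.perm hR)
  have hRT : ∀ v ∈ R, v.IsTriple := fun v hv =>
    hT v (hR.mem_iff.2 (List.mem_append_right _ hv))
  obtain ⟨B, rfl, hB⟩ := exists_ofBlocks_eq R hRT
  have hl : x.label = (x.rot 1).label := by
    conv_lhs => rw [← hx]
    exact label_mate h _
  rw [← hl] at hk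
  obtain ⟨B', h₁, h₂⟩ := exists_blocks_of_monogon hk.right
  refine ⟨weights B', ?_, cDelta_le (((SameKnot.of_perm hR D.2).trans hk).trans h₁)⟩
  have := hR.length_eq
  rw [List.length_append, List.length_map, List.length_singleton] at this
  omega

/-- Both bigons have the edge of `x.rot 1` as a side, so they end at the same second node `z.1`. The
two nodes are different and share three consecutive edges in opposite cyclic orders; together they
cost at most three delta-crossings. -/
theorem cDelta_lt_of_bigons (hT : ∀ v ∈ D.1, v.IsTriple) (hm : ∀ x, faceNext h x ≠ x)
    {x : HalfEdge D.1} (hx : IsBigon h x) (hx' : IsBigon h (x.rot 1)) :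
    ∃ m < 2 * D.1.length, cDelta D.knot ≤ m := by
  have h6 := hexavalent_of_isTriple hT
  obtain ⟨z, hz⟩ : ∃ z, z = faceNext h (x.rot 1) := ⟨_, rfl⟩
  have hy : faceNext h x = z.rot 1 := by
    rw [hz]
    exact hx'.mate_eq
  have hne : x.1 ≠ z.1 := by
    have := hx.node_ne D.2 h6 hm
    rwa [hy, rot_fst] at this
  have l₀ : z.label = (x.rot 2).label := by
    rw [hz, faceNext, label_mate, rot_rot]
  have l₁ : (z.rot 1).label = (x.rot 1).label := by
    rw [← hy, faceNext, label_mate]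
  have l₂ : (z.rot 2).label = x.label := by
    rw [← label_mate h x, hx.mate_eq, hy, rot_rot]
  obtain ⟨R, hR⟩ := exists_perm_of_nodup (D := D.1) (I := [x.1, z.1]) (by simpa using hne)
  obtain ⟨B, rfl, hB⟩ := exists_ofBlocks_eq R fun v hv =>
    hT v (hR.mem_iff.2 (List.mem_append_right _ hv))
  obtain ⟨k, hk⟩ := SameKnot.exists_turn hT (D.2.perm hR)
  have s₁ := hk.trans (.of_perm (List.Perm.swap _ _ _) hk.right)
  obtain ⟨g, hg⟩ := SameKnot.exists_turn hT s₁.right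
  have s₂ := (s₁.trans hg).trans (.of_perm (List.Perm.swap _ _ _) hg.right)
  rw [l₀, l₁, l₂] at s₂
  obtain ⟨B', h₁, h₂⟩ := exists_blocks_of_bigons s₂.right
  refine ⟨weights B', ?_, cDelta_le (((SameKnot.of_perm hR D.2).trans s₂).trans h₁)⟩
  have := hR.length_eq
  rw [List.length_append, List.length_map, List.length_cons, List.length_singleton] at this
  omega

theorem knot_eq_unknot {a : ℕ} (hD : D.1 = [arc a a]) : D.knot = unknot := by
  have := SameKnot.relabel D.2 (Equiv.swap a 0).injective
  rw [hD] at this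
  have e : List.map (Node.relabel (Equiv.swap a 0)) [arc a a] = [arc 0 0] := by
    simp [Node.relabel]
  rw [e] at this
  obtain ⟨h₁, h₂, h₃⟩ := this
  have hD' : D = ⟨[arc a a], h₁⟩ := Subtype.ext hD
  rw [hD']
  exact h₃

theorem tripleCount_of_isTriple (hT : ∀ v ∈ D.1, v.IsTriple) : D.tripleCount = D.1.length := by
  classical
  rw [KnotDiagram.tripleCount, List.countP_eq_length]
  exact fun v hv => decide_eq_true (hT v hv)

end Diagram
end KnotTheory
-- The form with `+ 1` avoids truncated subtraction, which would weaken the claim for `c₃ K = 0`.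
theorem mainTheorem5 (K : KnotTheory.Knot) (hK : K ≠ KnotTheory.unknot)
    (D : KnotTheory.KnotDiagram) (hD : D.IsMinimalTripleCrossing K)
    (hT₃ : ¬ D.HasT₃) (hT₄ : ¬ D.HasT₄) :
    KnotTheory.cDelta K + 1 ≤ 2 * KnotTheory.c₃ K := by
  obtain ⟨rfl, hT | ⟨a, ha⟩, hc⟩ := hD
  · obtain ⟨m, hm, hle⟩ : ∃ m < 2 * D.1.length, KnotTheory.cDelta D.knot ≤ m := by
      rcases KnotTheory.Diagram.exists_monogon_or_bigons (h := D.2.two_ends) hT hT₃ hT₄ with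
        ⟨x, hx⟩ | ⟨hm, x, hx, hx'⟩
      · exact KnotTheory.Diagram.cDelta_lt_of_monogon hT hx
      · exact KnotTheory.Diagram.cDelta_lt_of_bigons hT hm hx hx'
    rw [← hc, KnotTheory.Diagram.tripleCount_of_isTriple hT]
    calc KnotTheory.cDelta D.knot + 1 ≤ (m : ℕ∞) + 1 := by gcongr
      _ ≤ 2 * (D.1.length : ℕ∞) := by exact_mod_cast hm
  -- The circle without crossings has no crossing at which a delta-crossing could be saved;
  -- non-triviality of the knot rules it out.
  · exact absurd (KnotTheory.Diagram.knot_eq_unknot ha) hK
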